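/- Let $\mathbb O_{\mathbb C}=\mathbb O\otimes\mathbb C$ be the complexified octonions with basis $1,e_1,\dots,e_7$, where $e_i^2=-1$, $e_ie_j=-e_je_i$ for $i\ne j$, and the products are fixed by the seven relations $e_1e_2=-e_5$, $e_1e_3=-e_6$, $e_1e_4=-e_7$, $e_2e_3=-e_7$, $e_2e_4=e_6$, $e_3e_4=-e_5$, $e_5e_6=e_7$ and those obtained from each of them by cyclic permutation. Let $\mathbb G_2\subset \mathrm{SO}(7,\mathbb C)$ be the automorphism group of $\mathbb O_{\mathbb C}$ acting on $\mathbb C^7=\operatorname{Im}\mathbb O\otimes\mathbb C$, let $\langle\cdot,\cdot\rangle$ be the complex bilinear extension of the standard inner product of $\mathbb R^7$ (so that $\perp$ and "isotropic" refer to it), and let $x\cdot y\in\mathbb C^7$ be the imaginary part of the octonionic product of $x,y\in\mathbb C^7$. Put $\tau(g)=\bar g$ and $\sigma(g)=sgs^{-1}$ with $s=\operatorname{diag}(-1,-1,-1,-1,1,1,1)$; these define the symmetric space $G_2/\mathrm{SO}(4)$. Let $\mathcal L_-^{\tau,\sigma}(\mathbb G_2,\mathbb C^7)$ be the group of maps $g$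 from an open dense subset of $\mathbb{CP}^1$ to $\mathbb G_2$ (two maps being identified if they agree on an open dense set) that are holomorphic, extend to meromorphic maps $\mathbb{CP}^1\to\operatorname{End}(\mathbb C^7)$, are holomorphic at $\infty$ with $g(\infty)=e$, and satisfy $\tau(g(\bar\lambda))=g(\lambda)$ and $\sigma(g(-\lambda))=g(\lambda)$. For $\alpha\in\mathbb C\setminus\mathbb R$ and an isotropic line $L\subset\mathbb C^7$ let $$p_{\alpha,L}(\lambda)=\frac{\lambda-\bar\alpha}{\lambda-\alpha}\,\pi_{\bar L}+\pi_{(L\oplus\bar L)^\perp}+\frac{\lambda-\alpha}{\lambda-\bar\alpha}\,\pi_L ,$$ where $\pi_W$ is the hermitian orthogonal projection onto $W$. Call a pair $(L,K)$ of isotropic lines admissible if $K\subset\bar L^{\perp}$ and $\mathcal C=L\oplus\pi_{(L\oplus\bar L)^\perp}K$ is an isotropic $2$-plane with $\mathcal C\cdot\mathcal C=0$; for admissible pairs put $p_{\alpha,L,K}=p_{\alpha,L}\,p_{\alpha,K}$. For $\alpha\in\mathbb C\setminus(\mathbb R\cup i\mathbb R)$ and an admissible pair $(L,K)$ put $$q_{\alpha,L,K}=p_{-\alpha,(sL)',(sK)'}\;p_{\alpha,L,K},\qquad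 (sK)'=p_{\alpha,L,K}(-\alpha)\,sK,\qquad (sL)'=\bigl(p_{-\alpha,(sK)'}\;p_{\alpha,L,K}\;p_{-\alpha,sK}^{-1}\bigr)(-\alpha)\,sL,$$ where the last product is evaluated at its removable singularity $-\alpha$. **Theorem.** The elements $p_{\beta,M,N}$, with $\beta\in i\mathbb R\setminus\{0\}$ and $(M,N)$ an admissible pair such that $sM=\overline M$ and $sN=\overline N$, and the elements $q_{\alpha,L,K}$, with $\alpha\in\mathbb C\setminus(\mathbb R\cup i\mathbb R)$ and $(L,K)$ an admissible pair, belong to $\mathcal L_-^{\tau,\sigma}(\mathbb G_2,\mathbb C^7)$ and generate this group. -/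

import Mathlib

noncomputable section

open Filter Topology Matrix
open scoped ComplexConjugate

namespace G2Loop

/-! ## The complexified octonions and the group `𝔾₂` -/

/-- The product of the complexified octonions `𝕆 ⊗ ℂ`, with coordinates `x 0, …, x 7` with respect to
the basis `1, e₁, …, e₇`; here `e₁e₂ = -e₅`, `e₁e₃ = -e₆`, `e₁e₄ = -e₇`, `e₂e₃ = -e₇`, `e₂e₄ = e₆`,
`e₃e₄ = -e₅`, `e₅e₆ = e₇`, and so on. -/
def octMul (x y : Fin 8 → ℂ) : Fin 8 → ℂ :=
  ![x 0 * y 0 - x 1 * y 1 - x 2 * y 2 - x 3 * y 3 - x 4 * y 4 - x 5 * y 5 - x 6 * y 6 - x 7 * y 7,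
    x 0 * y 1 + x 1 * y 0 - x 2 * y 5 - x 3 * y 6 - x 4 * y 7 + x 5 * y 2 + x 6 * y 3 + x 7 * y 4,
    x 0 * y 2 + x 1 * y 5 + x 2 * y 0 - x 3 * y 7 + x 4 * y 6 - x 5 * y 1 - x 6 * y 4 + x 7 * y 3,
    x 0 * y 3 + x 1 * y 6 + x 2 * y 7 + x 3 * y 0 - x 4 * y 5 + x 5 * y 4 - x 6 * y 1 - x 7 * y 2,
    x 0 * y 4 + x 1 * y 7 - x 2 * y 6 + x 3 * y 5 + x 4 * y 0 - x 5 * y 3 + x 6 * y 2 - x 7 * y 1,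
    x 0 * y 5 - x 1 * y 2 + x 2 * y 1 - x 3 * y 4 + x 4 * y 3 + x 5 * y 0 + x 6 * y 7 - x 7 * y 6,
    x 0 * y 6 - x 1 * y 3 + x 2 * y 4 + x 3 * y 1 - x 4 * y 2 - x 5 * y 7 + x 6 * y 0 + x 7 * y 5,
    x 0 * y 7 - x 1 * y 4 - x 2 * y 3 + x 3 * y 2 + x 4 * y 1 + x 5 * y 6 - x 6 * y 5 + x 7 * y 0]

/-- `7 × 7` complex matrices, acting on `ℂ⁷ = Im 𝕆 ⊗ ℂ`. -/
abbrev Mat7 := Matrix (Fin 7) (Fin 7) ℂ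

/-- The map `x₀ + x ↦ x₀ + A x` of `𝕆 ⊗ ℂ = ℂ ⊕ ℂ⁷` defined by a `7 × 7` matrix `A`. -/
def octExt (A : Mat7) (x : Fin 8 → ℂ) : Fin 8 → ℂ :=
  Fin.cons (x 0) (A *ᵥ Fin.tail x)

lemma octExt_mul (A B : Mat7) (x : Fin 8 → ℂ) : octExt (A * B) x = octExt A (octExt B x) := by
  simp [octExt]

lemma octExt_one (x : Fin 8 → ℂ) : octExt 1 x = x := by
  simp [octExt]

/-- `𝔾₂`, the automorphism group of `𝕆 ⊗ ℂ`, in its representation on `ℂ⁷ = Im 𝕆 ⊗ ℂ`. -/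
def G2 : Subgroup (GL (Fin 7) ℂ) where
  carrier := {A | ∀ x y, octExt A.val (octMul x y) = octMul (octExt A.val x) (octExt A.val y)}
  mul_mem' {A B} hA hB x y := by
    rw [Units.val_mul]
    simp only [octExt_mul]
    rw [hB, hA]
  one_mem' x y := by
    simp only [Units.val_one, octExt_one]
  inv_mem' {A} hA x y := by
    have h1 : ∀ z, octExt A.val (octExt A⁻¹.val z) = z := fun z => by
      rw [← octExt_mul, Units.mul_inv, octExt_one]
    have h2 : ∀ z, octExt A⁻¹.val (octExt A.val z) = z := fun z => by
      rw [← octExt_mul, Units.inv_mul, octExt_one]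
    have h := hA (octExt A⁻¹.val x) (octExt A⁻¹.val y)
    rw [h1, h1] at h
    rw [← h, h2]

/-- The matrix `s = diag(-1, -1, -1, -1, 1, 1, 1)`. -/
def sMat : Mat7 := Matrix.diagonal ![-1, -1, -1, -1, 1, 1, 1]

lemma sMat_mul_self : sMat * sMat = 1 := by
  rw [sMat, Matrix.diagonal_mul_diagonal, ← Matrix.diagonal_one]
  congr 1
  ext i
  fin_cases i <;> simp

/-- `s` as an invertible matrix. -/
def sGL : GL (Fin 7) ℂ := ⟨sMat, sMat, sMat_mul_self, sMat_mul_self⟩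

/-- The antiholomorphic involution `τ(A) = Ā`. -/
def tau : GL (Fin 7) ℂ →* GL (Fin 7) ℂ := Matrix.GeneralLinearGroup.map (starRingEnd ℂ)

/-- The holomorphic involution `σ(A) = s A s⁻¹`. -/
def sigma : GL (Fin 7) ℂ →* GL (Fin 7) ℂ := (MulAut.conj sGL).toMonoidHom

/-! ## Loops -/

/-- The filter of all subsets of `ℂ` that contain an open and dense subset of `ℂ`. -/
def openDense : Filter ℂ where
  sets := {s | ∃ U ⊆ s, IsOpen U ∧ Dense U}
  univ_sets := ⟨Set.univ, subset_rfl, isOpen_univ, dense_univ⟩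
  sets_of_superset := fun ⟨U, hU, h⟩ hst => ⟨U, hU.trans hst, h⟩
  inter_sets := fun ⟨U, hU, hUo, hUd⟩ ⟨W, hW, hWo, hWd⟩ =>
    ⟨U ∩ W, Set.inter_subset_inter hU hW, hUo.inter hWo, hUd.inter_of_isOpen_left hWd hUo⟩

/-- The group of maps into `GL(7, ℂ)`, where maps that agree on an open and dense set are identified.
An open dense subset of `ℂℙ¹ = ℂ ∪ {∞}` and its trace on `ℂ` determine the same germs; the values
of a representative outside an open and dense set do not matter. -/
abbrev Loop := Germ openDense (GL (Fin 7) ℂ)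

/-- `f` is a holomorphic map into `𝔾₂` on some open and dense set. -/
def IsHolomorphicLoop (f : ℂ → GL (Fin 7) ℂ) : Prop :=
  ∃ U : Set ℂ, IsOpen U ∧ Dense U ∧ (∀ z ∈ U, f z ∈ G2) ∧
    ∀ i j, DifferentiableOn ℂ (fun z => (f z).val i j) U

/-- The matrix entries of `f` are meromorphic on `ℂℙ¹ = ℂ ∪ {∞}`. -/
def IsRational (f : ℂ → GL (Fin 7) ℂ) : Prop :=
  (∀ z, ∀ i j, MeromorphicAt (fun w => (f w).val i j) z) ∧
    ∀ i j, MeromorphicAt (fun w => (f w⁻¹).val i j) 0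

/-- The reality condition `τ(f(λ̄)) = f(λ)`. -/
def IsReal (f : ℂ → GL (Fin 7) ℂ) : Prop :=
  ∀ᶠ z in openDense, tau (f (conj z)) = f z

/-- The twisting condition `σ(f(-λ)) = f(λ)`. -/
def IsTwisted (f : ℂ → GL (Fin 7) ℂ) : Prop :=
  ∀ᶠ z in openDense, sigma (f (-z)) = f z

/-- The map `f` in the coordinate `w = 1/λ` at `∞`, with the value `e` at `w = 0`. -/
def atInfty (f : ℂ → GL (Fin 7) ℂ) : ℂ → GL (Fin 7) ℂ :=
  Function.update (fun w => f w⁻¹) 0 1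

/-- `f` is holomorphic at `∞` and `f(∞) = e`. -/
def IsNegative (f : ℂ → GL (Fin 7) ℂ) : Prop :=
  ∀ i j, AnalyticAt ℂ (fun w => (atInfty f w).val i j) 0

/-! ### Closure properties needed for the loop group -/

section Closure

/-- Entries of products stay in a subring of functions that contains the entries of the factors. -/
lemma entry_mul_mem (S : Subring (ℂ → ℂ)) (f g : ℂ → GL (Fin 7) ℂ)
    (hf : ∀ i j, (fun z => (f z).val i j) ∈ S) (hg : ∀ i j, (fun z => (g z).val i j) ∈ S)
    (i j : Fin 7) : (fun z => ((f * g) z).val i j) ∈ S := by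
  have h : (fun z => ((f * g) z).val i j)
      = ∑ k, (fun z => (f z).val i k) * (fun z => (g z).val k j) := by
    ext z
    simp [Matrix.mul_apply, Finset.sum_apply]
  rw [h]
  exact S.sum_mem fun k _ => S.mul_mem (hf i k) (hg k j)

lemma det_mem (S : Subring (ℂ → ℂ)) (F : ℂ → Mat7)
    (hF : ∀ i j, (fun z => F z i j) ∈ S) : (fun z => (F z).det) ∈ S := by
  have h : (fun z => (F z).det)
      = ∑ p : Equiv.Perm (Fin 7), ((Equiv.Perm.sign p : ℤ) : ℂ → ℂ) *
          ∏ i, (fun z => F z (p i) i) := by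
    ext z
    simp [Matrix.det_apply', Finset.sum_apply, Finset.prod_apply]
  rw [h]
  exact S.sum_mem fun p _ => S.mul_mem (intCast_mem S _) (S.prod_mem fun i _ => hF _ _)

lemma entry_inv_mem (S : Subring (ℂ → ℂ))
    (hS : ∀ u ∈ S, (∀ z, u z ≠ 0) → (fun z => (u z)⁻¹) ∈ S) (f : ℂ → GL (Fin 7) ℂ)
    (hf : ∀ i j, (fun z => (f z).val i j) ∈ S) (i j : Fin 7) :
    (fun z => ((f⁻¹) z).val i j) ∈ S := by
  have h : (fun z => ((f⁻¹) z).val i j)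
      = (fun z => ((f z).val.det)⁻¹) * fun z => ((f z).val.updateRow j (Pi.single i 1)).det := by
    ext z
    simp [Matrix.coe_units_inv, Matrix.inv_def, Matrix.adjugate_apply]
  rw [h]
  refine S.mul_mem (hS _ (det_mem S _ hf) fun z => ?_) (det_mem S _ fun k l => ?_)
  · exact ((Matrix.isUnit_iff_isUnit_det _).1 (f z).isUnit).ne_zero
  · by_cases hk : k = j
    · subst hk
      simp only [Matrix.updateRow_self]
      by_cases hl : l = i
      · subst hl
        simp only [Pi.single_eq_same]
        exact S.one_mem
      · simp only [Pi.single_apply, if_neg hl]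
        exact S.zero_mem
    · simpa [Matrix.updateRow_ne hk] using hf k l

/-- Functions holomorphic on `U`. -/
def holoRing (U : Set ℂ) : Subring (ℂ → ℂ) where
  carrier := {u | DifferentiableOn ℂ u U}
  mul_mem' hu hv := hu.mul hv
  one_mem' := differentiableOn_const 1
  add_mem' hu hv := hu.add hv
  zero_mem' := differentiableOn_const 0
  neg_mem' hu := hu.neg

/-- Functions meromorphic at `z`. -/
def meroRing (z : ℂ) : Subring (ℂ → ℂ) where
  carrier := {u | MeromorphicAt u z}
  mul_mem' hu hv := hu.mul hv
  one_mem' := MeromorphicAt.const 1 z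
  add_mem' hu hv := hu.add hv
  zero_mem' := MeromorphicAt.const 0 z
  neg_mem' hu := hu.neg

/-- Functions holomorphic at `z`. -/
def anaRing (z : ℂ) : Subring (ℂ → ℂ) where
  carrier := {u | AnalyticAt ℂ u z}
  mul_mem' hu hv := hu.mul hv
  one_mem' := analyticAt_const
  add_mem' hu hv := hu.add hv
  zero_mem' := analyticAt_const
  neg_mem' hu := hu.neg

lemma IsHolomorphicLoop.mul {f g : ℂ → GL (Fin 7) ℂ} (hf : IsHolomorphicLoop f)
    (hg : IsHolomorphicLoop g) : IsHolomorphicLoop (f * g) := by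
  obtain ⟨U, hUo, hUd, hU, hU'⟩ := hf
  obtain ⟨W, hWo, hWd, hW, hW'⟩ := hg
  refine ⟨U ∩ W, hUo.inter hWo, hUd.inter_of_isOpen_left hWd hUo,
    fun z hz => G2.mul_mem (hU z hz.1) (hW z hz.2), ?_⟩
  exact entry_mul_mem (holoRing (U ∩ W)) f g (fun i j => (hU' i j).mono Set.inter_subset_left)
    (fun i j => (hW' i j).mono Set.inter_subset_right)

lemma IsHolomorphicLoop.inv {f : ℂ → GL (Fin 7) ℂ} (hf : IsHolomorphicLoop f) :
    IsHolomorphicLoop f⁻¹ := by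
  obtain ⟨U, hUo, hUd, hU, hU'⟩ := hf
  refine ⟨U, hUo, hUd, fun z hz => G2.inv_mem (hU z hz), ?_⟩
  exact entry_inv_mem (holoRing U) (fun u hu h0 => DifferentiableOn.inv hu fun z _ => h0 z) f hU'

lemma IsHolomorphicLoop.one : IsHolomorphicLoop 1 :=
  ⟨Set.univ, isOpen_univ, dense_univ, fun _ _ => G2.one_mem, fun _ _ => differentiableOn_const _⟩

lemma IsRational.mul {f g : ℂ → GL (Fin 7) ℂ} (hf : IsRational f) (hg : IsRational g) :
    IsRational (f * g) :=
  ⟨fun z => entry_mul_mem (meroRing z) f g (hf.1 z) (hg.1 z),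
    entry_mul_mem (meroRing 0) (fun w => f w⁻¹) (fun w => g w⁻¹) hf.2 hg.2⟩

lemma IsRational.inv {f : ℂ → GL (Fin 7) ℂ} (hf : IsRational f) : IsRational f⁻¹ :=
  ⟨fun z => entry_inv_mem (meroRing z) (fun _ hu _ => MeromorphicAt.inv hu) f (hf.1 z),
    entry_inv_mem (meroRing 0) (fun _ hu _ => MeromorphicAt.inv hu) (fun w => f w⁻¹) hf.2⟩

lemma IsRational.one : IsRational 1 :=
  ⟨fun _ _ _ => MeromorphicAt.const _ _, fun _ _ => MeromorphicAt.const _ _⟩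

lemma atInfty_mul (f g : ℂ → GL (Fin 7) ℂ) : atInfty (f * g) = atInfty f * atInfty g := by
  ext1 w
  by_cases hw : w = 0 <;> simp [atInfty, hw]

lemma atInfty_inv (f : ℂ → GL (Fin 7) ℂ) : atInfty f⁻¹ = (atInfty f)⁻¹ := by
  ext1 w
  by_cases hw : w = 0 <;> simp [atInfty, hw]

lemma atInfty_one : atInfty 1 = 1 := by
  ext1 w
  by_cases hw : w = 0 <;> simp [atInfty, hw]

lemma IsNegative.mul {f g : ℂ → GL (Fin 7) ℂ} (hf : IsNegative f) (hg : IsNegative g) :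
    IsNegative (f * g) := by
  rw [IsNegative, atInfty_mul]
  exact entry_mul_mem (anaRing 0) _ _ hf hg

lemma IsNegative.inv {f : ℂ → GL (Fin 7) ℂ} (hf : IsNegative f) : IsNegative f⁻¹ := by
  rw [IsNegative, atInfty_inv]
  exact entry_inv_mem (anaRing 0) (fun _ hu h0 => AnalyticAt.inv hu (h0 0)) _ hf

lemma IsNegative.one : IsNegative 1 := by
  rw [IsNegative, atInfty_one]
  exact fun _ _ => analyticAt_const

lemma IsReal.mul {f g : ℂ → GL (Fin 7) ℂ} (hf : IsReal f) (hg : IsReal g) : IsReal (f * g) := by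
  filter_upwards [hf, hg] with z h1 h2
  simp [h1, h2]

lemma IsReal.inv {f : ℂ → GL (Fin 7) ℂ} (hf : IsReal f) : IsReal f⁻¹ := by
  filter_upwards [hf] with z h1
  rw [Pi.inv_apply, Pi.inv_apply, map_inv, h1]

lemma IsReal.one : IsReal 1 :=
  Eventually.of_forall fun _ => map_one tau

lemma IsTwisted.mul {f g : ℂ → GL (Fin 7) ℂ} (hf : IsTwisted f) (hg : IsTwisted g) :
    IsTwisted (f * g) := by
  filter_upwards [hf, hg] with z h1 h2
  rw [Pi.mul_apply, Pi.mul_apply, map_mul, h1, h2]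

lemma IsTwisted.inv {f : ℂ → GL (Fin 7) ℂ} (hf : IsTwisted f) : IsTwisted f⁻¹ := by
  filter_upwards [hf] with z h1
  rw [Pi.inv_apply, Pi.inv_apply, map_inv, h1]

lemma IsTwisted.one : IsTwisted 1 :=
  Eventually.of_forall fun _ => map_one sigma

end Closure

/-- The group `ℒ₋^{τ,σ}(𝔾₂, ℂ⁷)` of negative rational loops in `𝔾₂` that satisfy the reality and the
twisting condition. -/
def twistedLoopGroup : Subgroup Loop where
  carrier := {γ | ∃ f : ℂ → GL (Fin 7) ℂ, γ = (f : Loop) ∧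
    IsHolomorphicLoop f ∧ IsRational f ∧ IsReal f ∧ IsTwisted f ∧ IsNegative f}
  mul_mem' := by
    rintro _ _ ⟨f, rfl, h1, h2, h3, h4, h5⟩ ⟨g, rfl, k1, k2, k3, k4, k5⟩
    exact ⟨f * g, rfl, h1.mul k1, h2.mul k2, h3.mul k3, h4.mul k4, h5.mul k5⟩
  one_mem' := ⟨1, rfl, .one, .one, .one, .one, .one⟩
  inv_mem' := by
    rintro _ ⟨f, rfl, h1, h2, h3, h4, h5⟩
    exact ⟨f⁻¹, rfl, h1.inv, h2.inv, h3.inv, h4.inv, h5.inv⟩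

/-! ## Lines in `ℂ⁷` -/

/-- `ℂ⁷` with its standard hermitian inner product. -/
abbrev C7 := EuclideanSpace ℂ (Fin 7)

/-- Complex conjugation on `ℂ⁷`. -/
def conjMap : C7 →ₛₗ[starRingEnd ℂ] C7 where
  toFun x := WithLp.toLp 2 fun i => conj (x i)
  map_add' x y := by ext i; simp
  map_smul' c x := by ext i; simp

/-- The conjugate subspace `W̄`. -/
def conjSub (W : Submodule ℂ C7) : Submodule ℂ C7 := W.map conjMap

/-- The image `A W` of a subspace under a matrix. -/
def matSub (A : Mat7) (W : Submodule ℂ C7) : Submodule ℂ C7 := W.map (Matrix.toEuclideanLin A)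

/-- The complex bilinear extension of the standard inner product of `ℝ⁷`. -/
def bil (x y : C7) : ℂ := ∑ i, x i * y i

/-- The product on `ℂ⁷`: the imaginary part of the octonionic product. -/
def imMul (x y : C7) : Fin 7 → ℂ :=
  Fin.tail (octMul (Fin.cons 0 x.ofLp) (Fin.cons 0 y.ofLp))

/-- Isotropic subspaces with respect to the bilinear form. -/
def IsIsotropic (W : Submodule ℂ C7) : Prop := ∀ x ∈ W, ∀ y ∈ W, bil x y = 0

/-- Isotropic lines. -/
def IsIsotropicLine (L : Submodule ℂ C7) : Prop := Module.finrank ℂ L = 1 ∧ IsIsotropic L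

/-- Complex coassociative planes: isotropic `2`-planes `C` with `C · C = 0`. -/
def IsCoassociative (C : Submodule ℂ C7) : Prop :=
  Module.finrank ℂ C = 2 ∧ IsIsotropic C ∧ ∀ x ∈ C, ∀ y ∈ C, imMul x y = 0

/-- The matrix of the hermitian orthogonal projection `π_W` onto `W`. -/
def proj (W : Submodule ℂ C7) : Mat7 :=
  (Matrix.toEuclideanCLM (n := Fin 7) (𝕜 := ℂ)).symm W.starProjection

/-- The pairs of isotropic lines `L, K` for which `p_{α,L,K}` is defined: `K ⊂ L̄^⊥` (with respect to
the bilinear form) and `L ⊕ π_{(L ⊕ L̄)^⊥} K` is complex coassociative. The hermitian and the bilinear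
complement of the conjugation invariant subspace `L ⊕ L̄` are the same. -/
def IsPair (L K : Submodule ℂ C7) : Prop :=
  IsIsotropicLine L ∧ IsIsotropicLine K ∧ (∀ x ∈ K, ∀ y ∈ conjSub L, bil x y = 0) ∧
    IsCoassociative (L ⊔ matSub (proj (L ⊔ conjSub L)ᗮ) K)

/-! ## Simple elements -/

/-- `p_{α,L}(λ) = (λ-ᾱ)/(λ-α) π_{L̄} + π_{(L⊕L̄)^⊥} + (λ-α)/(λ-ᾱ) π_L`. -/
def pLine (α : ℂ) (L : Submodule ℂ C7) (z : ℂ) : Mat7 :=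
  ((z - conj α) / (z - α)) • proj (conjSub L) + proj (L ⊔ conjSub L)ᗮ +
    ((z - α) / (z - conj α)) • proj L

/-- `p_{α,L,K} = p_{α,L} p_{α,K}`. -/
def pPair (α : ℂ) (L K : Submodule ℂ C7) (z : ℂ) : Mat7 := pLine α L z * pLine α K z

/-- `p_{β,K} * h = p_{β,K} h p_{β,K'}⁻¹`, where `K' = h(β)⁻¹ K`. -/
def dress (β : ℂ) (K : Submodule ℂ C7) (h : ℂ → Mat7) (z : ℂ) : Mat7 :=
  pLine β K z * h z * (pLine β (matSub (h β)⁻¹ K) z)⁻¹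

/-- The value at `β` of the holomorphic extension of `p_{β,K} * h` over its removable singularity. -/
def dressAt (β : ℂ) (K : Submodule ℂ C7) (h : ℂ → Mat7) : Mat7 :=
  limUnder (𝓝[≠] β) (dress β K h)

/-- `(sK)' = p_{α,L,K}(-α) sK`. -/
def sKPrime (α : ℂ) (L K : Submodule ℂ C7) : Submodule ℂ C7 :=
  matSub (pPair α L K (-α)) (matSub sMat K)

/-- `(sL)' = (p_{-α,(sK)'} * p_{α,L,K})(-α) sL`. -/
def sLPrime (α : ℂ) (L K : Submodule ℂ C7) : Submodule ℂ C7 :=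
  matSub (dressAt (-α) (sKPrime α L K) (pPair α L K)) (matSub sMat L)

/-- `q_{α,L,K} = p_{-α,(sL)',(sK)'} p_{α,L,K}`. -/
def qPair (α : ℂ) (L K : Submodule ℂ C7) (z : ℂ) : Mat7 :=
  pPair (-α) (sLPrime α L K) (sKPrime α L K) z * pPair α L K z

/-- The first family: `p_{β,M,N}` with `β ∈ iℝ ∖ {0}`, `sM = M̄` and `sN = N̄`. -/
def pFamily : Set (ℂ → Mat7) :=
  {F | ∃ (β : ℂ) (M N : Submodule ℂ C7), β.re = 0 ∧ β.im ≠ 0 ∧ IsPair M N ∧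
    matSub sMat M = conjSub M ∧ matSub sMat N = conjSub N ∧ F = pPair β M N}

/-- The second family: `q_{α,L,K}` with `α ∈ ℂ ∖ (ℝ ∪ iℝ)`. -/
def qFamily : Set (ℂ → Mat7) :=
  {F | ∃ (α : ℂ) (L K : Submodule ℂ C7), α.re ≠ 0 ∧ α.im ≠ 0 ∧ IsPair L K ∧ F = qPair α L K}

/-- The loop `γ` is given by the matrix valued function `F` on an open and dense set. -/
def Represents (F : ℂ → Mat7) (γ : Loop) : Prop :=
  γ.map (fun A : GL (Fin 7) ℂ => A.val) = (F : Germ openDense Mat7)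

end G2Loop

end

noncomputable section

open Filter Topology Matrix
open scoped ComplexConjugate

namespace G2Loop

/-! A loop without poles is constant by Liouville's theorem, hence equal to `1`. It is therefore
enough to lower the poles one at a time by left multiplication with elements of the two families, by
induction on the total pole order (`mem_closure_of_poleLE`).

Real poles do not occur (`poleLE_pred_of_real`). At a nonreal pole `α` of order `n`, write `(z-α)^n
g = A + (z-α) B + ⋯`. As `g` preserves the form and the product, the image of `A` is isotropic with
vanishing product, hence at most two-dimensional (`finrank_le_two_of_null`), and `B` pairs with it
through a single number `κ` (`IsLeading.exists_frame`). This number dictates an admissible pair `(L,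
K)` for which `p_{α,L,K} g` has order at most `n-1` (`IsFrame.pv_mul_leading`,
`exists_pair_lowering`).

Admissible pairs are the pairs `L = ℂ l`, `K = ℂ (k + c l̄)` with `l, k` a hermitian orthonormal
basis of an isotropic plane with vanishing product (`exists_frame_of_isPair`). The element
`p_{α,L,K}` takes values in a copy of `SL(2)` attached to this plane, which lies in `𝔾₂` because it
is generated by exponentials of nilpotent derivations (`IsFrame.pv_mul`, `IsFrame.isG2_slElem`).

It remains to respect the twisting. If `α` is imaginary, it is fixed by `z ↦ -z̄`, and all choices
can be made invariant under `x ↦ s x̄`; this gives the first family. Otherwise let `P` be the left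
factor of `q_{α,L,K}`. Two dressing steps (`mReg_dress`) make `P p_{α,L,K} p_{-α,sL,sK}⁻¹` regular
at `-α`. Pole lowering provides a `𝔾₂`-valued factor with the same property, and Liouville forces it
to equal `P` (`isG2_of_mReg_mul`). Liouville applied to `q` and its twisted version shows that `q`
is twisted (`twisted_of_mReg`). -/

/-! ### The cross product of `ℂ⁷` and its identities. -/

/-- Vectors of `ℂ⁷` in coordinates. -/
abbrev V7 := Fin 7 → ℂ

/-- The cross product of `ℂ⁷`: the imaginary part of the octonionic product. -/
def cr (x y : V7) : V7 := Fin.tail (octMul (Fin.cons 0 x) (Fin.cons 0 y))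

lemma cr_eq (x y : V7) : cr x y =
    ![- x 1 * y 4 - x 2 * y 5 - x 3 * y 6 + x 4 * y 1 + x 5 * y 2 + x 6 * y 3,
      x 0 * y 4 - x 2 * y 6 + x 3 * y 5 - x 4 * y 0 - x 5 * y 3 + x 6 * y 2,
      x 0 * y 5 + x 1 * y 6 - x 3 * y 4 + x 4 * y 3 - x 5 * y 0 - x 6 * y 1,
      x 0 * y 6 - x 1 * y 5 + x 2 * y 4 - x 4 * y 2 + x 5 * y 1 - x 6 * y 0,
      - x 0 * y 1 + x 1 * y 0 - x 2 * y 3 + x 3 * y 2 + x 5 * y 6 - x 6 * y 5,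
      - x 0 * y 2 + x 1 * y 3 + x 2 * y 0 - x 3 * y 1 - x 4 * y 6 + x 6 * y 4,
      - x 0 * y 3 - x 1 * y 2 + x 2 * y 1 + x 3 * y 0 + x 4 * y 5 - x 5 * y 4] := by
  have e : ∀ z : V7, (Fin.cons 0 z : Fin 8 → ℂ) = ![0, z 0, z 1, z 2, z 3, z 4, z 5, z 6] := by
    intro z; ext i; fin_cases i <;> rfl
  unfold cr
  rw [e, e]
  ext i
  fin_cases i <;> simp [octMul, Fin.tail]

lemma dot_eq (x y : V7) : x ⬝ᵥ y =
    x 0 * y 0 + x 1 * y 1 + x 2 * y 2 + x 3 * y 3 + x 4 * y 4 + x 5 * y 5 + x 6 * y 6 := by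
  simp [dotProduct, Fin.sum_univ_succ]; ring

lemma cr_add_left (x y z : V7) : cr (x + y) z = cr x z + cr y z := by
  simp only [cr_eq]; ext i; fin_cases i <;> simp <;> ring

lemma cr_add_right (x y z : V7) : cr x (y + z) = cr x y + cr x z := by
  simp only [cr_eq]; ext i; fin_cases i <;> simp <;> ring

lemma cr_smul_left (c : ℂ) (x y : V7) : cr (c • x) y = c • cr x y := by
  simp only [cr_eq]; ext i; fin_cases i <;> simp <;> ring

lemma cr_smul_right (c : ℂ) (x y : V7) : cr x (c • y) = c • cr x y := by
  simp only [cr_eq]; ext i; fin_cases i <;> simp <;> ring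

/-- The cross product as a bilinear map. -/
def crL : V7 →ₗ[ℂ] V7 →ₗ[ℂ] V7 :=
  LinearMap.mk₂ ℂ cr cr_add_left cr_smul_left cr_add_right cr_smul_right

@[simp] lemma crL_apply (x y : V7) : crL x y = cr x y := rfl

lemma cr_zero_left (x : V7) : cr 0 x = 0 := by simpa using cr_smul_left 0 0 x

lemma cr_zero_right (x : V7) : cr x 0 = 0 := by simpa using cr_smul_right 0 x 0

lemma cr_neg_left (x y : V7) : cr (-x) y = -cr x y := by simpa using cr_smul_left (-1) x y

lemma cr_neg_right (x y : V7) : cr x (-y) = -cr x y := by simpa using cr_smul_right (-1) x y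

lemma cr_sub_left (x y z : V7) : cr (x - y) z = cr x z - cr y z := by
  rw [sub_eq_add_neg, cr_add_left, cr_neg_left, sub_eq_add_neg]

lemma cr_sub_right (x y z : V7) : cr x (y - z) = cr x y - cr x z := by
  rw [sub_eq_add_neg, cr_add_right, cr_neg_right, sub_eq_add_neg]

lemma cr_anti (x y : V7) : cr x y = -cr y x := by
  simp only [cr_eq]; ext i; fin_cases i <;> simp <;> ring

lemma cr_self (x : V7) : cr x x = 0 := by
  simp only [cr_eq]; ext i; fin_cases i <;> simp <;> ring

/-- Together with `cr_anti`, this makes `⟨x · y, z⟩` an alternating 3-form. -/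
lemma cr_dot (x y z : V7) : cr x y ⬝ᵥ z = x ⬝ᵥ cr y z := by
  simp only [cr_eq, dot_eq]; simp; ring

/-- The polarized form of `x · (x · z) = -⟨x, x⟩ z + ⟨x, z⟩ x`. -/
lemma cr_cr (x y z : V7) : cr x (cr y z) + cr y (cr x z) =
    (-2 * (x ⬝ᵥ y)) • z + (x ⬝ᵥ z) • y + (y ⬝ᵥ z) • x := by
  simp only [cr_eq, dot_eq]; ext i; fin_cases i <;> simp <;> ring

lemma cr_cr_self (x z : V7) : cr x (cr x z) = (-(x ⬝ᵥ x)) • z + (x ⬝ᵥ z) • x := by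
  have h := cr_cr x x z
  have : (2 : ℂ) • cr x (cr x z) = (2 : ℂ) • ((-(x ⬝ᵥ x)) • z + (x ⬝ᵥ z) • x) := by
    rw [two_smul, h]; module
  exact smul_right_injective _ (two_ne_zero) this

lemma star_cr (x y : V7) : star (cr x y) = cr (star x) (star y) := by
  simp only [cr_eq]; ext i; fin_cases i <;> simp

lemma star_dot_star (x y : V7) : star x ⬝ᵥ star y = star (x ⬝ᵥ y) := by
  simp [dotProduct]

lemma sMat_mulVec (x : V7) : sMat *ᵥ x = ![-x 0, -x 1, -x 2, -x 3, x 4, x 5, x 6] := by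
  ext i; fin_cases i <;> simp [sMat, Matrix.mulVec_diagonal]

/-! ### Matrices that preserve the product -/

/-- `A` preserves the bilinear form and the cross product. -/
structure IsG2 (A : Mat7) : Prop where
  dot : ∀ x y : V7, A *ᵥ x ⬝ᵥ A *ᵥ y = x ⬝ᵥ y
  cross : ∀ x y : V7, cr (A *ᵥ x) (A *ᵥ y) = A *ᵥ cr x y

lemma octMul_cons (a b : ℂ) (x y : V7) : octMul (Fin.cons a x) (Fin.cons b y) =
    Fin.cons (a * b - x ⬝ᵥ y) (a • y + b • x + cr x y) := by
  have e : ∀ (a : ℂ) (z : V7),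
      (Fin.cons a z : Fin 8 → ℂ) = ![a, z 0, z 1, z 2, z 3, z 4, z 5, z 6] := by
    intro a z; ext i; fin_cases i <;> rfl
  rw [e, e, e, cr_eq, dot_eq]
  ext i
  fin_cases i <;> simp [octMul] <;> ring

lemma octExt_cons (A : Mat7) (a : ℂ) (x : V7) :
    octExt A (Fin.cons a x) = Fin.cons a (A *ᵥ x) := by
  simp [octExt]

/-- The product of imaginary octonions has scalar part `-(x ⬝ᵥ y)` and imaginary part `cr x y`, so
an automorphism preserves both separately. -/
lemma mem_G2_iff (A : GL (Fin 7) ℂ) : A ∈ G2 ↔ IsG2 A.val := by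
  constructor
  · intro h
    have h' : ∀ x y : V7, _ := fun x y => h (Fin.cons 0 x) (Fin.cons 0 y)
    simp only [octMul_cons, octExt_cons, Fin.cons_inj] at h'
    exact ⟨fun x y => by simpa using (h' x y).1.symm, fun x y => by simpa using (h' x y).2.symm⟩
  · intro h x y
    rw [← Fin.cons_self_tail x, ← Fin.cons_self_tail y]
    simp only [octMul_cons, octExt_cons, h.dot, h.cross, mulVec_add, mulVec_smul]

lemma IsG2.one : IsG2 1 := ⟨by simp, by simp⟩

lemma IsG2.mul {A B : Mat7} (hA : IsG2 A) (hB : IsG2 B) : IsG2 (A * B) :=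
  ⟨fun x y => by rw [← mulVec_mulVec, ← mulVec_mulVec, hA.dot, hB.dot],
   fun x y => by simp only [← mulVec_mulVec]; rw [hA.cross, hB.cross]⟩

lemma orthogonal_iff (A : Mat7) : (∀ x y : V7, A *ᵥ x ⬝ᵥ A *ᵥ y = x ⬝ᵥ y) ↔ Aᵀ * A = 1 := by
  constructor
  · intro h
    ext i j
    have := h (Pi.single i 1) (Pi.single j 1)
    simp only [mulVec_single_one, single_one_dotProduct] at this
    rw [mul_apply]
    simp only [dotProduct, col_apply, Pi.single_apply] at this
    simpa [one_apply, eq_comm] using this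
  · intro h x y
    rw [dotProduct_mulVec, ← mulVec_transpose, mulVec_mulVec, h, one_mulVec]

lemma IsG2.transpose_mul {A : Mat7} (hA : IsG2 A) : Aᵀ * A = 1 := (orthogonal_iff A).1 hA.dot

lemma IsG2.mul_transpose {A : Mat7} (hA : IsG2 A) : A * Aᵀ = 1 :=
  mul_eq_one_comm.1 hA.transpose_mul

lemma IsG2.transpose {A : Mat7} (hA : IsG2 A) : IsG2 Aᵀ := by
  have h1 := hA.transpose_mul
  have h2 := hA.mul_transpose
  refine ⟨(orthogonal_iff _).2 (by rw [transpose_transpose, h2]), fun x y => ?_⟩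
  have := hA.cross (Aᵀ *ᵥ x) (Aᵀ *ᵥ y)
  simp only [mulVec_mulVec, h2, one_mulVec] at this
  rw [this, mulVec_mulVec, h1, one_mulVec]

lemma isG2_sMat : IsG2 sMat := by
  constructor
  · intro x y
    simp only [sMat_mulVec, dot_eq]; simp
  · intro x y
    simp only [sMat_mulVec, cr_eq]; ext i; fin_cases i <;> simp <;> ring

/-! ### Null vectors -/

/-- For a null pair `l · k = 0`, the infinitesimal rotation in the plane of `l` and `k` is a
derivation. -/
lemma derivation_of_null {l k : V7} (hlk : cr l k = 0) (h0 : l ⬝ᵥ k = 0) (x y : V7) :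
    (k ⬝ᵥ cr x y) • l - (l ⬝ᵥ cr x y) • k =
      cr ((k ⬝ᵥ x) • l - (l ⬝ᵥ x) • k) y + cr x ((k ⬝ᵥ y) • l - (l ⬝ᵥ y) • k) := by
  have key : ∀ z, cr l (cr k z) = (2 * (l ⬝ᵥ z)) • k - (k ⬝ᵥ z) • l := fun z => by
    have h := cr_cr l z k
    rw [hlk, cr_zero_right, add_zero, cr_anti z k, cr_neg_right, h0, neg_eq_iff_eq_neg,
      dotProduct_comm z k] at h
    rw [h]; module
  -- Evaluate `l · (k · (x · y))` in two ways: by `key`, and by moving first `k` and then `l` past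
  -- `x` with `cr_cr`.
  have e1 := key (cr x y)
  have e2 : cr k (cr x y) =
      -cr x (cr k y) + ((-2 * (k ⬝ᵥ x)) • y + (k ⬝ᵥ y) • x + (x ⬝ᵥ y) • k) := by
    rw [← cr_cr]; abel
  have e3 : cr l (cr x (cr k y)) = -cr x (cr l (cr k y)) +
      ((-2 * (l ⬝ᵥ x)) • cr k y + (l ⬝ᵥ cr k y) • x + (x ⬝ᵥ cr k y) • l) := by
    rw [← cr_cr]; abel
  have e4 : l ⬝ᵥ cr k y = 0 := by rw [← cr_dot, hlk, zero_dotProduct]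
  have e5 : x ⬝ᵥ cr k y = -(k ⬝ᵥ cr x y) := by
    rw [cr_anti x y, dotProduct_neg, neg_neg, ← cr_dot, dotProduct_comm, ← cr_dot, cr_anti,
      cr_anti x, dotProduct_comm]
  rw [e2] at e1
  simp only [cr_add_right, cr_neg_right, cr_smul_right, e3, key, e4, e5, cr_sub_right, hlk] at e1
  simp only [cr_sub_left, cr_sub_right, cr_smul_left, cr_smul_right]
  rw [cr_anti x l] at e1 ⊢
  have : (2 : ℂ) • ((k ⬝ᵥ cr x y) • l - (l ⬝ᵥ cr x y) • k) = (2 : ℂ) • 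
     ((k ⬝ᵥ x) • cr l y - (l ⬝ᵥ x) • cr k y + ((k ⬝ᵥ y) • -cr l x - (l ⬝ᵥ y) • cr x k)) := by
    linear_combination (norm := module) (1 : ℂ) • e1
  exact smul_right_injective _ two_ne_zero this

/-- For `x, y ⊥ l` the vectors `l · x` and `l · y` lie in `annihil l`. Their product falls into the
line of `l`, with the 3-form as coefficient; this obstructs three-dimensional null subspaces. -/
lemma cr_cr_null {l x y : V7} (hl : l ⬝ᵥ l = 0) (hx : l ⬝ᵥ x = 0) (hy : l ⬝ᵥ y = 0) :
    cr (cr l x) (cr l y) = (2 * (l ⬝ᵥ cr x y)) • l := by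
  have e1 := cr_cr (cr l x) l y
  have e2 := cr_cr y l x
  have e3 : cr l x ⬝ᵥ l = 0 := by rw [dotProduct_comm, ← cr_dot, cr_self, zero_dotProduct]
  have e4 : cr y (cr l x) = (x ⬝ᵥ y) • l - cr l (cr y x) := by
    rw [dotProduct_comm y l, hy, hx, dotProduct_comm y x] at e2
    rw [eq_sub_iff_add_eq, e2]; module
  rw [cr_anti (cr l x) y, e4, e3, hy, cr_neg_right, cr_sub_right, cr_smul_right, cr_self,
    cr_cr_self, hl, cr_anti y x, dotProduct_neg, cr_dot] at e1
  linear_combination (norm := module) (1 : ℂ) • e1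

/-- The space of all `x` with `m · x = 0`. -/
def annihil (m : V7) : Submodule ℂ V7 := LinearMap.ker (crL m)

@[simp] lemma mem_annihil {m x : V7} : x ∈ annihil m ↔ cr m x = 0 := by simp [annihil]

lemma dot_eq_zero_of_annihil {m x : V7} (hm0 : m ≠ 0) (hm : m ⬝ᵥ m = 0) (hx : cr m x = 0) :
    m ⬝ᵥ x = 0 := by
  have h := cr_cr_self m x
  rw [hx, cr_zero_right, hm, neg_zero, zero_smul, zero_add] at h
  exact (smul_eq_zero.1 h.symm).resolve_right hm0

/-- In the polarized identity for `x, y` applied to `m`, every term but `-2 ⟨x, y⟩ m` vanishes. -/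
lemma annihil_isotropic {m x y : V7} (hm0 : m ≠ 0) (hm : m ⬝ᵥ m = 0) (hx : cr m x = 0)
    (hy : cr m y = 0) : x ⬝ᵥ y = 0 := by
  have h := cr_cr x y m
  rw [cr_anti y m, cr_anti x m, hx, hy, neg_zero, cr_zero_right, cr_zero_right, dotProduct_comm x m,
    dotProduct_comm y m, dot_eq_zero_of_annihil hm0 hm hx, dot_eq_zero_of_annihil hm0 hm hy] at h
  simp only [zero_smul, add_zero] at h
  simpa [hm0] using h.symm

/-- The form embeds `W` into its annihilator in the dual space, which has dimension `7 - dim W`. -/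
lemma finrank_le_of_isotropic {W : Submodule ℂ V7} (hW : ∀ x ∈ W, ∀ y ∈ W, x ⬝ᵥ y = 0) :
    Module.finrank ℂ W ≤ 3 := by
  have h1 : Module.finrank ℂ W + Module.finrank ℂ W.dualAnnihilator = 7 :=
    (Subspace.finrank_add_finrank_dualAnnihilator_eq W).trans (by simp)
  have h2 : W.map (dotProductEquiv ℂ (Fin 7)).toLinearMap ≤ W.dualAnnihilator := by
    rintro _ ⟨x, hx, rfl⟩
    rw [Submodule.mem_dualAnnihilator]
    intro y hy
    exact hW x hx y hy
  have h3 : Module.finrank ℂ (W.map (dotProductEquiv ℂ (Fin 7)).toLinearMap) ≤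
      Module.finrank ℂ W.dualAnnihilator := Submodule.finrank_mono h2
  have h4 : Module.finrank ℂ (W.map (dotProductEquiv ℂ (Fin 7)).toLinearMap) =
      Module.finrank ℂ W := LinearEquiv.finrank_map_eq _ _
  omega

lemma finrank_le_map_add_ker (f : V7 →ₗ[ℂ] V7) (W : Submodule ℂ V7) :
    Module.finrank ℂ W ≤ Module.finrank ℂ (W.map f) + Module.finrank ℂ (LinearMap.ker f) := by
  have h := LinearMap.finrank_range_add_finrank_ker (f.domRestrict W)
  rw [LinearMap.range_domRestrict] at h
  have h2 : Module.finrank ℂ (LinearMap.ker (f.domRestrict W)) ≤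
      Module.finrank ℂ (LinearMap.ker f) := by
    refine LinearMap.finrank_le_finrank_of_injective
      (f := (W.subtype ∘ₗ (LinearMap.ker (f.domRestrict W)).subtype).codRestrict (LinearMap.ker f)
        fun x => x.2) ?_
    intro x y hxy
    exact Subtype.ext (Subtype.ext (congrArg (Subtype.val (p := (· ∈ LinearMap.ker f))) hxy))
  omega

lemma finrank_le_inf_ker_add_one (φ : V7 →ₗ[ℂ] ℂ) (W : Submodule ℂ V7) :
    Module.finrank ℂ W ≤ Module.finrank ℂ (W ⊓ LinearMap.ker φ : Submodule ℂ V7) + 1 := by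
  have h1 := LinearMap.finrank_range_add_finrank_ker φ
  have h2 : Module.finrank ℂ (LinearMap.range φ) ≤ 1 := by
    simpa using Submodule.finrank_le (LinearMap.range φ)
  have h3 := Submodule.finrank_sup_add_finrank_inf_eq W (LinearMap.ker φ)
  have h4 := Submodule.finrank_le (W ⊔ LinearMap.ker φ)
  omega

/-- The hyperplane orthogonal to `m`. -/
def hyper (m : V7) : Submodule ℂ V7 := LinearMap.ker (dotProductEquiv ℂ (Fin 7) m)

@[simp] lemma mem_hyper {m x : V7} : x ∈ hyper m ↔ m ⬝ᵥ x = 0 := by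
  simp [hyper]

lemma six_le_finrank_hyper (m : V7) : 6 ≤ Module.finrank ℂ (hyper m) := by
  have := finrank_le_inf_ker_add_one (dotProductEquiv ℂ (Fin 7) m) ⊤
  rw [top_inf_eq] at this
  simp only [finrank_top, Module.finrank_fintype_fun_eq_card, Fintype.card_fin] at this
  exact Nat.succ_le_succ_iff.1 this

lemma mem_span_of_dot {l v : V7} (hl : l ≠ 0) (h : ∀ y, l ⬝ᵥ y = 0 → v ⬝ᵥ y = 0) :
    v ∈ ℂ ∙ l := by
  obtain ⟨i, hi⟩ := Function.ne_iff.1 hl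
  rw [Pi.zero_apply] at hi
  refine Submodule.mem_span_singleton.2 ⟨v i / l i, ?_⟩
  ext j
  -- The vectors `l i • e_j - l j • e_i` are orthogonal to `l` and compare the coordinates of `v`
  -- with those of `l`.
  have := h (l i • Pi.single j 1 - l j • Pi.single i 1) (by
    simp [dotProduct_sub, dotProduct_smul]; ring)
  simp only [dotProduct_sub, dotProduct_smul, dotProduct_single_one, smul_eq_mul] at this
  simp only [Pi.smul_apply, smul_eq_mul]
  field_simp
  linear_combination -this

/-- Multiplication by `m` maps the six-dimensional hyperplane `m^⊥` into its own kernel, so the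
kernel has dimension at least three; being isotropic, it has dimension at most three. -/
lemma finrank_annihil {m : V7} (hm0 : m ≠ 0) (hm : m ⬝ᵥ m = 0) :
    Module.finrank ℂ (annihil m) = 3 := by
  have h1 : Module.finrank ℂ (annihil m) ≤ 3 := finrank_le_of_isotropic fun x hx y hy =>
    annihil_isotropic hm0 hm (mem_annihil.1 hx) (mem_annihil.1 hy)
  have h2 := finrank_le_map_add_ker (crL m) (hyper m)
  have h3 : (hyper m).map (crL m) ≤ annihil m := by
    rintro _ ⟨x, hx, rfl⟩
    rw [SetLike.mem_coe, mem_hyper] at hx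
    rw [mem_annihil, crL_apply, cr_cr_self, hm, hx]
    simp
  have h4 := Submodule.finrank_mono h3
  have h5 := six_le_finrank_hyper m
  change _ ≤ _ + Module.finrank ℂ (annihil m) at h2
  omega

/-- Otherwise multiplication by `m` would have rank at most one on a space of dimension six, with
kernel of dimension at most three. -/
lemma exists_cr_not_mem_span {m : V7} (hm0 : m ≠ 0) (hm : m ⬝ᵥ m = 0) :
    ∃ x, m ⬝ᵥ x = 0 ∧ cr m x ∉ ℂ ∙ m := by
  by_contra! h
  have h2 := finrank_le_map_add_ker (crL m) (hyper m)
  have h3 : (hyper m).map (crL m) ≤ ℂ ∙ m := by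
    rintro _ ⟨x, hx, rfl⟩
    exact h x (mem_hyper.1 hx)
  have h4 := Submodule.finrank_mono h3
  rw [finrank_span_singleton hm0] at h4
  have h5 := six_le_finrank_hyper m
  have h6 := finrank_annihil hm0 hm
  change _ ≤ _ + Module.finrank ℂ (annihil m) at h2
  omega

/-- An isotropic subspace with vanishing product is at most two-dimensional. -/
lemma finrank_le_two_of_null {W : Submodule ℂ V7} (h0 : ∀ x ∈ W, ∀ y ∈ W, x ⬝ᵥ y = 0)
    (h1 : ∀ x ∈ W, ∀ y ∈ W, cr x y = 0) : Module.finrank ℂ W ≤ 2 := by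
  by_contra! hW
  obtain ⟨l, hlW, hl0⟩ : ∃ l ∈ W, l ≠ 0 := by
    apply Submodule.exists_mem_ne_zero_of_ne_bot
    rintro rfl
    simp at hW
  have hl := h0 l hlW l hlW
  -- By dimension, `W` is all of `annihil l`. It contains every `l · x` with `x ⊥ l`, so by
  -- `cr_cr_null` the form `⟨l, x · y⟩` vanishes on `l^⊥`, which contradicts
  -- `exists_cr_not_mem_span`.
  have hWE : W = annihil l := by
    apply Submodule.eq_of_le_of_finrank_le
    · intro x hx
      exact mem_annihil.2 (h1 l hlW x hx)
    · rw [finrank_annihil hl0 hl]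
      exact hW
  obtain ⟨x, hx, hxl⟩ := exists_cr_not_mem_span hl0 hl
  have hmem : ∀ y, l ⬝ᵥ y = 0 → cr l y ∈ W := fun y hy => by
    rw [hWE, mem_annihil, cr_cr_self, hl, hy]; simp
  refine hxl (mem_span_of_dot hl0 fun y hy => ?_)
  have h := h1 _ (hmem x hx) _ (hmem y hy)
  rw [cr_cr_null hl hx hy] at h
  rw [cr_dot]
  simpa [hl0] using h

/-! ### Frames -/

/-- A hermitian orthonormal basis `l, k` of an isotropic plane with vanishing product. -/
structure IsFrame (l k : V7) : Prop where
  ll : l ⬝ᵥ l = 0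
  kk : k ⬝ᵥ k = 0
  lk : l ⬝ᵥ k = 0
  sll : star l ⬝ᵥ l = 1
  skk : star k ⬝ᵥ k = 1
  slk : star l ⬝ᵥ k = 0
  cr : cr l k = 0

lemma star_dot_comm (x y : V7) : star x ⬝ᵥ y = star (star y ⬝ᵥ x) := by
  rw [← star_dot_star, star_star, dotProduct_comm]

lemma IsFrame.skl {l k : V7} (h : IsFrame l k) : star k ⬝ᵥ l = 0 := by
  rw [star_dot_comm, h.slk, star_zero]

lemma IsFrame.conj {l k : V7} (h : IsFrame l k) : IsFrame (star l) (star k) where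
  ll := by rw [star_dot_star, h.ll, star_zero]
  kk := by rw [star_dot_star, h.kk, star_zero]
  lk := by rw [star_dot_star, h.lk, star_zero]
  sll := by rw [star_star, dotProduct_comm, h.sll]
  skk := by rw [star_star, dotProduct_comm, h.skk]
  slk := by rw [star_star, dotProduct_comm, h.skl]
  cr := by rw [← star_cr, h.cr, star_zero]

lemma IsFrame.kl {l k : V7} (h : IsFrame l k) : k ⬝ᵥ l = 0 := by rw [dotProduct_comm, h.lk]

lemma IsFrame.lsl {l k : V7} (h : IsFrame l k) : l ⬝ᵥ star l = 1 := by rw [dotProduct_comm, h.sll]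

lemma IsFrame.lsk {l k : V7} (h : IsFrame l k) : l ⬝ᵥ star k = 0 := by rw [dotProduct_comm, h.skl]

lemma IsFrame.ksl {l k : V7} (h : IsFrame l k) : k ⬝ᵥ star l = 0 := by rw [dotProduct_comm, h.slk]

lemma IsFrame.ksk {l k : V7} (h : IsFrame l k) : k ⬝ᵥ star k = 1 := by rw [dotProduct_comm, h.skk]

lemma IsFrame.slsl {l k : V7} (h : IsFrame l k) : star l ⬝ᵥ star l = 0 := h.conj.ll

lemma IsFrame.sksk {l k : V7} (h : IsFrame l k) : star k ⬝ᵥ star k = 0 := h.conj.kk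

lemma IsFrame.slsk {l k : V7} (h : IsFrame l k) : star l ⬝ᵥ star k = 0 := h.conj.lk

lemma IsFrame.sksl {l k : V7} (h : IsFrame l k) : star k ⬝ᵥ star l = 0 := h.conj.kl

/-- The element of the `SL(2)` of a frame with matrix entries `a, b, c, d`: it is the identity on the
complement of `l, k, l̄, k̄` and maps `l ↦ a l + c k̄`, `k̄ ↦ b l + d k̄`, `k ↦ a k - c l̄`,
`l̄ ↦ d l̄ - b k`. -/
def slElem (l k : V7) (a b c d : ℂ) : Mat7 :=
  1 + (a - 1) • (vecMulVec l (star l) + vecMulVec k (star k)) +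
    (d - 1) • (vecMulVec (star l) l + vecMulVec (star k) k) +
    b • (vecMulVec l k - vecMulVec k l) + c • (vecMulVec (star k) (star l) - vecMulVec (star l) (star k))

lemma slElem_mulVec (l k : V7) (a b c d : ℂ) (x : V7) : slElem l k a b c d *ᵥ x =
    x + (a - 1) • ((star l ⬝ᵥ x) • l + (star k ⬝ᵥ x) • k) +
    (d - 1) • ((l ⬝ᵥ x) • star l + (k ⬝ᵥ x) • star k) +
    b • ((k ⬝ᵥ x) • l - (l ⬝ᵥ x) • k) +
    c • ((star l ⬝ᵥ x) • star k - (star k ⬝ᵥ x) • star l) := by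
  simp [slElem, add_mulVec, smul_mulVec, sub_mulVec, vecMulVec_mulVec]

/-- The ordered pairs `l, k̄` and `k, -l̄` span two copies of the standard representation of `2 × 2`
matrices. -/
lemma IsFrame.slElem_mul {l k : V7} (h : IsFrame l k) (a b c d a' b' c' d' : ℂ) :
    slElem l k a b c d * slElem l k a' b' c' d' =
      slElem l k (a * a' + b * c') (a * b' + b * d') (c * a' + d * c') (c * b' + d * d') := by
  refine Matrix.mulVec_injective (funext fun x => ?_)
  rw [← mulVec_mulVec]
  simp only [slElem_mulVec l k, dotProduct_add, dotProduct_sub, dotProduct_smul, h.ll, h.kk, h.lk,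
    h.sll, h.skk, h.slk, h.skl, h.kl, h.lsl, h.lsk, h.ksl, h.ksk, h.slsl, h.sksk, h.slsk, h.sksl,
    smul_eq_mul]
  module

/-- The derivation of `derivation_of_null` has square zero on an isotropic plane, so this matrix is
its exponential. The quadratic term of the product vanishes because `l · k = 0`. -/
lemma isG2_of_null {l k : V7} (hll : l ⬝ᵥ l = 0) (hkk : k ⬝ᵥ k = 0) (hlk : l ⬝ᵥ k = 0)
    (h : cr l k = 0) (b : ℂ) : IsG2 (1 + b • (vecMulVec l k - vecMulVec k l)) := by
  have e : ∀ x, (1 + b • (vecMulVec l k - vecMulVec k l)) *ᵥ x =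
      x + b • ((k ⬝ᵥ x) • l - (l ⬝ᵥ x) • k) := fun x => by
    simp [add_mulVec, smul_mulVec, sub_mulVec, vecMulVec_mulVec]
  constructor
  · intro x y
    simp only [e, dotProduct_add, add_dotProduct, smul_dotProduct, dotProduct_smul, sub_dotProduct,
      dotProduct_sub, hll, hkk, hlk, dotProduct_comm k l, dotProduct_comm x l, dotProduct_comm x k,
      smul_eq_mul]
    ring
  · intro x y
    rw [e, e, e, derivation_of_null h hlk]
    simp only [cr_add_left, cr_add_right, cr_smul_left, cr_smul_right, cr_sub_left, cr_sub_right,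
      cr_self, h, cr_anti k l]
    module

/-- Upper and lower unipotent matrices generate `SL(2)`; they are instances of `isG2_of_null`, for
`l, k` and for `k̄, l̄`. -/
lemma IsFrame.isG2_slElem {l k : V7} (h : IsFrame l k) {a b c d : ℂ} (hd : a * d - b * c = 1) :
    IsG2 (slElem l k a b c d) := by
  have up : ∀ b, IsG2 (slElem l k 1 b 0 1) := fun b => by
    have := isG2_of_null h.ll h.kk h.lk h.cr b
    simpa [slElem] using this
  have lo : ∀ c, IsG2 (slElem l k 1 0 c 1) := fun c => by
    have := isG2_of_null h.conj.kk h.conj.ll (by rw [dotProduct_comm, h.conj.lk])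
      (by rw [cr_anti, h.conj.cr, neg_zero]) c
    simpa [slElem] using this
  have gen : ∀ {a b c d : ℂ}, a * d - b * c = 1 → c ≠ 0 → IsG2 (slElem l k a b c d) := by
    intro a b c d hd hc
    have := ((up ((a - 1) / c)).mul (lo c)).mul (up ((d - 1) / c))
    rw [h.slElem_mul, h.slElem_mul] at this
    convert this using 1
    congr 1 <;> field_simp
    · ring
    · linear_combination -hd
    · ring
    · ring
  by_cases hc : c = 0
  · subst hc
    have hd' : d ≠ 0 := by rintro rfl; simp at hd
    -- When the lower left entry vanishes, write the matrix as one with lower left entry `d ≠ 0`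
    -- times a lower unipotent matrix.
    have := (gen (a := a + b) (b := b) (c := d) (d := d) (by linear_combination hd) hd').mul (lo (-1))
    rw [h.slElem_mul] at this
    convert this using 1
    congr 1 <;> ring
  · exact gen hd hc

/-! ### Simple elements in coordinates -/

/-- The simple element of the isotropic line of `w`, with eigenvalues `u`, `1`, `u⁻¹`. -/
def pv (w : V7) (u : ℂ) : Mat7 :=
  1 + ((u - 1) / (star w ⬝ᵥ w)) • vecMulVec (star w) w +
    ((u⁻¹ - 1) / (star w ⬝ᵥ w)) • vecMulVec w (star w)

lemma pv_mulVec (w : V7) (u : ℂ) (x : V7) : pv w u *ᵥ x =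
    x + ((u - 1) / (star w ⬝ᵥ w) * (w ⬝ᵥ x)) • star w +
      ((u⁻¹ - 1) / (star w ⬝ᵥ w) * (star w ⬝ᵥ x)) • w := by
  simp [pv, add_mulVec, smul_mulVec, vecMulVec_mulVec, smul_smul]

lemma norm_ne_zero {w : V7} (hw : w ≠ 0) : star w ⬝ᵥ w ≠ 0 := by
  intro h
  apply hw
  have h' : ∑ i, ((Complex.normSq (w i) : ℝ) : ℂ) = 0 := by
    rw [← h]
    exact Finset.sum_congr rfl fun i _ => by rw [Complex.normSq_eq_conj_mul_self]; rfl
  rw [← Complex.ofReal_sum, Complex.ofReal_eq_zero,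
    Finset.sum_eq_zero_iff_of_nonneg fun i _ => Complex.normSq_nonneg _] at h'
  ext i
  simpa using h' i (Finset.mem_univ i)

lemma pv_one (w : V7) : pv w 1 = 1 := by simp [pv]

lemma pv_mul_pv {w : V7} (hw : w ≠ 0) (hi : w ⬝ᵥ w = 0) {u v : ℂ} (hu : u ≠ 0) (hv : v ≠ 0) :
    pv w u * pv w v = pv w (u * v) := by
  have hn := norm_ne_zero hw
  have hi' : star w ⬝ᵥ star w = 0 := by rw [star_dot_star, hi, star_zero]
  refine Matrix.mulVec_injective (funext fun x => ?_)
  rw [← mulVec_mulVec]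
  simp only [pv_mulVec w, dotProduct_add, dotProduct_smul, hi, hi', dotProduct_comm w (star w),
    smul_eq_mul]
  match_scalars
  · ring
  · field_simp; ring
  · field_simp; ring

lemma pv_transpose (w : V7) (u : ℂ) : (pv w u)ᵀ = pv w u⁻¹ := by
  rw [pv, pv]
  simp only [transpose_add, transpose_smul, transpose_one, transpose_vecMulVec, inv_inv]
  abel

lemma pv_star (w : V7) (u : ℂ) : pv (star w) u = pv w u⁻¹ := by
  rw [pv, pv]
  simp only [star_star, inv_inv, dotProduct_comm w (star w)]
  abel

lemma star_norm (w : V7) : star (star w ⬝ᵥ w) = star w ⬝ᵥ w := by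
  rw [← star_dot_star, star_star, dotProduct_comm]

lemma pv_map_star (w : V7) (u : ℂ) : (pv w u).map star = pv w (star u)⁻¹ := by
  ext i j
  have h := star_norm w
  simp only [RCLike.star_def] at h ⊢
  simp [pv, vecMulVec_apply, one_apply, apply_ite, h]
  ring

lemma pv_smul {c : ℂ} (hc : c ≠ 0) (w : V7) (u : ℂ) : pv (c • w) u = pv w u := by
  have : star c ≠ 0 := star_ne_zero.2 hc
  have e : ∀ x : ℂ, x / (c * (star c * (star w ⬝ᵥ w))) * (star c * c) = x / (star w ⬝ᵥ w) := by
    intro x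
    by_cases h : star w ⬝ᵥ w = 0
    · simp [h]
    · field_simp
  rw [pv, pv]
  simp only [star_smul, smul_dotProduct, dotProduct_smul, smul_vecMulVec, vecMulVec_smul, smul_smul,
    smul_eq_mul]
  rw [show (u - 1) / (c * (star c * (star w ⬝ᵥ w))) * (c * star c) = (u - 1) / (star w ⬝ᵥ w) by
    rw [mul_comm c (star c), mul_comm (star c) c, mul_comm c (star c), e], e]

lemma pv_conj {A : Mat7} (hA : Aᵀ * A = 1) (hr : A.map star = A) (w : V7) (u : ℂ) :
    A * pv w u * Aᵀ = pv (A *ᵥ w) u := by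
  have hs : star (A *ᵥ w) = A *ᵥ star w := by
    conv_rhs => rw [← hr]
    ext i
    simp [mulVec, dotProduct]
  have h1 : star (A *ᵥ w) ⬝ᵥ A *ᵥ w = star w ⬝ᵥ w := by
    rw [hs, (orthogonal_iff A).2 hA]
  rw [pv, pv, h1, hs]
  simp only [mul_add, add_mul, mul_one, mul_eq_one_comm.1 hA, mul_smul_comm, smul_mul_assoc,
    mul_vecMulVec, vecMulVec_mul, vecMul_transpose]

lemma one_add_mul_star_ne_zero (c : ℂ) : 1 + c * star c ≠ 0 := by
  rw [RCLike.star_def, Complex.mul_conj]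
  have : (0 : ℝ) < 1 + Complex.normSq c := by linarith [Complex.normSq_nonneg c]
  exact_mod_cast this.ne'

/-- A single factor need not preserve the product, but the product of the two lies in the `SL(2)` of
the frame. For `c = 0` it is the diagonal matrix with entries `u⁻¹, u`. -/
lemma IsFrame.pv_mul {l k : V7} (h : IsFrame l k) (c : ℂ) {u : ℂ} (hu : u ≠ 0) :
    pv l u * pv (k + c • star l) u =
      slElem l k ((u⁻¹ + c * star c) / (1 + c * star c)) ((star c - star c * u⁻¹) / (1 + c * star c))
        ((u * c - c) / (1 + c * star c)) ((u + c * star c) / (1 + c * star c)) := by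
  have hN := one_add_mul_star_ne_zero c
  refine Matrix.mulVec_injective (funext fun x => ?_)
  rw [← mulVec_mulVec]
  simp only [pv_mulVec _ u, slElem_mulVec l k, star_add, star_smul, star_star, dotProduct_add,
    add_dotProduct, smul_dotProduct,
    dotProduct_smul, h.ll, h.lk, h.sll, h.skk, h.slk, h.lsl, h.lsk, h.slsl, h.slsk, h.sksl,
    smul_eq_mul]
  simp only [mul_zero, mul_one, add_zero, zero_add]
  generalize star c = c' at *
  match_scalars <;> field_simp <;> ring

lemma IsFrame.isG2_pv {l k : V7} (h : IsFrame l k) (c : ℂ) {u : ℂ} (hu : u ≠ 0) :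
    IsG2 (pv l u * pv (k + c • star l) u) := by
  have hN := one_add_mul_star_ne_zero c
  rw [h.pv_mul c hu]
  apply h.isG2_slElem
  field_simp
  ring

/-! ### Lines -/

/-- The line spanned by a vector. -/
def ln (w : V7) : Submodule ℂ C7 := ℂ ∙ (WithLp.toLp 2 w : C7)

lemma mem_ln {w : V7} {x : C7} : x ∈ ln w ↔ ∃ c : ℂ, x.ofLp = c • w := by
  rw [ln, Submodule.mem_span_singleton]
  constructor
  · rintro ⟨c, rfl⟩; exact ⟨c, rfl⟩
  · rintro ⟨c, hc⟩; exact ⟨c, by rw [← WithLp.toLp_smul, ← hc]⟩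

lemma conjSub_ln (w : V7) : conjSub (ln w) = ln (star w) := by
  ext x
  simp only [conjSub, Submodule.mem_map, mem_ln]
  constructor
  · rintro ⟨y, ⟨c, hc⟩, rfl⟩
    exact ⟨star c, by ext i; simp [conjMap, hc]⟩
  · rintro ⟨c, hc⟩
    refine ⟨WithLp.toLp 2 (star c • w), ⟨star c, rfl⟩, ?_⟩
    ext i
    simp [conjMap, hc]

lemma matSub_ln (A : Mat7) (w : V7) : matSub A (ln w) = ln (A *ᵥ w) := by
  rw [matSub, ln, Submodule.map_span, Set.image_singleton]
  rfl

lemma ln_smul {c : ℂ} (hc : c ≠ 0) (w : V7) : ln (c • w) = ln w := by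
  rw [ln, ln, WithLp.toLp_smul]
  exact Submodule.span_singleton_smul_eq (IsUnit.mk0 c hc) _

lemma exists_smul_of_ln_eq {v w : V7} (hv : v ≠ 0) (h : ln v = ln w) : ∃ c : ℂ, c ≠ 0 ∧ v = c • w := by
  have : (WithLp.toLp 2 v : C7) ∈ ln w := by rw [← h]; exact mem_ln.2 ⟨1, by simp⟩
  obtain ⟨c, hc⟩ := mem_ln.1 this
  refine ⟨c, ?_, hc⟩
  rintro rfl
  exact hv (by simpa using hc)

lemma proj_eq_of (W : Submodule ℂ C7) (P : Mat7)
    (h1 : ∀ x : C7, (WithLp.toLp 2 (P *ᵥ x.ofLp) : C7) ∈ W)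
    (h2 : ∀ x : C7, x - WithLp.toLp 2 (P *ᵥ x.ofLp) ∈ Wᗮ) : proj W = P := by
  rw [proj, ← StarAlgEquiv.symm_apply_apply (toEuclideanCLM (n := Fin 7) (𝕜 := ℂ)) P]
  congr 1
  ext1 x
  rw [Submodule.eq_starProjection_of_mem_orthogonal (h1 x) (h2 x)]
  rfl

lemma inner_eq_dot (x y : C7) : inner ℂ x y = star x.ofLp ⬝ᵥ y.ofLp := by
  rw [EuclideanSpace.inner_eq_star_dotProduct, dotProduct_comm]

lemma proj_ln {w : V7} (hw : w ≠ 0) :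
    proj (ln w) = (1 / (star w ⬝ᵥ w)) • vecMulVec w (star w) := by
  have hn := norm_ne_zero hw
  apply proj_eq_of
  · intro x
    rw [mem_ln]
    exact ⟨1 / (star w ⬝ᵥ w) * (star w ⬝ᵥ x.ofLp), by
      simp [smul_mulVec, vecMulVec_mulVec, smul_smul]⟩
  · intro x
    rw [ln, Submodule.mem_orthogonal_singleton_iff_inner_right, inner_eq_dot]
    simp [smul_mulVec, vecMulVec_mulVec, smul_smul, dotProduct_sub, dotProduct_smul]
    field_simp
    simp

lemma proj_compl_ln {w : V7} (hw : w ≠ 0) (hi : w ⬝ᵥ w = 0) :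
    proj (ln w ⊔ ln (star w))ᗮ = 1 - (1 / (star w ⬝ᵥ w)) • vecMulVec w (star w)
      - (1 / (star w ⬝ᵥ w)) • vecMulVec (star w) w := by
  have hn := norm_ne_zero hw
  have hi' : star w ⬝ᵥ star w = 0 := by rw [star_dot_star, hi, star_zero]
  apply proj_eq_of
  · intro x
    rw [← Submodule.inf_orthogonal, Submodule.mem_inf, ln, ln,
      Submodule.mem_orthogonal_singleton_iff_inner_right,
      Submodule.mem_orthogonal_singleton_iff_inner_right, inner_eq_dot, inner_eq_dot]
    simp only [sub_mulVec, smul_mulVec, vecMulVec_mulVec, one_mulVec, dotProduct_sub,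
      dotProduct_smul, hi, hi', dotProduct_comm w (star w), star_star, op_smul_eq_smul,
      smul_eq_mul]
    constructor <;> field_simp <;> ring
  · intro x
    rw [Submodule.orthogonal_orthogonal]
    have : x - WithLp.toLp 2 ((1 - (1 / (star w ⬝ᵥ w)) • vecMulVec w (star w)
      - (1 / (star w ⬝ᵥ w)) • vecMulVec (star w) w) *ᵥ x.ofLp) =
      WithLp.toLp 2 ((1 / (star w ⬝ᵥ w) * (star w ⬝ᵥ x.ofLp)) • w) +
      WithLp.toLp 2 ((1 / (star w ⬝ᵥ w) * (w ⬝ᵥ x.ofLp)) • star w) := by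
      ext i
      simp [sub_mulVec, smul_mulVec, vecMulVec_mulVec]
      ring
    rw [this]
    exact Submodule.add_mem_sup (mem_ln.2 ⟨_, rfl⟩) (mem_ln.2 ⟨_, rfl⟩)

lemma pLine_ln {w : V7} (hw : w ≠ 0) (hi : w ⬝ᵥ w = 0) (α z : ℂ) :
    pLine α (ln w) z = pv w ((z - conj α) / (z - α)) := by
  have hw' : star w ≠ 0 := star_ne_zero.2 hw
  rw [pLine, conjSub_ln, proj_compl_ln hw hi, proj_ln hw, proj_ln hw', pv, inv_div, star_star,
    dotProduct_comm w (star w)]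
  module

/-! ### Admissible pairs -/

lemma bil_eq_dot (x y : C7) : bil x y = x.ofLp ⬝ᵥ y.ofLp := rfl

lemma imMul_eq_cr (x y : C7) : imMul x y = cr x.ofLp y.ofLp := rfl

lemma ne_zero_of_norm {w : V7} (h : star w ⬝ᵥ w = 1) : w ≠ 0 := by
  rintro rfl; simp at h

lemma finrank_ln {w : V7} (hw : w ≠ 0) : Module.finrank ℂ (ln w) = 1 :=
  finrank_span_singleton (by simpa using hw)

lemma isIsotropicLine_ln {w : V7} (hw : w ≠ 0) (hi : w ⬝ᵥ w = 0) : IsIsotropicLine (ln w) := by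
  refine ⟨finrank_ln hw, fun x hx y hy => ?_⟩
  obtain ⟨a, ha⟩ := mem_ln.1 hx
  obtain ⟨b, hb⟩ := mem_ln.1 hy
  rw [bil_eq_dot, ha, hb, smul_dotProduct, dotProduct_smul, hi]
  simp

lemma exists_ln_of_isIsotropicLine {L : Submodule ℂ C7} (hL : IsIsotropicLine L) :
    ∃ w : V7, w ≠ 0 ∧ w ⬝ᵥ w = 0 ∧ L = ln w := by
  obtain ⟨v, hv0, hv⟩ := finrank_eq_one_iff'.1 hL.1
  refine ⟨v.1.ofLp, by simpa using hv0, hL.2 v v.2 v v.2, ?_⟩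
  ext x
  constructor
  · intro hx
    obtain ⟨c, hc⟩ := hv ⟨x, hx⟩
    exact mem_ln.2 ⟨c, by rw [← WithLp.ofLp_smul, ← Submodule.coe_smul, hc]⟩
  · intro hx
    obtain ⟨c, hc⟩ := mem_ln.1 hx
    have : x = c • v.1 := by
      rw [← WithLp.toLp_ofLp 2 x, hc]; rfl
    rw [this]
    exact L.smul_mem c v.2

lemma norm_eq_ofReal (w : V7) : ∃ r : ℝ, 0 ≤ r ∧ star w ⬝ᵥ w = r := by
  refine ⟨∑ i, Complex.normSq (w i), Finset.sum_nonneg fun i _ => Complex.normSq_nonneg _, ?_⟩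
  rw [Complex.ofReal_sum]
  exact Finset.sum_congr rfl fun i _ => by rw [Complex.normSq_eq_conj_mul_self]; rfl

lemma exists_normalize {w : V7} (hw : w ≠ 0) :
    ∃ r : ℝ, r ≠ 0 ∧ star ((r : ℂ) • w) ⬝ᵥ ((r : ℂ) • w) = 1 := by
  obtain ⟨r, hr, hr'⟩ := norm_eq_ofReal w
  have h0 : r ≠ 0 := by
    rintro rfl
    exact norm_ne_zero hw (by simpa using hr')
  have hs : √r ≠ 0 := Real.sqrt_ne_zero'.2 (lt_of_le_of_ne hr h0.symm)
  refine ⟨(√r)⁻¹, inv_ne_zero hs, ?_⟩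
  rw [star_smul, smul_dotProduct, dotProduct_smul, hr', RCLike.star_def, Complex.conj_ofReal]
  simp only [smul_eq_mul]
  rw [← Complex.ofReal_mul, ← Complex.ofReal_mul, ← Complex.ofReal_one]
  congr 1
  field_simp
  exact (Real.sq_sqrt hr).symm

lemma IsFrame.isCoassociative {l k : V7} (h : IsFrame l k) : IsCoassociative (ln l ⊔ ln k) := by
  have hl := ne_zero_of_norm h.sll
  have hk := ne_zero_of_norm h.skk
  have hmem : ∀ x ∈ ln l ⊔ ln k, ∃ a b : ℂ, x.ofLp = a • l + b • k := by
    intro x hx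
    obtain ⟨y, hy, z, hz, rfl⟩ := Submodule.mem_sup.1 hx
    obtain ⟨a, ha⟩ := mem_ln.1 hy
    obtain ⟨b, hb⟩ := mem_ln.1 hz
    exact ⟨a, b, by rw [WithLp.ofLp_add, ha, hb]⟩
  refine ⟨?_, fun x hx y hy => ?_, fun x hx y hy => ?_⟩
  · have h1 := Submodule.finrank_sup_add_finrank_inf_eq (ln l) (ln k)
    have h2 : ln l ⊓ ln k = ⊥ := by
      rw [eq_bot_iff]
      rintro x ⟨hx, hx'⟩
      obtain ⟨a, ha⟩ := mem_ln.1 hx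
      obtain ⟨b, hb⟩ := mem_ln.1 hx'
      have e : star l ⬝ᵥ x.ofLp = a := by rw [ha, dotProduct_smul, h.sll, smul_eq_mul, mul_one]
      rw [hb, dotProduct_smul, h.slk, smul_zero] at e
      rw [← e, zero_smul] at ha
      rw [Submodule.mem_bot, ← WithLp.toLp_ofLp 2 x, ha]
      rfl
    rw [h2, finrank_bot, finrank_ln hl, finrank_ln hk] at h1
    omega
  · obtain ⟨a, b, e⟩ := hmem x hx
    obtain ⟨a', b', e'⟩ := hmem y hy
    rw [bil_eq_dot, e, e']
    simp [h.ll, h.lk, h.kl, h.kk]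
  · obtain ⟨a, b, e⟩ := hmem x hx
    obtain ⟨a', b', e'⟩ := hmem y hy
    rw [imMul_eq_cr, e, e']
    simp only [cr_add_left, cr_add_right, cr_smul_left, cr_smul_right, cr_self, h.cr, cr_anti k l]
    simp

lemma IsFrame.add_ne_zero {l k : V7} (h : IsFrame l k) (c : ℂ) : k + c • star l ≠ 0 := by
  intro e
  have := congrArg (star k ⬝ᵥ ·) e
  simp [h.skk, h.sksl] at this

lemma IsFrame.add_isotropic {l k : V7} (h : IsFrame l k) (c : ℂ) :
    (k + c • star l) ⬝ᵥ (k + c • star l) = 0 := by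
  simp [h.kk, h.ksl, h.slk, h.slsl]

lemma proj_frame {l k : V7} (h : IsFrame l k) (c : ℂ) :
    (1 - (1 / (star l ⬝ᵥ l)) • vecMulVec l (star l) - (1 / (star l ⬝ᵥ l)) • vecMulVec (star l) l) *ᵥ
      (k + c • star l) = k := by
  simp only [sub_mulVec, smul_mulVec, vecMulVec_mulVec, one_mulVec, dotProduct_add, dotProduct_smul,
    h.sll, h.slk, h.slsl, h.lk, h.lsl, op_smul_eq_smul]
  module

lemma IsFrame.isPair {l k : V7} (h : IsFrame l k) (c : ℂ) :
    IsPair (ln l) (ln (k + c • star l)) := by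
  have hl := ne_zero_of_norm h.sll
  refine ⟨isIsotropicLine_ln hl h.ll, isIsotropicLine_ln (h.add_ne_zero c) (h.add_isotropic c),
    fun x hx y hy => ?_, ?_⟩
  · rw [conjSub_ln] at hy
    obtain ⟨a, ha⟩ := mem_ln.1 hx
    obtain ⟨b, hb⟩ := mem_ln.1 hy
    rw [bil_eq_dot, ha, hb]
    simp [h.ksl, h.slsl]
  · rw [conjSub_ln, proj_compl_ln hl h.ll, matSub_ln, proj_frame h]
    exact h.isCoassociative

/-- Converse to `IsFrame.isPair`. The condition `K ⊂ L̄^⊥` removes the component of `K` along `l`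
and leaves the one along `l̄` free; the latter is `c`. -/
lemma exists_frame_of_isPair {L K : Submodule ℂ C7} (h : IsPair L K) :
    ∃ (l k : V7) (c : ℂ), IsFrame l k ∧ L = ln l ∧ K = ln (k + c • star l) := by
  obtain ⟨hL, hK, h3, h4⟩ := h
  obtain ⟨l₀, hl0, hli, rfl⟩ := exists_ln_of_isIsotropicLine hL
  obtain ⟨r, hr, hr1⟩ := exists_normalize hl0
  have hrC : (r : ℂ) ≠ 0 := by exact_mod_cast hr
  rw [← ln_smul hrC l₀] at *
  have hl0' := ne_zero_of_norm hr1
  have hll : ((r : ℂ) • l₀) ⬝ᵥ ((r : ℂ) • l₀) = 0 := by simp [hli]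
  generalize (r : ℂ) • l₀ = l at *
  obtain ⟨w, hw0, hwi, rfl⟩ := exists_ln_of_isIsotropicLine hK
  rw [conjSub_ln] at *
  have hwl : star l ⬝ᵥ w = 0 := by
    rw [dotProduct_comm]
    exact h3 _ (mem_ln.2 ⟨1, (one_smul _ _).symm⟩) _ (mem_ln.2 ⟨1, (one_smul _ _).symm⟩)
  rw [proj_compl_ln hl0' hll, matSub_ln] at h4
  have hP : (1 - (1 / (star l ⬝ᵥ l)) • vecMulVec l (star l) -
      (1 / (star l ⬝ᵥ l)) • vecMulVec (star l) l) *ᵥ w = w - (l ⬝ᵥ w) • star l := by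
    simp only [sub_mulVec, smul_mulVec, vecMulVec_mulVec, one_mulVec, hwl, hr1, op_smul_eq_smul]
    module
  rw [hP] at h4
  set v := w - (l ⬝ᵥ w) • star l with hv
  have hv0 : v ≠ 0 := by
    intro e
    have h5 := h4.1
    rw [e] at h5
    have : ln (0 : V7) = ⊥ := by simp [ln]
    rw [this, sup_bot_eq, finrank_ln hl0'] at h5
    omega
  obtain ⟨q, hq, hq1⟩ := exists_normalize hv0
  have hqC : (q : ℂ) ≠ 0 := by exact_mod_cast hq
  have ml : (WithLp.toLp 2 l : C7) ∈ ln l ⊔ ln v :=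
    Submodule.mem_sup_left (mem_ln.2 ⟨1, (one_smul _ _).symm⟩)
  have mv : (WithLp.toLp 2 v : C7) ∈ ln l ⊔ ln v :=
    Submodule.mem_sup_right (mem_ln.2 ⟨1, (one_smul _ _).symm⟩)
  have slsl : star l ⬝ᵥ star l = 0 := by rw [star_dot_star, hll, star_zero]
  refine ⟨l, (q : ℂ) • v, q * (l ⬝ᵥ w), ⟨hll, ?_, ?_, hr1, hq1, ?_, ?_⟩, rfl, ?_⟩
  · have := h4.2.1 _ mv _ mv
    rw [bil_eq_dot] at this
    simp [this]
  · have := h4.2.1 _ ml _ mv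
    rw [bil_eq_dot] at this
    simp [this]
  · simp [hv, hwl, slsl]
  · have := h4.2.2 _ ml _ mv
    rw [imMul_eq_cr] at this
    rw [cr_smul_right, this, smul_zero]
  · rw [← ln_smul hqC w]
    congr 1
    rw [hv]
    module

/-- Rotating a frame in its `SL(2)`. -/
lemma IsFrame.rotate {m k : V7} (h : IsFrame m k) (c : ℂ) : ∃ n : ℝ, n ≠ 0 ∧
    (n : ℂ) ^ 2 = 1 + c * star c ∧
    IsFrame ((n : ℂ)⁻¹ • (m + c • star k)) ((n : ℂ)⁻¹ • (k - c • star m)) := by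
  have hpos : (0 : ℝ) < 1 + Complex.normSq c := by linarith [Complex.normSq_nonneg c]
  refine ⟨√(1 + Complex.normSq c), (Real.sqrt_pos.2 hpos).ne', ?_, ?_⟩
  · rw [← Complex.ofReal_pow, Real.sq_sqrt hpos.le, RCLike.star_def, Complex.mul_conj]
    push_cast; rfl
  · set n := √(1 + Complex.normSq c)
    have hn : (n : ℂ) ≠ 0 := by exact_mod_cast (Real.sqrt_pos.2 hpos).ne'
    have hn2 : (n : ℂ) ^ 2 = 1 + c * star c := by
      rw [← Complex.ofReal_pow, Real.sq_sqrt hpos.le, RCLike.star_def, Complex.mul_conj]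
      push_cast; rfl
    have hsn : star (n : ℂ)⁻¹ = (n : ℂ)⁻¹ := by
      rw [star_inv₀, RCLike.star_def, Complex.conj_ofReal]
    -- The matrix `n⁻¹ (1, -c̄; c, 1)` belongs to `SU(2)`, so it carries the frame to another frame.
    have g := h.isG2_slElem (a := (n : ℂ)⁻¹) (b := -(star c) / n) (c := c / n) (d := (n : ℂ)⁻¹)
      (by field_simp; rw [hn2]; ring)
    have e1 : slElem m k (n : ℂ)⁻¹ (-(star c) / n) (c / n) (n : ℂ)⁻¹ *ᵥ m =
        (n : ℂ)⁻¹ • (m + c • star k) := by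
      rw [slElem_mulVec]
      simp only [h.ll, h.sll, h.skl, h.kl]
      module
    have e2 : slElem m k (n : ℂ)⁻¹ (-(star c) / n) (c / n) (n : ℂ)⁻¹ *ᵥ k =
        (n : ℂ)⁻¹ • (k - c • star m) := by
      rw [slElem_mulVec]
      simp only [h.kk, h.skk, h.slk, h.lk]
      module
    rw [← e1, ← e2]
    refine ⟨by rw [g.dot, h.ll], by rw [g.dot, h.kk], by rw [g.dot, h.lk], ?_, ?_, ?_, ?_⟩
    · rw [e1]
      simp only [star_smul, hsn, star_add, star_star, smul_dotProduct, dotProduct_smul,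
        add_dotProduct, dotProduct_add, h.sll, h.slsk, h.kl, h.ksk, smul_eq_mul]
      field_simp
      rw [hn2]; ring
    · rw [e2]
      simp only [star_smul, hsn, star_sub, star_star, smul_dotProduct, dotProduct_smul,
        sub_dotProduct, dotProduct_sub, h.skk, h.sksl, h.lk, h.lsl, smul_eq_mul]
      field_simp
      rw [hn2]; ring
    · rw [e1, e2]
      simp only [star_smul, hsn, star_add, star_star, smul_dotProduct, dotProduct_smul,
        add_dotProduct, dotProduct_sub, h.slk, h.slsl, h.kk, h.ksl, smul_eq_mul]
      ring
    · rw [g.cross, h.cr, mulVec_zero]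

/-- For the rotated frame `l' = n⁻¹ (m + c k̄)`, `k' = n⁻¹ (k - c m̄)` one has `k' + c l̄' = n k`.
Pole lowering produces pairs in this form. -/
lemma IsFrame.isPair_right {m k : V7} (h : IsFrame m k) (c : ℂ) :
    IsPair (ln (m + c • star k)) (ln k) := by
  obtain ⟨n, hn, hn2, hf⟩ := h.rotate c
  have hnC : (n : ℂ) ≠ 0 := by exact_mod_cast hn
  have := hf.isPair c
  rw [ln_smul (inv_ne_zero hnC)] at this
  convert this using 1
  rw [← ln_smul hnC k]
  congr 1
  have hsn : star (n : ℂ)⁻¹ = (n : ℂ)⁻¹ := by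
    rw [star_inv₀, RCLike.star_def, Complex.conj_ofReal]
  simp only [star_smul, hsn, star_add, star_star]
  match_scalars
  · field_simp
    rw [hn2]
  · ring

lemma pPair_ln {v w : V7} (hv : v ≠ 0) (hvi : v ⬝ᵥ v = 0) (hw : w ≠ 0) (hwi : w ⬝ᵥ w = 0)
    (α z : ℂ) : pPair α (ln v) (ln w) z =
      pv v ((z - conj α) / (z - α)) * pv w ((z - conj α) / (z - α)) := by
  rw [pPair, pLine_ln hv hvi, pLine_ln hw hwi]

/-! ### The real structure of the split form -/

/-- The antilinear involution `x ↦ s x̄`. -/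
def theta (x : V7) : V7 := sMat *ᵥ star x

lemma star_sMat_mulVec (x : V7) : star (sMat *ᵥ x) = sMat *ᵥ star x := by
  rw [sMat_mulVec, sMat_mulVec]; ext i; fin_cases i <;> simp

lemma sMat_sMat_mulVec (x : V7) : sMat *ᵥ (sMat *ᵥ x) = x := by
  rw [mulVec_mulVec, sMat_mul_self, one_mulVec]

lemma theta_theta (x : V7) : theta (theta x) = x := by
  rw [theta, theta, star_sMat_mulVec, star_star, sMat_sMat_mulVec]

lemma theta_add (x y : V7) : theta (x + y) = theta x + theta y := by
  simp [theta, mulVec_add]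

lemma theta_smul (c : ℂ) (x : V7) : theta (c • x) = star c • theta x := by
  simp [theta, mulVec_smul]

lemma theta_dot (x y : V7) : theta x ⬝ᵥ theta y = star (x ⬝ᵥ y) := by
  rw [theta, theta, isG2_sMat.dot, star_dot_star]

lemma theta_cr (x y : V7) : theta (cr x y) = cr (theta x) (theta y) := by
  rw [theta, theta, theta, isG2_sMat.cross, star_cr]

lemma star_theta_dot (x y : V7) : star (theta x) ⬝ᵥ theta y = star (star x ⬝ᵥ y) := by
  rw [theta, theta, star_sMat_mulVec, isG2_sMat.dot, star_dot_star]

/-- The proposition `r` is a switch: `True` at imaginary poles, where all choices must be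
`theta`-invariant, and `False` elsewhere. This treats both cases by one argument. -/
lemma exists_unit_mem {W : Submodule ℂ V7} (hW : W ≠ ⊥) {r : Prop}
    (hr : r → ∀ w ∈ W, theta w ∈ W) :
    ∃ v ∈ W, star v ⬝ᵥ v = 1 ∧ (r → theta v = v) := by
  obtain ⟨w, hw, hw0⟩ := Submodule.exists_mem_ne_zero_of_ne_bot hW
  obtain ⟨v, hv, hv0, hvr⟩ : ∃ v ∈ W, v ≠ 0 ∧ (r → theta v = v) := by
    by_cases h : r
    -- Since `theta` is antilinear, either `w + theta w` is a nonzero fixed vector, or `theta w =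
    -- -w` and `i w` is fixed.
    · by_cases h0 : w + theta w = 0
      · refine ⟨Complex.I • w, W.smul_mem _ hw, by simpa using hw0, fun _ => ?_⟩
        have : theta w = -w := (neg_eq_of_add_eq_zero_right h0).symm
        rw [theta_smul, this]
        simp
      · refine ⟨_, W.add_mem hw (hr h w hw), h0, fun _ => ?_⟩
        rw [theta_add, theta_theta, add_comm]
    · exact ⟨w, hw, hw0, fun h' => absurd h' h⟩
  obtain ⟨c, hc, hc1⟩ := exists_normalize hv0
  refine ⟨_, W.smul_mem _ hv, hc1, fun h => ?_⟩
  rw [theta_smul, hvr h, RCLike.star_def, Complex.conj_ofReal]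

lemma theta_mem_hyper {m w : V7} (hm : theta m = m) (hw : w ∈ hyper (star m)) :
    theta w ∈ hyper (star m) := by
  rw [mem_hyper] at *
  conv_lhs => rw [← hm]
  rw [star_theta_dot, hw, star_zero]

lemma ne_bot_of_finrank_pos {W : Submodule ℂ V7} (h : 1 ≤ Module.finrank ℂ W) : W ≠ ⊥ := by
  rintro rfl; simp at h

lemma mem_span_pair_of_finrank {W : Submodule ℂ V7} (hW : Module.finrank ℂ W ≤ 2) {m k : V7}
    (hm : m ∈ W) (hk : k ∈ W) (h1 : star m ⬝ᵥ m = 1) (h2 : star k ⬝ᵥ k = 1)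
    (h3 : star m ⬝ᵥ k = 0) {w : V7} (hw : w ∈ W) :
    w = (star m ⬝ᵥ w) • m + (star k ⬝ᵥ w) • k := by
  have h3' : star k ⬝ᵥ m = 0 := by rw [star_dot_comm, h3, star_zero]
  have hli : LinearIndependent ℂ ![m, k] := by
    rw [LinearIndependent.pair_iff]
    intro a b hab
    have e1 := congrArg (star m ⬝ᵥ ·) hab
    have e2 := congrArg (star k ⬝ᵥ ·) hab
    simp [h1, h3] at e1
    simp [h2, h3'] at e2
    exact ⟨e1, e2⟩
  have hle : Submodule.span ℂ {m, k} ≤ W := Submodule.span_le.2 (by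
    rintro x (rfl | rfl) <;> assumption)
  have hf : Module.finrank ℂ (Submodule.span ℂ {m, k}) = 2 := by
    have := finrank_span_eq_card hli
    rwa [show Set.range ![m, k] = {m, k} by simp [Matrix.range_cons, Set.pair_comm]] at this
  have heq := Submodule.eq_of_le_of_finrank_le hle (by omega)
  rw [← heq, Submodule.mem_span_pair] at hw
  obtain ⟨a, b, rfl⟩ := hw
  simp [h1, h2, h3, h3']

/-! ### The leading coefficients at a pole -/

/-- Relations between the first two coefficients of `t ^ n • g`, `n ≥ 1`, for a loop `g` in `𝔾₂` with a
pole of order `n` at `t = 0`. -/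
structure IsLeading (A B : Mat7) (ε : ℂ) : Prop where
  ne : A ≠ 0
  dot₀ : ∀ x y : V7, A *ᵥ x ⬝ᵥ A *ᵥ y = 0
  dot₀' : A * Aᵀ = 0
  dot₁ : ∀ x y : V7, A *ᵥ x ⬝ᵥ B *ᵥ y + B *ᵥ x ⬝ᵥ A *ᵥ y = 0
  cr₀ : ∀ x y : V7, cr (A *ᵥ x) (A *ᵥ y) = 0
  cr₁ : ∀ x y : V7, cr (A *ᵥ x) (B *ᵥ y) + cr (B *ᵥ x) (A *ᵥ y) = ε • (A *ᵥ cr x y)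

lemma IsLeading.dot_self {A B : Mat7} {ε : ℂ} (h : IsLeading A B ε) (x : V7) :
    A *ᵥ x ⬝ᵥ B *ᵥ x = 0 := by
  have := h.dot₁ x x
  rw [dotProduct_comm (B *ᵥ x)] at this
  linear_combination this / 2

/-- A rank one residue of a simple pole is impossible. -/
lemma IsLeading.eps_eq_zero {A B : Mat7} {ε : ℂ} (h : IsLeading A B ε) {m : V7}
    (hm : ∀ x, A *ᵥ x = (star m ⬝ᵥ A *ᵥ x) • m) : ε = 0 := by
  by_contra hε
  -- Here `A = m vᵀ`, and `A Aᵀ = 0` makes `v` isotropic. On `v^⊥ = ker A` the relation `cr₁`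
  -- becomes `ε A (x · y) = 0`; for `ε ≠ 0` the form `⟨v, x · y⟩` would vanish on `v^⊥`, against
  -- `exists_cr_not_mem_span`.
  set v := Aᵀ *ᵥ star m with hv
  have e : ∀ x, star m ⬝ᵥ A *ᵥ x = v ⬝ᵥ x := fun x => by
    rw [hv, mulVec_transpose, dotProduct_mulVec]
  have hv0 : v ≠ 0 := by
    intro h0
    apply h.ne
    refine Matrix.mulVec_injective (funext fun x => ?_)
    rw [hm, e, h0, zero_dotProduct, zero_smul, zero_mulVec]
  have hvv : v ⬝ᵥ v = 0 := by
    rw [← e, hv, mulVec_mulVec, h.dot₀', zero_mulVec, dotProduct_zero]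
  obtain ⟨x, hx, hxv⟩ := exists_cr_not_mem_span hv0 hvv
  refine hxv (mem_span_of_dot hv0 fun y hy => ?_)
  have h0 : ∀ x, v ⬝ᵥ x = 0 → A *ᵥ x = 0 := fun x hx => by rw [hm, e, hx, zero_smul]
  have := h.cr₁ x y
  rw [h0 x hx, h0 y hy, cr_zero_left, cr_zero_right, add_zero] at this
  have h2 := (smul_eq_zero.1 this.symm).resolve_left hε
  rw [cr_dot, ← e, h2, dotProduct_zero]

/-- The image `W` of `A` is isotropic with vanishing product, so it has dimension one or two. In
dimension two, `dot₁` says that the pairing of `W` with the image of `B` is antisymmetric, hence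
given by one number `κ`. In dimension one, `m` is completed by a vector `k` orthogonal to the image
of `B`, and `κ = 0`. -/
theorem IsLeading.exists_frame {A B : Mat7} {ε : ℂ} (h : IsLeading A B ε) {r : Prop} {e : ℂ}
    (he : e * e = 1)
    (hrA : r → ∀ x, theta (A *ᵥ x) = e • (A *ᵥ theta x))
    (hrB : r → ∀ x, theta (B *ᵥ x) = -e • (B *ᵥ theta x)) :
    ∃ (m k : V7) (κ : ℂ), IsFrame m k ∧
      (∀ x, A *ᵥ x = (star m ⬝ᵥ A *ᵥ x) • m + (star k ⬝ᵥ A *ᵥ x) • k) ∧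
      (∀ x, m ⬝ᵥ B *ᵥ x = -κ * (star k ⬝ᵥ A *ᵥ x)) ∧ (∀ x, k ⬝ᵥ B *ᵥ x = κ * (star m ⬝ᵥ A *ᵥ x)) ∧
      (r → theta m = m ∧ theta k = k ∧ star κ = -κ) := by
  set W := LinearMap.range A.mulVecLin with hWdef
  have hAW : ∀ x, A *ᵥ x ∈ W := fun x => ⟨x, rfl⟩
  have hW0 : ∀ x ∈ W, ∀ y ∈ W, x ⬝ᵥ y = 0 := by
    rintro _ ⟨x, rfl⟩ _ ⟨y, rfl⟩; exact h.dot₀ x y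
  have hW1 : ∀ x ∈ W, ∀ y ∈ W, cr x y = 0 := by
    rintro _ ⟨x, rfl⟩ _ ⟨y, rfl⟩; exact h.cr₀ x y
  have hW2 := finrank_le_two_of_null hW0 hW1
  have hWb : W ≠ ⊥ := by
    intro hb
    apply h.ne
    refine Matrix.mulVec_injective (funext fun x => ?_)
    have := hAW x
    rw [hb, Submodule.mem_bot] at this
    rw [this, zero_mulVec]
  have hWr : r → ∀ w ∈ W, theta w ∈ W := by
    rintro hr _ ⟨x, rfl⟩
    rw [mulVecLin_apply, hrA hr]
    exact W.smul_mem _ (hAW _)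
  obtain ⟨m, hmW, hm1, hmr⟩ := exists_unit_mem hWb hWr
  have hm0 := ne_zero_of_norm hm1
  have hmm := hW0 m hmW m hmW
  obtain ⟨x₀, hx₀⟩ := hmW
  rw [mulVecLin_apply] at hx₀
  have hmB₀ : m ⬝ᵥ B *ᵥ x₀ = 0 := by rw [← hx₀, h.dot_self]
  have hAx₀ : r → A *ᵥ theta x₀ = e • m := fun hr => by
    have := hrA hr x₀
    rw [hx₀, hmr hr] at this
    rw [this, smul_smul, he, one_smul]
  by_cases hdim : Module.finrank ℂ W = 2
  · obtain ⟨k, ⟨hkW, hkm⟩, hk1, hkr⟩ := exists_unit_mem (W := W ⊓ hyper (star m)) (r := r)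
      (ne_bot_of_finrank_pos (by
        have := finrank_le_inf_ker_add_one (dotProductEquiv ℂ (Fin 7) (star m)) W
        rw [hdim] at this
        exact Nat.succ_le_succ_iff.1 this))
      (fun hr w hw => ⟨hWr hr w hw.1, theta_mem_hyper (hmr hr) hw.2⟩)
    have hmk : star m ⬝ᵥ k = 0 := mem_hyper.1 hkm
    have hmW : m ∈ W := ⟨x₀, hx₀⟩
    have hF : IsFrame m k :=
      ⟨hmm, hW0 k hkW k hkW, hW0 m hmW k hkW, hm1, hk1, hmk, hW1 m hmW k hkW⟩
    have hA : ∀ x, A *ᵥ x = (star m ⬝ᵥ A *ᵥ x) • m + (star k ⬝ᵥ A *ᵥ x) • k := fun x =>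
      mem_span_pair_of_finrank hW2 hmW hkW hm1 hk1 hmk (hAW x)
    obtain ⟨y₀, hy₀⟩ := hkW
    rw [mulVecLin_apply] at hy₀
    have hkB₀ : k ⬝ᵥ B *ᵥ y₀ = 0 := by rw [← hy₀, h.dot_self]
    have hmB : ∀ x, m ⬝ᵥ B *ᵥ x = -(k ⬝ᵥ B *ᵥ x₀) * (star k ⬝ᵥ A *ᵥ x) := fun x => by
      have := h.dot₁ x x₀
      rw [hx₀, hA x, add_dotProduct, smul_dotProduct, smul_dotProduct, hmB₀,
        dotProduct_comm (B *ᵥ x)] at this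
      simp only [smul_eq_mul] at this
      linear_combination this
    have hkB : ∀ x, k ⬝ᵥ B *ᵥ x = (k ⬝ᵥ B *ᵥ x₀) * (star m ⬝ᵥ A *ᵥ x) := fun x => by
      have := h.dot₁ x y₀
      rw [hy₀, hA x, add_dotProduct, smul_dotProduct, smul_dotProduct, hkB₀, hmB y₀, hy₀, hk1,
        dotProduct_comm (B *ᵥ x)] at this
      simp only [smul_eq_mul] at this
      linear_combination this
    refine ⟨m, k, k ⬝ᵥ B *ᵥ x₀, hF, hA, hmB, hkB, fun hr => ⟨hmr hr, hkr hr, ?_⟩⟩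
    rw [← theta_dot, hkr hr, hrB hr, dotProduct_smul, hkB, hAx₀ hr, dotProduct_smul, hm1]
    simp only [smul_eq_mul]
    linear_combination (-(k ⬝ᵥ B *ᵥ x₀)) * he
  · have hW1' : Module.finrank ℂ W ≤ 1 := Nat.lt_succ_iff.1 (lt_of_le_of_ne hW2 hdim)
    have hA : ∀ x, A *ᵥ x = (star m ⬝ᵥ A *ᵥ x) • m := fun x => by
      have hle : (ℂ ∙ m) ≤ W := (Submodule.span_singleton_le_iff_mem _ _).2 ⟨x₀, hx₀⟩
      have heq := Submodule.eq_of_le_of_finrank_le hle (by rwa [finrank_span_singleton hm0])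
      have := hAW x
      rw [← heq, Submodule.mem_span_singleton] at this
      obtain ⟨a, ha⟩ := this
      rw [← ha, dotProduct_smul, hm1]
      simp
    have hε := h.eps_eq_zero hA
    -- As `ε = 0`, the matrix `B` maps `ker A` into the isotropic space `annihil m`. For `k` in
    -- `annihil m` the functional `⟨k, B x⟩` therefore vanishes as soon as it does at `x₀`.
    have hker : ∀ z, A *ᵥ z = 0 → cr m (B *ᵥ z) = 0 := fun z hz => by
      have := h.cr₁ x₀ z
      rwa [hx₀, hz, cr_zero_right, add_zero, hε, zero_smul] at this
    have hkB : ∀ k, cr m k = 0 → k ⬝ᵥ B *ᵥ x₀ = 0 → ∀ x, k ⬝ᵥ B *ᵥ x = 0 := by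
      intro k hk hk0 x
      have hz : A *ᵥ (x - (star m ⬝ᵥ A *ᵥ x) • x₀) = 0 := by
        rw [mulVec_sub, mulVec_smul, hx₀, ← hA, sub_self]
      have := annihil_isotropic hm0 hmm hk (hker _ hz)
      rw [mulVec_sub, mulVec_smul, dotProduct_sub, dotProduct_smul, hk0] at this
      simpa using this
    have hmB : ∀ x, m ⬝ᵥ B *ᵥ x = 0 := hkB m (cr_self m) hmB₀
    -- The space `annihil m` is three-dimensional, so two linear conditions leave a nonzero vector.
    obtain ⟨k, ⟨⟨hkE, hkm⟩, hkB₀⟩, hk1, hkr⟩ := exists_unit_mem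
      (W := annihil m ⊓ hyper (star m) ⊓ hyper (B *ᵥ x₀)) (r := r)
      (ne_bot_of_finrank_pos (by
        have e1 := finrank_le_inf_ker_add_one (dotProductEquiv ℂ (Fin 7) (star m)) (annihil m)
        have e2 := finrank_le_inf_ker_add_one (dotProductEquiv ℂ (Fin 7) (B *ᵥ x₀))
          (annihil m ⊓ hyper (star m))
        rw [finrank_annihil hm0 hmm] at e1
        exact Nat.succ_le_succ_iff.1 (Nat.succ_le_succ_iff.1 (e1.trans (Nat.succ_le_succ e2)))))
      (by
        rintro hr w ⟨⟨h1, h2⟩, h3⟩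
        have h1' : cr m w = 0 := mem_annihil.1 h1
        have h3' : w ⬝ᵥ B *ᵥ x₀ = 0 := by rw [dotProduct_comm]; exact mem_hyper.1 h3
        refine ⟨⟨?_, theta_mem_hyper (hmr hr) h2⟩, ?_⟩
        · refine mem_annihil.2 ?_
          rw [← hmr hr, ← theta_cr, h1']
          simp [theta]
        · refine mem_hyper.2 ?_
          -- `theta` moves `B x₀` to a multiple of `B (theta x₀)`, so orthogonality to the whole
          -- image of `B` is needed here.
          rw [← theta_theta (B *ᵥ x₀), theta_dot, hrB hr, smul_dotProduct, dotProduct_comm,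
            hkB w h1' h3']
          simp)
    have hk' : cr m k = 0 := mem_annihil.1 hkE
    have hkB' : k ⬝ᵥ B *ᵥ x₀ = 0 := by rw [dotProduct_comm]; exact mem_hyper.1 hkB₀
    have hmk : star m ⬝ᵥ k = 0 := mem_hyper.1 hkm
    have hkm' : star k ⬝ᵥ m = 0 := by rw [star_dot_comm, hmk, star_zero]
    refine ⟨m, k, 0, ⟨hmm, annihil_isotropic hm0 hmm hk' hk', dot_eq_zero_of_annihil hm0 hmm hk',
      hm1, hk1, hmk, hk'⟩, fun x => ?_, fun x => ?_, fun x => ?_,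
      fun hr => ⟨hmr hr, hkr hr, by simp⟩⟩
    · rw [hA x, dotProduct_smul, dotProduct_smul, hkm', hm1]
      simp
    · rw [hmB]; simp
    · rw [hkB k hk' hkB']; simp

/-! ### Functions near a point, up to an open and dense set -/

/-- The traces near `b` of the sets that contain an open and dense set. -/
def nd (b : ℂ) : Filter ℂ := 𝓝 b ⊓ openDense

lemma eventually_nd {b : ℂ} {P : ℂ → Prop} : (∀ᶠ z in nd b, P z) ↔
    ∃ U W : Set ℂ, IsOpen U ∧ b ∈ U ∧ IsOpen W ∧ Dense W ∧ ∀ z ∈ U, z ∈ W → P z := by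
  rw [nd, Filter.eventually_inf]
  constructor
  · rintro ⟨s, hs, t, ⟨W, hWt, hWo, hWd⟩, h⟩
    obtain ⟨U, hUs, hUo, hbU⟩ := mem_nhds_iff.1 hs
    exact ⟨U, W, hUo, hbU, hWo, hWd, fun z hz hz' => h z ⟨hUs hz, hWt hz'⟩⟩
  · rintro ⟨U, W, hUo, hbU, hWo, hWd, h⟩
    exact ⟨U, hUo.mem_nhds hbU, W, ⟨W, subset_rfl, hWo, hWd⟩, fun z hz => h z hz.1 hz.2⟩

/-- Neighbourhoods of `b` meet every dense set. Limits along `nd b` are thus unique, although loops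
are only known up to open dense sets. -/
instance (b : ℂ) : (nd b).NeBot := by
  rw [← Filter.frequently_true_iff_neBot]
  intro h
  obtain ⟨U, W, hUo, hbU, hWo, hWd, h⟩ := eventually_nd.1 h
  obtain ⟨z, hz, hz'⟩ := hWd.inter_open_nonempty U hUo ⟨b, hbU⟩
  exact h z hz hz' trivial

lemma nd_le_nhds (b : ℂ) : nd b ≤ 𝓝 b := inf_le_left

lemma nd_le_openDense (b : ℂ) : nd b ≤ openDense := inf_le_right

lemma compl_singleton_mem_openDense (b : ℂ) : ({b}ᶜ : Set ℂ) ∈ openDense :=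
  ⟨{b}ᶜ, subset_rfl, isOpen_compl_singleton, dense_compl_singleton b⟩

lemma nd_le_nhdsNE (b : ℂ) : nd b ≤ 𝓝[≠] b :=
  le_inf (nd_le_nhds b) (le_principal_iff.2 (nd_le_openDense b (compl_singleton_mem_openDense b)))

lemma eventually_nd_ne (a b : ℂ) : ∀ᶠ z in nd b, z ≠ a :=
  nd_le_openDense b (compl_singleton_mem_openDense a)

lemma eventually_eventually_nd {b : ℂ} {P : ℂ → Prop} (h : ∀ᶠ z in nd b, P z) :
    ∀ᶠ b' in 𝓝 b, ∀ᶠ z in nd b', P z := by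
  obtain ⟨U, W, hUo, hbU, hWo, hWd, h⟩ := eventually_nd.1 h
  filter_upwards [hUo.mem_nhds hbU] with b' hb'
  exact eventually_nd.2 ⟨U, W, hUo, hb', hWo, hWd, h⟩

lemma eventually_openDense_of_nd {P : ℂ → Prop} (h : ∀ b, ∀ᶠ z in nd b, P z) :
    ∀ᶠ z in openDense, P z := by
  choose U W hUo hbU hWo hWd h using fun b => eventually_nd.1 (h b)
  refine ⟨⋃ b, U b ∩ W b, ?_, isOpen_iUnion fun b => (hUo b).inter (hWo b), ?_⟩
  · intro z hz
    obtain ⟨b, hz⟩ := Set.mem_iUnion.1 hz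
    exact h b z hz.1 hz.2
  · rw [dense_iff_inter_open]
    rintro O hO ⟨b, hb⟩
    obtain ⟨z, hz, hz'⟩ := (hWd b).inter_open_nonempty (O ∩ U b) (hO.inter (hUo b)) ⟨b, hb, hbU b⟩
    exact ⟨z, hz.1, Set.mem_iUnion.2 ⟨b, hz.2, hz'⟩⟩

lemma tendsto_openDense (e : ℂ ≃ₜ ℂ) : Tendsto e openDense openDense := by
  rintro s ⟨U, hU, hUo, hUd⟩
  exact ⟨e ⁻¹' U, Set.preimage_mono hU, hUo.preimage e.continuous,
    hUd.preimage e.isOpenMap⟩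

lemma tendsto_nd (e : ℂ ≃ₜ ℂ) (b : ℂ) : Tendsto e (nd b) (nd (e b)) :=
  tendsto_inf.2 ⟨(e.continuous.tendsto b).mono_left inf_le_left,
    (tendsto_openDense e).mono_left inf_le_right⟩

lemma tendsto_conj_openDense : Tendsto (conj : ℂ → ℂ) openDense openDense :=
  tendsto_openDense Complex.conjCLE.toHomeomorph

lemma tendsto_neg_openDense : Tendsto (fun z : ℂ => -z) openDense openDense :=
  tendsto_openDense (Homeomorph.neg ℂ)

lemma tendsto_conj_nd (b : ℂ) : Tendsto (conj : ℂ → ℂ) (nd b) (nd (conj b)) :=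
  tendsto_nd Complex.conjCLE.toHomeomorph b

lemma tendsto_neg_nd (b : ℂ) : Tendsto (fun z : ℂ => -z) (nd b) (nd (-b)) :=
  tendsto_nd (Homeomorph.neg ℂ) b

/-! ### Regular functions -/

/-- `f` agrees along `l` with a function that is analytic at `b`. -/
def RegAt (l : Filter ℂ) (f : ℂ → ℂ) (b : ℂ) : Prop := ∃ h : ℂ → ℂ, AnalyticAt ℂ h b ∧ f =ᶠ[l] h

section RegAt

variable {l l' : Filter ℂ} {f g : ℂ → ℂ} {b : ℂ}

lemma RegAt.mono (hf : RegAt l f b) (h : l' ≤ l) : RegAt l' f b :=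
  let ⟨u, hu, e⟩ := hf
  ⟨u, hu, h e⟩

lemma RegAt.congr (hf : RegAt l f b) (h : g =ᶠ[l] f) : RegAt l g b :=
  let ⟨u, hu, e⟩ := hf
  ⟨u, hu, h.trans e⟩

lemma regAt_of_analyticAt (hf : AnalyticAt ℂ f b) : RegAt l f b := ⟨f, hf, EventuallyEq.rfl⟩

lemma RegAt.add (hf : RegAt l f b) (hg : RegAt l g b) : RegAt l (fun z => f z + g z) b :=
  let ⟨u, hu, e⟩ := hf
  let ⟨v, hv, e'⟩ := hg
  ⟨fun z => u z + v z, hu.add hv, e.add e'⟩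

lemma RegAt.mul (hf : RegAt l f b) (hg : RegAt l g b) : RegAt l (fun z => f z * g z) b :=
  let ⟨u, hu, e⟩ := hf
  let ⟨v, hv, e'⟩ := hg
  ⟨fun z => u z * v z, hu.mul hv, e.mul e'⟩

lemma RegAt.const (c : ℂ) : RegAt l (fun _ => c) b := regAt_of_analyticAt analyticAt_const

lemma RegAt.sum {ι : Type*} (s : Finset ι) {F : ι → ℂ → ℂ} (h : ∀ i ∈ s, RegAt l (F i) b) :
    RegAt l (fun z => ∑ i ∈ s, F i z) b := by
  classical
  induction s using Finset.induction_on with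
  | empty => simpa using RegAt.const 0
  | insert i s hi ih =>
    simp only [Finset.sum_insert hi]
    exact (h i (Finset.mem_insert_self i s)).add
      (ih fun j hj => h j (Finset.mem_insert_of_mem hj))

end RegAt

lemma exists_eq_add_mul_of_analyticAt {f : ℂ → ℂ} {b : ℂ} (hf : AnalyticAt ℂ f b) :
    ∃ g : ℂ → ℂ, AnalyticAt ℂ g b ∧ ∀ z, f z = f b + (z - b) * g z := by
  obtain ⟨p, hp⟩ := hf
  refine ⟨dslope f b, ⟨_, hp.has_fpower_series_dslope_fslope⟩, fun z => ?_⟩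
  have := sub_smul_dslope f b z
  rw [smul_eq_mul] at this
  rw [this]; ring

lemma RegAt.expansion {l : Filter ℂ} {f : ℂ → ℂ} {b : ℂ} (hf : RegAt l f b) :
    ∃ (a c : ℂ) (R : ℂ → ℂ), AnalyticAt ℂ R b ∧
      ∀ᶠ z in l, f z = a + (z - b) * c + (z - b) ^ 2 * R z := by
  obtain ⟨h, hh, e⟩ := hf
  obtain ⟨g, hg, e1⟩ := exists_eq_add_mul_of_analyticAt hh
  obtain ⟨R, hR, e2⟩ := exists_eq_add_mul_of_analyticAt hg
  refine ⟨h b, g b, R, hR, ?_⟩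
  filter_upwards [e] with z hz
  rw [hz, e1, e2]; ring

/-- Comparison of coefficients. -/
lemma coeff_eq_zero {a c : ℂ} {R : ℂ → ℂ} {b : ℂ} (hR : ContinuousAt R b)
    (h : ∀ᶠ z in nd b, a + (z - b) * c + (z - b) ^ 2 * R z = 0) : a = 0 ∧ c = 0 := by
  have hl := nd_le_nhds b
  have ha : a = 0 := by
    have h1 : Tendsto (fun z => a + (z - b) * c + (z - b) ^ 2 * R z) (nd b)
        (𝓝 (a + (b - b) * c + (b - b) ^ 2 * R b)) :=
      ContinuousAt.tendsto (f := fun z => a + (z - b) * c + (z - b) ^ 2 * R z) (by fun_prop)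
        |>.mono_left hl
    have h2 := tendsto_nhds_unique_of_eventuallyEq h1 tendsto_const_nhds h
    simpa using h2
  refine ⟨ha, ?_⟩
  have h1 : Tendsto (fun z => c + (z - b) * R z) (nd b) (𝓝 (c + (b - b) * R b)) :=
    ContinuousAt.tendsto (f := fun z => c + (z - b) * R z) (by fun_prop) |>.mono_left hl
  have h2 := tendsto_nhds_unique_of_eventuallyEq h1 (tendsto_const_nhds (x := (0 : ℂ))) (by
    filter_upwards [h, eventually_nd_ne b b] with z hz hzb
    have : (z - b) * (c + (z - b) * R z) = 0 := by rw [← hz, ha]; ring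
    exact (mul_eq_zero.1 this).resolve_left (sub_ne_zero.2 hzb))
  simpa using h2

lemma analyticAt_conj_conj {f : ℂ → ℂ} {b : ℂ} (hf : AnalyticAt ℂ f b) :
    AnalyticAt ℂ (fun z => conj (f (conj z))) (conj b) := by
  rw [Complex.analyticAt_iff_eventually_differentiableAt] at *
  have ht : Tendsto (conj : ℂ → ℂ) (𝓝 (conj b)) (𝓝 b) := by
    simpa using Complex.continuous_conj.tendsto (conj b)
  filter_upwards [ht.eventually hf] with z hz
  have := hz.conj_conj
  simpa [Function.comp_def] using this

lemma RegAt.conj {f : ℂ → ℂ} {b : ℂ} (hf : RegAt (nd b) f b) :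
    RegAt (nd (conj b)) (fun z => conj (f (conj z))) (conj b) := by
  obtain ⟨h, hh, e⟩ := hf
  refine ⟨_, analyticAt_conj_conj hh, ?_⟩
  have ht : Tendsto (conj : ℂ → ℂ) (nd (conj b)) (nd b) := by
    simpa using tendsto_conj_nd (conj b)
  filter_upwards [ht.eventually e] with z hz
  rw [hz]

lemma RegAt.neg_arg {f : ℂ → ℂ} {b : ℂ} (hf : RegAt (nd b) f b) :
    RegAt (nd (-b)) (fun z => f (-z)) (-b) := by
  obtain ⟨h, hh, e⟩ := hf
  refine ⟨fun z => h (-z), ?_, ?_⟩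
  · have hh' : AnalyticAt ℂ h (-(-b)) := by rwa [neg_neg]
    exact hh'.comp (analyticAt_id.neg)
  · have ht : Tendsto (fun z : ℂ => -z) (nd (-b)) (nd b) := by
      simpa using tendsto_neg_nd (-b)
    exact ht.eventually e

/-- Liouville's theorem for functions without poles on the Riemann sphere. -/
lemma eventually_eq_of_regAt {f : ℂ → ℂ} {c : ℂ} (h : ∀ b, RegAt (nd b) f b)
    (hc : Tendsto f (cocompact ℂ ⊓ openDense) (𝓝 c)) : ∀ᶠ z in openDense, f z = c := by
  choose u hu e using h
  -- The local analytic representatives `u b` are glued along the diagonal: at `b'`, both `u b` and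
  -- `u b'` take the limit of `f` along `nd b'` as their value.
  have key : ∀ b, ∀ᶠ b' in 𝓝 b, u b' b' = u b b' := fun b => by
    filter_upwards [eventually_eventually_nd (e b), (hu b).eventually_analyticAt] with b' h1 h2
    have t1 : Tendsto f (nd b') (𝓝 (u b b')) :=
      (h2.continuousAt.tendsto.mono_left (nd_le_nhds b')).congr' (EventuallyEq.symm h1)
    have t2 : Tendsto f (nd b') (𝓝 (u b' b')) :=
      ((hu b').continuousAt.tendsto.mono_left (nd_le_nhds b')).congr' (e b').symm
    exact tendsto_nhds_unique t2 t1
  set H : ℂ → ℂ := fun b => u b b with hH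
  have hd : Differentiable ℂ H := fun b =>
    (hu b).differentiableAt.congr_of_eventuallyEq (key b)
  -- Values of `H` are limits of values of `f`, so closed neighbourhoods of `c` carry the limit at
  -- infinity over from `f` to `H`.
  have hlim : Tendsto H (cocompact ℂ) (𝓝 c) := by
    rw [(closed_nhds_basis c).tendsto_right_iff]
    rintro V ⟨hV, hVc⟩
    have h1 := hc.eventually hV
    rw [Filter.eventually_inf] at h1
    obtain ⟨s, hs, t, ht, h1⟩ := h1
    obtain ⟨K, hK, hKs⟩ := mem_cocompact.1 hs
    filter_upwards [hK.compl_mem_cocompact] with b hb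
    have t2 : Tendsto f (nd b) (𝓝 (u b b)) :=
      ((hu b).continuousAt.tendsto.mono_left (nd_le_nhds b)).congr' (e b).symm
    refine hVc.mem_of_tendsto t2 ?_
    filter_upwards [nd_le_nhds b (hK.isClosed.isOpen_compl.mem_nhds hb), nd_le_openDense b ht]
      with z hz hz'
    exact h1 z ⟨hKs hz, hz'⟩
  refine eventually_openDense_of_nd fun b => ?_
  filter_upwards [e b, nd_le_nhds b (key b)] with z h1 h2
  rw [h1, ← h2]
  exact hd.apply_eq_of_tendsto_cocompact z hlim

/-! ### Regular matrix valued functions -/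

/-- All entries of `F` are regular at `b`. -/
def MReg (l : Filter ℂ) (F : ℂ → Mat7) (b : ℂ) : Prop := ∀ i j, RegAt l (fun z => F z i j) b

section MReg

variable {l l' : Filter ℂ} {F G : ℂ → Mat7} {b : ℂ}

lemma MReg.mono (hF : MReg l F b) (h : l' ≤ l) : MReg l' F b := fun i j => (hF i j).mono h

lemma MReg.congr (hF : MReg l F b) (h : ∀ᶠ z in l, G z = F z) : MReg l G b := fun i j =>
  (hF i j).congr (h.mono fun z hz => by simp only [hz])

lemma MReg.const (A : Mat7) : MReg l (fun _ => A) b := fun i j => RegAt.const (A i j)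

lemma MReg.add (hF : MReg l F b) (hG : MReg l G b) : MReg l (fun z => F z + G z) b :=
  fun i j => (hF i j).add (hG i j)

lemma MReg.mul (hF : MReg l F b) (hG : MReg l G b) : MReg l (fun z => F z * G z) b := fun i j => by
  simp only [mul_apply]
  exact RegAt.sum _ fun k _ => (hF i k).mul (hG k j)

lemma MReg.smul {f : ℂ → ℂ} (hf : RegAt l f b) (hG : MReg l G b) : MReg l (fun z => f z • G z) b :=
  fun i j => hf.mul (hG i j)

lemma MReg.transpose (hF : MReg l F b) : MReg l (fun z => (F z)ᵀ) b := fun i j => hF j i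

lemma MReg.conj (hF : MReg (nd b) F b) :
    MReg (nd (conj b)) (fun z => (F (conj z)).map star) (conj b) := fun i j => (hF i j).conj

lemma MReg.neg_arg (hF : MReg (nd b) F b) : MReg (nd (-b)) (fun z => F (-z)) (-b) :=
  fun i j => (hF i j).neg_arg

lemma MReg.expansion (hF : MReg l F b) : ∃ (A B : Mat7) (R : ℂ → Mat7),
    (∀ i j, AnalyticAt ℂ (fun z => R z i j) b) ∧
      ∀ᶠ z in l, F z = A + (z - b) • B + (z - b) ^ 2 • R z := by
  choose A B R hR h using fun i j => (hF i j).expansion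
  refine ⟨of A, of B, fun z => of fun i j => R i j z, hR, ?_⟩
  have : ∀ᶠ z in l, ∀ i j, F z i j = A i j + (z - b) * B i j + (z - b) ^ 2 * R i j z :=
    eventually_all.2 fun i => eventually_all.2 fun j => h i j
  filter_upwards [this] with z hz
  ext i j
  simpa using hz i j

end MReg

lemma eventually_eq_one_of_mReg {F : ℂ → Mat7} (h : ∀ b, MReg (nd b) F b)
    (hc : ∀ i j, Tendsto (fun z => F z i j) (cocompact ℂ ⊓ openDense) (𝓝 ((1 : Mat7) i j))) :
    ∀ᶠ z in openDense, F z = 1 := by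
  have : ∀ᶠ z in openDense, ∀ i j, F z i j = (1 : Mat7) i j :=
    eventually_all.2 fun i => eventually_all.2 fun j =>
      eventually_eq_of_regAt (fun b => h b i j) (hc i j)
  filter_upwards [this] with z hz
  ext i j
  exact hz i j

/-! ### Pole orders -/

/-- `g` has a pole of order at most `n` at `b`. -/
def PoleLE (g : ℂ → Mat7) (b : ℂ) (n : ℕ) : Prop := MReg (nd b) (fun z => (z - b) ^ n • g z) b

lemma regAt_sub_pow (l : Filter ℂ) (a b : ℂ) (n : ℕ) : RegAt l (fun z => (z - a) ^ n) b :=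
  regAt_of_analyticAt ((analyticAt_id.sub analyticAt_const).pow n)

lemma regAt_inv_sub (l : Filter ℂ) {a b : ℂ} (h : b ≠ a) : RegAt l (fun z => (z - a)⁻¹) b :=
  regAt_of_analyticAt ((analyticAt_id.sub analyticAt_const).inv (sub_ne_zero.2 h))

lemma PoleLE.mono {g : ℂ → Mat7} {b : ℂ} {n m : ℕ} (h : PoleLE g b n) (hnm : n ≤ m) :
    PoleLE g b m := by
  refine (MReg.smul (regAt_sub_pow _ b b (m - n)) h).congr (Eventually.of_forall fun z => ?_)
  rw [smul_smul, ← pow_add, Nat.sub_add_cancel hnm]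

lemma PoleLE.congr {g g' : ℂ → Mat7} {b : ℂ} {n : ℕ} (h : PoleLE g b n)
    (e : ∀ᶠ z in nd b, g' z = g z) : PoleLE g' b n :=
  MReg.congr h (e.mono fun z hz => by rw [hz])

lemma PoleLE.mul_left {g P : ℂ → Mat7} {b : ℂ} {n : ℕ} (h : PoleLE g b n) (hP : MReg (nd b) P b) :
    PoleLE (fun z => P z * g z) b n :=
  (hP.mul h).congr (Eventually.of_forall fun z => by rw [mul_smul_comm])

lemma poleLE_zero {g : ℂ → Mat7} {b : ℂ} : PoleLE g b 0 ↔ MReg (nd b) g b := by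
  simp [PoleLE]

lemma PoleLE.real {g : ℂ → Mat7} (hg : ∀ᶠ z in openDense, (g (conj z)).map star = g z) {b : ℂ}
    {n : ℕ} (h : PoleLE g b n) : PoleLE g (conj b) n := by
  refine (MReg.conj h).congr ?_
  filter_upwards [nd_le_openDense _ hg] with z hz
  rw [← hz]
  ext i j
  simp

lemma PoleLE.twisted {g : ℂ → Mat7} (hg : ∀ᶠ z in openDense, sMat * g (-z) * sMat = g z) {b : ℂ}
    {n : ℕ} (h : PoleLE g b n) : PoleLE g (-b) n := by
  have h1 := (MReg.neg_arg h)
  refine (MReg.smul (RegAt.const ((-1) ^ n)) (((MReg.const sMat).mul h1).mul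
    (MReg.const sMat))).congr ?_
  filter_upwards [nd_le_openDense _ hg] with z hz
  rw [← hz, mul_smul_comm, smul_mul_assoc, smul_smul, ← mul_pow]
  congr 2
  ring

/-! ### Relations between leading coefficients -/

lemma continuous_cr : Continuous fun p : V7 × V7 => cr p.1 p.2 := by
  simp only [cr_eq]
  refine continuous_pi fun i => ?_
  fin_cases i <;> simp <;> fun_prop

lemma continuous_cr_comp {X : Type*} [TopologicalSpace X] {f g : X → V7} (hf : Continuous f)
    (hg : Continuous g) : Continuous fun p => cr (f p) (g p) :=
  Continuous.comp (g := fun p : V7 × V7 => cr p.1 p.2) (f := fun p => (f p, g p)) continuous_cr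
    (hf.prodMk hg)

lemma leading_dot {A B : Mat7} {R : ℂ → Mat7} {b : ℂ} {n : ℕ} (hn : 1 ≤ n) (hR : ContinuousAt R b)
    (h : ∀ᶠ z in nd b, ∀ x y : V7, (A + (z - b) • B + (z - b) ^ 2 • R z) *ᵥ x ⬝ᵥ
      (A + (z - b) • B + (z - b) ^ 2 • R z) *ᵥ y = (z - b) ^ (2 * n) * (x ⬝ᵥ y)) (x y : V7) :
    A *ᵥ x ⬝ᵥ A *ᵥ y = 0 ∧ A *ᵥ x ⬝ᵥ B *ᵥ y + B *ᵥ x ⬝ᵥ A *ᵥ y = 0 := by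
  -- `Φ` collects everything of order at least two in `t = z - b`. The right side contributes `t ^
  -- (2n) = t² t ^ (2(n-1))`, which does not reach the first two coefficients since `n ≥ 1`.
  set Φ : ℂ × Mat7 → ℂ := fun p => A *ᵥ x ⬝ᵥ p.2 *ᵥ y + B *ᵥ x ⬝ᵥ B *ᵥ y + p.2 *ᵥ x ⬝ᵥ A *ᵥ y +
    (p.1 - b) * (B *ᵥ x ⬝ᵥ p.2 *ᵥ y + p.2 *ᵥ x ⬝ᵥ B *ᵥ y) +
    (p.1 - b) ^ 2 * (p.2 *ᵥ x ⬝ᵥ p.2 *ᵥ y) - (p.1 - b) ^ (2 * (n - 1)) * (x ⬝ᵥ y) with hΦ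
  have hc : Continuous Φ := by fun_prop
  refine coeff_eq_zero (R := fun z => Φ (z, R z))
    (hc.continuousAt.comp (continuousAt_id.prodMk hR)) ?_
  filter_upwards [h] with z hz
  have h1 := hz x y
  obtain ⟨k, rfl⟩ : ∃ k, n = k + 1 := ⟨n - 1, by omega⟩
  simp only [add_mulVec, smul_mulVec, add_dotProduct, dotProduct_add, smul_dotProduct,
    dotProduct_smul, smul_eq_mul] at h1
  simp only [hΦ, Nat.add_sub_cancel]
  linear_combination h1

lemma leading_cr {A B : Mat7} {R : ℂ → Mat7} {b : ℂ} {n : ℕ} (hn : 1 ≤ n) (hR : ContinuousAt R b)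
    (h : ∀ᶠ z in nd b, ∀ x y : V7, cr ((A + (z - b) • B + (z - b) ^ 2 • R z) *ᵥ x)
      ((A + (z - b) • B + (z - b) ^ 2 • R z) *ᵥ y) =
        (z - b) ^ n • ((A + (z - b) • B + (z - b) ^ 2 • R z) *ᵥ cr x y)) (x y : V7) :
    cr (A *ᵥ x) (A *ᵥ y) = 0 ∧ cr (A *ᵥ x) (B *ᵥ y) + cr (B *ᵥ x) (A *ᵥ y) =
      (if n = 1 then 1 else 0 : ℂ) • (A *ᵥ cr x y) := by
  have key : ∀ i, cr (A *ᵥ x) (A *ᵥ y) i = 0 ∧ (cr (A *ᵥ x) (B *ᵥ y) + cr (B *ᵥ x) (A *ᵥ y) -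
      (if n = 1 then 1 else 0 : ℂ) • (A *ᵥ cr x y)) i = 0 := by
    intro i
    -- The right side `t ^ n (A + ⋯)` reaches the coefficient of `t` exactly when `n = 1`; this is
    -- the origin of the `ε` in `IsLeading`.
    set Ψ : ℂ × Mat7 → V7 := fun p => cr (A *ᵥ x) (p.2 *ᵥ y) + cr (B *ᵥ x) (B *ᵥ y) +
      cr (p.2 *ᵥ x) (A *ᵥ y) + (p.1 - b) • (cr (B *ᵥ x) (p.2 *ᵥ y) + cr (p.2 *ᵥ x) (B *ᵥ y)) +
      (p.1 - b) ^ 2 • cr (p.2 *ᵥ x) (p.2 *ᵥ y) - (if n = 1 then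
        (B + (p.1 - b) • p.2) *ᵥ cr x y else
        (p.1 - b) ^ (n - 2) • ((A + (p.1 - b) • B + (p.1 - b) ^ 2 • p.2) *ᵥ cr x y)) with hΨ
    have hc : Continuous Ψ := by
      have c1 : Continuous fun p : ℂ × Mat7 => p.2 *ᵥ x := by fun_prop
      have c2 : Continuous fun p : ℂ × Mat7 => p.2 *ᵥ y := by fun_prop
      have e1 := continuous_cr_comp (continuous_const (y := A *ᵥ x)) c2
      have e2 := continuous_cr_comp c1 (continuous_const (y := A *ᵥ y))
      have e3 := continuous_cr_comp (continuous_const (y := B *ᵥ x)) c2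
      have e4 := continuous_cr_comp c1 (continuous_const (y := B *ᵥ y))
      have e5 := continuous_cr_comp c1 c2
      by_cases h1 : n = 1
      · simp only [hΨ, if_pos h1]; fun_prop
      · simp only [hΨ, if_neg h1]; fun_prop
    refine coeff_eq_zero (R := fun z => Ψ (z, R z) i)
      ((continuous_apply i).continuousAt.comp
        (hc.continuousAt.comp (continuousAt_id.prodMk hR))) ?_
    filter_upwards [h] with z hz
    have h1 := congrFun (hz x y) i
    simp only [add_mulVec, smul_mulVec, cr_add_left, cr_add_right, cr_smul_left, cr_smul_right,
      Pi.add_apply, Pi.smul_apply, smul_eq_mul] at h1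
    by_cases hn1 : n = 1
    · subst hn1
      simp only [hΨ, if_true, Pi.add_apply, Pi.sub_apply, Pi.smul_apply, smul_eq_mul, add_mulVec,
        smul_mulVec]
      linear_combination h1
    · obtain ⟨k, rfl⟩ : ∃ k, n = k + 2 := ⟨n - 2, by omega⟩
      simp only [hΨ, if_neg hn1, Pi.add_apply, Pi.sub_apply, Pi.smul_apply, smul_eq_mul, add_mulVec,
        smul_mulVec, Nat.add_sub_cancel]
      linear_combination h1
  exact ⟨funext fun i => (key i).1, sub_eq_zero.1 (funext fun i => (key i).2)⟩

lemma isLeading_of_expansion {g : ℂ → Mat7} {A B : Mat7} {R : ℂ → Mat7} {b : ℂ} {n : ℕ}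
    (hn : 1 ≤ n) (hR : ContinuousAt R b) (hg : ∀ᶠ z in nd b, IsG2 (g z))
    (h : ∀ᶠ z in nd b, (z - b) ^ n • g z = A + (z - b) • B + (z - b) ^ 2 • R z) (hA : A ≠ 0) :
    IsLeading A B (if n = 1 then 1 else 0) := by
  have hd := leading_dot (A := A) (B := B) hn hR (by
    filter_upwards [hg, h] with z h1 h2 x y
    rw [← h2, smul_mulVec, smul_mulVec, smul_dotProduct, dotProduct_smul, h1.dot]
    simp only [smul_eq_mul]; ring)
  have hRt : ContinuousAt (fun z => (R z)ᵀ) b :=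
    (continuous_id.matrix_transpose.continuousAt).comp hR
  -- The transposed loop is the inverse loop and also preserves the form; its leading relation gives
  -- `A Aᵀ = 0`.
  have hd' := leading_dot (A := Aᵀ) (B := Bᵀ) hn hRt (by
    filter_upwards [hg, h] with z h1 h2 x y
    have : Aᵀ + (z - b) • Bᵀ + (z - b) ^ 2 • (R z)ᵀ = (z - b) ^ n • (g z)ᵀ := by
      rw [← transpose_smul (_ ^ n), h2]; simp only [transpose_add, transpose_smul]
    rw [this, smul_mulVec, smul_mulVec, smul_dotProduct, dotProduct_smul, h1.transpose.dot]
    simp only [smul_eq_mul]; ring)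
  have hc := leading_cr (A := A) (B := B) hn hR (by
    filter_upwards [hg, h] with z h1 h2 x y
    rw [← h2]
    simp only [smul_mulVec, cr_smul_left, cr_smul_right, h1.cross])
  refine ⟨hA, fun x y => (hd x y).1, ?_, fun x y => (hd x y).2, fun x y => (hc x y).1,
    fun x y => (hc x y).2⟩
  ext i j
  have := (hd' (Pi.single i 1) (Pi.single j 1)).1
  simp only [mulVec_single_one, dotProduct, col_apply, transpose_apply] at this
  simpa [mul_apply] using this

/-! ### Lowering the order of a pole -/

lemma IsFrame.dot_right {m k : V7} (h : IsFrame m k) (c : ℂ) :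
    star (m + c • star k) ⬝ᵥ (m + c • star k) = 1 + c * star c := by
  simp only [star_add, star_smul, star_star, add_dotProduct, dotProduct_add, smul_dotProduct,
    dotProduct_smul, h.sll, h.slsk, h.kl, h.ksk, smul_eq_mul]
  ring

lemma IsFrame.right_ne_zero {m k : V7} (h : IsFrame m k) (c : ℂ) : m + c • star k ≠ 0 := by
  intro e
  have := h.dot_right c
  rw [e, dotProduct_zero] at this
  exact one_add_mul_star_ne_zero c this.symm

lemma IsFrame.right_isotropic {m k : V7} (h : IsFrame m k) (c : ℂ) :
    (m + c • star k) ⬝ᵥ (m + c • star k) = 0 := by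
  simp [h.ll, h.lsk, h.skl, h.sksk]

/-- Put `a = ⟨m̄, A x⟩`. By `hk`, the pole of the factor of `k` acts on `t B x` and turns the
constant term `a m` into `a (m + c k̄)`, while the part along `k` becomes divisible by `t`. The
factor of `m + c k̄` makes this constant term divisible by `t`, and by `hm` its own pole creates no
new constant term. -/
lemma IsFrame.pv_mul_leading {m k : V7} (h : IsFrame m k) {A B : Mat7} {c δ t : ℂ} (hδ : δ ≠ 0)
    (hA : ∀ x, A *ᵥ x = (star m ⬝ᵥ A *ᵥ x) • m + (star k ⬝ᵥ A *ᵥ x) • k)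
    (hm : ∀ x, m ⬝ᵥ B *ᵥ x = -(c / δ) * (star k ⬝ᵥ A *ᵥ x))
    (hk : ∀ x, k ⬝ᵥ B *ᵥ x = c / δ * (star m ⬝ᵥ A *ᵥ x)) (ht : t ≠ 0) (htd : t + δ ≠ 0) :
    pv (m + c • star k) ((t + δ) / t) * pv k ((t + δ) / t) * (A + t • B) =
      t • (B + (t + δ)⁻¹ • (vecMulVec (m + c • star k) (star m) * A + vecMulVec k (star k) * A -
        (c / (1 + c * star c)) •
          (vecMulVec (star m + star c • k) (star k) * (A - δ • B)) -
        δ • (vecMulVec k (star k) * B) -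
        (δ / (1 + c * star c)) •
          (vecMulVec (m + c • star k) (star m + star c • k) * B))) := by
  have hN := one_add_mul_star_ne_zero c
  refine Matrix.mulVec_injective (funext fun x => ?_)
  have hdr := h.dot_right c
  generalize hc' : star c = c' at *
  rw [← mulVec_mulVec, ← mulVec_mulVec, add_mulVec A, smul_mulVec, hA x]
  simp only [pv_mulVec, hdr, h.skk]
  simp only [star_add, star_smul, star_star, hc']
  simp only [add_mulVec, sub_mulVec, smul_mulVec, ← mulVec_mulVec, vecMulVec_mulVec,
    op_smul_eq_smul, dotProduct_add, dotProduct_sub, add_dotProduct, smul_dotProduct,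
    dotProduct_smul, hm, hk, smul_eq_mul, h.ll, h.kk, h.lk,
    h.sll, h.skk, h.slk, h.skl, h.kl, h.lsk, h.ksk, h.sksk, h.slsk]
  generalize star m ⬝ᵥ A *ᵥ x = a
  generalize star k ⬝ᵥ A *ᵥ x = b
  generalize star m ⬝ᵥ B *ᵥ x = p
  generalize star k ⬝ᵥ B *ᵥ x = q
  generalize B *ᵥ x = y
  match_scalars
  all_goals field_simp
  all_goals ring

/-- The product of the two factors has only a simple pole at `t = 0`: the residues multiply to zero
because `m + c k̄` is orthogonal to `k̄`. This controls the remainder term of the expansion. -/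
lemma IsFrame.smul_pv_mul {m k : V7} (h : IsFrame m k) {c δ t : ℂ} (ht : t ≠ 0)
    (htd : t + δ ≠ 0) :
    t • (pv (m + c • star k) ((t + δ) / t) * pv k ((t + δ) / t)) =
      (t • (1 : Mat7) + (δ / (1 + c * star c)) • vecMulVec (star (m + c • star k)) (m + c • star k) +
        (t * (t + δ)⁻¹ * (-δ / (1 + c * star c))) •
          vecMulVec (m + c • star k) (star (m + c • star k))) *
        (1 + ((t + δ)⁻¹ * -δ) • vecMulVec k (star k)) +
      (δ • vecMulVec (star k) k +
        ((t + δ)⁻¹ * (-δ * δ * star c / (1 + c * star c))) • vecMulVec (m + c • star k) k) := by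
  have hN := one_add_mul_star_ne_zero c
  refine Matrix.mulVec_injective (funext fun x => ?_)
  have hdr := h.dot_right c
  rw [smul_mulVec, ← mulVec_mulVec]
  simp only [pv_mulVec, hdr, h.skk]
  generalize hc' : star c = c' at *
  simp only [star_add, star_smul, star_star, hc']
  simp only [add_mulVec, smul_mulVec, ← mulVec_mulVec, vecMulVec_mulVec, one_mulVec,
    op_smul_eq_smul, dotProduct_add, add_dotProduct, smul_dotProduct,
    dotProduct_smul, smul_eq_mul, h.lk, h.slk, h.lsk, h.ksk, h.skk, h.kk, h.slsk, h.sksk]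
  match_scalars
  all_goals field_simp
  all_goals ring

lemma eventually_nd_conj_ne {α : ℂ} : ∀ᶠ z in nd α, z - α ≠ 0 ∧ z - conj α ≠ 0 := by
  filter_upwards [eventually_nd_ne α α, eventually_nd_ne (conj α) α] with z h1 h2
  exact ⟨sub_ne_zero.2 h1, sub_ne_zero.2 h2⟩

lemma ne_conj_of_im {α : ℂ} (hα : α.im ≠ 0) : α ≠ conj α := fun h =>
  hα (Complex.conj_eq_iff_im.1 h.symm)

lemma sMat_mul_mul_apply (M : Mat7) (i j : Fin 7) : (sMat * M * sMat) i j =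
    (![-1, -1, -1, -1, 1, 1, 1] : Fin 7 → ℂ) i * M i j * (![-1, -1, -1, -1, 1, 1, 1] : Fin 7 → ℂ) j := by
  rw [sMat, mul_diagonal, diagonal_mul]

/-- For imaginary `α` the map `z ↦ -z̄` fixes `α` and takes `t = z - α` to `-t̄`, so the
coefficients acquire the signs `(-1)^n` and `-(-1)^n`. -/
lemma conj_leading {A B : Mat7} {R : ℂ → Mat7} {g : ℂ → Mat7} {α : ℂ} {n : ℕ} (hα : α.re = 0)
    (hR : ContinuousAt R α)
    (h : ∀ᶠ z in nd α, (z - α) ^ n • g z = A + (z - α) • B + (z - α) ^ 2 • R z)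
    (hg : ∀ᶠ z in nd α, (g (-conj z)).map star = sMat * g z * sMat) :
    A.map star = (-1 : ℂ) ^ n • (sMat * A * sMat) ∧
      B.map star = -(-1 : ℂ) ^ n • (sMat * B * sMat) := by
  have hca : -conj α = α := by apply Complex.ext <;> simp [hα]
  have ht : Tendsto (fun z => -conj z) (nd α) (nd α) := by
    have := (tendsto_neg_nd (conj α)).comp (tendsto_conj_nd α)
    rwa [hca] at this
  have hRc : ContinuousAt (fun z => R (-conj z)) α := by
    apply ContinuousAt.comp (g := R) (f := fun z => -conj z)
    · rwa [hca]
    · fun_prop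
  have key : ∀ i j, star (A i j) - (-1 : ℂ) ^ n * (sMat * A * sMat) i j = 0 ∧
      -star (B i j) - (-1 : ℂ) ^ n * (sMat * B * sMat) i j = 0 := by
    intro i j
    have hent : ∀ {S : ℂ → Mat7}, ContinuousAt S α → ContinuousAt (fun z => S z i j) α := fun hS =>
      (continuous_apply_apply i j).continuousAt.comp hS
    have h1 := hent hR
    have h2 := hent hRc
    refine coeff_eq_zero (b := α) (R := fun z => star (R (-conj z) i j) -
      (-1 : ℂ) ^ n * (sMat * R z * sMat) i j) ?_ ?_
    · simp only [sMat_mul_mul_apply]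
      exact h2.star.sub
        (continuousAt_const.mul ((continuousAt_const.mul h1).mul continuousAt_const))
    · filter_upwards [h, ht.eventually h, hg] with z e1 e2 e3
      have e4 := congrFun (congrFun e3 i) j
      have e5 := congrArg star (congrFun (congrFun e2 i) j)
      have e6 := congrFun (congrFun e1 i) j
      simp only [sMat_mul_mul_apply, map_apply, Matrix.smul_apply, Matrix.add_apply, smul_eq_mul, star_add,
        star_mul', star_pow, star_sub, star_neg] at *
      have e7 : star (conj z) = z := star_star z
      have e8 : star α = -α := by
        have := congrArg Neg.neg hca; rw [neg_neg] at this; exact this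
      rw [e7, e8, e4, show -z - -α = (-1) * (z - α) by ring, mul_pow] at e5
      linear_combination -e5 + (-1) ^ n * (![-1, -1, -1, -1, 1, 1, 1] : Fin 7 → ℂ) i *
        (![-1, -1, -1, -1, 1, 1, 1] : Fin 7 → ℂ) j * e6
  constructor
  · ext i j
    exact sub_eq_zero.1 (key i j).1
  · ext i j
    have := (key i j).2
    simp only [map_apply, Matrix.smul_apply, smul_eq_mul]
    linear_combination -this

lemma theta_mulVec_of_map_star {A : Mat7} {e : ℂ} (h : A.map star = e • (sMat * A * sMat)) (x : V7) :
    theta (A *ᵥ x) = e • (A *ᵥ theta x) := by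
  have : star (A *ᵥ x) = A.map star *ᵥ star x := by
    ext i
    simp [mulVec, dotProduct]
  rw [theta, this, h, smul_mulVec, mulVec_smul, theta, ← mulVec_mulVec, ← mulVec_mulVec,
    sMat_sMat_mulVec]

lemma poleLE_pred_of_expansion {g : ℂ → Mat7} {B : Mat7} {R : ℂ → Mat7} {α : ℂ} {n : ℕ} (hn : 1 ≤ n)
    (hRm : MReg (nd α) R α)
    (hexp : ∀ᶠ z in nd α, (z - α) ^ n • g z = (z - α) • B + (z - α) ^ 2 • R z) :
    PoleLE g α (n - 1) := by
  have ht1 : RegAt (nd α) (fun z => z - α) α := by simpa using regAt_sub_pow (nd α) α α 1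
  refine ((MReg.const B).add (MReg.smul ht1 hRm)).congr ?_
  filter_upwards [hexp, eventually_nd_ne α α] with z hz hzα
  apply smul_right_injective _ (sub_ne_zero.2 hzα)
  simp only
  rw [smul_smul, ← pow_succ', Nat.sub_add_cancel hn, hz, smul_add, smul_smul, sq]

/-- The order of a pole of a loop in `𝔾₂` is lowered by a suitable simple element. -/
theorem exists_pair_lowering {g : ℂ → Mat7} {α : ℂ} (hα : α.im ≠ 0) {n : ℕ} (hn : 1 ≤ n)
    (hG : ∀ᶠ z in nd α, IsG2 (g z)) (hP : PoleLE g α n) (hP' : ¬PoleLE g α (n - 1)) {r : Prop}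
    (hr : r → α.re = 0 ∧ ∀ᶠ z in nd α, (g (-conj z)).map star = sMat * g z * sMat) :
    ∃ L K, IsPair L K ∧ PoleLE (fun z => pPair α L K z * g z) α (n - 1) ∧
      (r → matSub sMat L = conjSub L ∧ matSub sMat K = conjSub K) := by
  obtain ⟨A, B, R, hRa, hexp⟩ := MReg.expansion hP
  have hRm : MReg (nd α) R α := fun i j => regAt_of_analyticAt (hRa i j)
  have hR : ContinuousAt R α :=
    continuousAt_pi.2 fun i => continuousAt_pi.2 fun j => (hRa i j).continuousAt
  have hne := ne_conj_of_im hα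
  have ht1 : RegAt (nd α) (fun z => z - α) α := by simpa using regAt_sub_pow (nd α) α α 1
  have hA : A ≠ 0 := by
    rintro rfl
    exact hP' (poleLE_pred_of_expansion hn hRm (by simpa using hexp))
  have hL := isLeading_of_expansion hn hR hG hexp hA
  obtain ⟨m, k, κ, hF, hAx, hmB, hkB, hreal⟩ := hL.exists_frame (r := r) (e := (-1) ^ n)
    (by rw [← mul_pow]; simp)
    (fun h => theta_mulVec_of_map_star (conj_leading (hr h).1 hR hexp (hr h).2).1)
    (fun h => theta_mulVec_of_map_star (conj_leading (hr h).1 hR hexp (hr h).2).2)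
  have hδ : α - conj α ≠ 0 := sub_ne_zero.2 hne
  -- `IsFrame.pv_mul_leading` with `δ = α - ᾱ` requires this value of `c`.
  obtain ⟨c, hc⟩ : ∃ c, κ = c / (α - conj α) := ⟨κ * (α - conj α), by field_simp⟩
  rw [hc] at hmB hkB hreal
  refine ⟨ln (m + c • star k), ln k, hF.isPair_right c, ?_, fun h => ?_⟩
  · have hw := regAt_inv_sub (nd α) hne
    have hk0 := ne_zero_of_norm hF.skk
    have reg1 := ((MReg.const B).add (MReg.smul hw (MReg.const (l := nd α) (b := α)
      (vecMulVec (m + c • star k) (star m) * A + vecMulVec k (star k) * A -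
        (c / (1 + c * star c)) • (vecMulVec (star m + star c • k) (star k) * (A - (α - conj α) • B)) -
        (α - conj α) • (vecMulVec k (star k) * B) - ((α - conj α) / (1 + c * star c)) •
          (vecMulVec (m + c • star k) (star m + star c • k) * B)))))
    have reg2 := ((((MReg.smul ht1 (MReg.const (1 : Mat7))).add (MReg.const
      (((α - conj α) / (1 + c * star c)) • vecMulVec (star (m + c • star k)) (m + c • star k)))).add
      (MReg.smul ((ht1.mul hw).mul (RegAt.const (-(α - conj α) / (1 + c * star c))))
        (MReg.const (vecMulVec (m + c • star k) (star (m + c • star k)))))).mul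
      ((MReg.const 1).add (MReg.smul (hw.mul (RegAt.const (-(α - conj α))))
        (MReg.const (vecMulVec k (star k)))))).add ((MReg.const ((α - conj α) •
        vecMulVec (star k) k)).add (MReg.smul (hw.mul (RegAt.const
        (-(α - conj α) * (α - conj α) * star c / (1 + c * star c))))
        (MReg.const (vecMulVec (m + c • star k) k))))
    -- With `t = z - α` and `p` the simple element, `t ^ (n-1) p g = t⁻¹ p (A + t B) + (t p) R`, and
    -- both summands are regular.
    refine (reg1.add (reg2.mul hRm)).congr ?_
    filter_upwards [hexp, eventually_nd_conj_ne] with z hz hz0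
    have e : z - α + (α - conj α) = z - conj α := by ring
    have l1 := hF.pv_mul_leading (t := z - α) hδ hAx hmB hkB hz0.1 (by rw [e]; exact hz0.2)
    have l2 := hF.smul_pv_mul (c := c) (δ := α - conj α) hz0.1 (by rw [e]; exact hz0.2)
    rw [e] at l1 l2
    rw [← l2, pPair_ln (hF.right_ne_zero c) (hF.right_isotropic c) hk0 hF.kk]
    apply smul_right_injective _ hz0.1
    simp only
    rw [smul_add, ← l1, smul_mul_assoc, smul_smul, smul_smul, ← pow_succ', Nat.sub_add_cancel hn,
      ← mul_smul_comm, hz, mul_add, mul_smul_comm, sq]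
  · obtain ⟨h1, h2, h3⟩ := hreal h
    have hca : star α = -α := by
      apply Complex.ext <;> simp [(hr h).1]
    -- Both `κ` and `α - ᾱ` are imaginary, so `c` is real and `s` maps each of the two lines to its
    -- conjugate.
    have hcs : star c = c := by
      have hca' : conj α = -α := hca
      have h2α : α - -α ≠ 0 := by rwa [hca'] at hδ
      rw [hca', star_div₀, star_sub, star_neg, hca, neg_neg] at h3
      have h5 : -α - α ≠ 0 := by intro h; apply h2α; linear_combination -h
      rw [div_eq_iff h5, show -α - α = -(α - -α) by ring, neg_mul_neg, div_mul_cancel₀ _ h2α] at h3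
      exact h3
    have hs : ∀ {x : V7}, theta x = x → sMat *ᵥ x = star x := fun {x} hx => by
      conv_lhs => rw [← hx]
      rw [theta, sMat_sMat_mulVec]
    constructor
    · rw [matSub_ln, conjSub_ln, mulVec_add, mulVec_smul, hs h1, star_add, star_smul, star_star, hcs]
      congr 3
    · rw [matSub_ln, conjSub_ln, hs h2]

/-! ### Rational orthogonal loops with given poles -/

/-- `F` is a real orthogonal loop, regular outside of `P`, with value `1` at `∞`. -/
structure IsOrthLoop (F : ℂ → Mat7) (P : Set ℂ) : Prop where
  reg : ∀ (l : Filter ℂ) (b : ℂ), b ∉ P → MReg l F b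
  real : ∀ z, (F (conj z)).map star = F z
  lim : ∀ i j, Tendsto (fun z => F z i j) (cocompact ℂ) (𝓝 ((1 : Mat7) i j))
  orth : ∀ z, z ∉ P → (F z)ᵀ * F z = 1

lemma map_star_mul (A B : Mat7) : (A * B).map star = A.map star * B.map star := by
  ext i j
  simp [mul_apply]

lemma map_star_sMat : sMat.map star = sMat := by
  ext i j
  simp only [sMat, map_apply, diagonal_apply]
  split_ifs
  · fin_cases i <;> simp
  · simp

lemma sMat_transpose : sMatᵀ = sMat := by rw [sMat, diagonal_transpose]

namespace IsOrthLoop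

variable {F G : ℂ → Mat7} {P Q : Set ℂ}

lemma mul (hF : IsOrthLoop F P) (hG : IsOrthLoop G Q) :
    IsOrthLoop (fun z => F z * G z) (P ∪ Q) where
  reg l b hb := (hF.reg l b fun h => hb (Or.inl h)).mul (hG.reg l b fun h => hb (Or.inr h))
  real z := by rw [map_star_mul, hF.real, hG.real]
  lim i j := by
    simp only [mul_apply]
    have := tendsto_finsetSum Finset.univ fun k _ => (hF.lim i k).mul (hG.lim k j)
    rwa [← mul_apply, one_mul] at this
  orth z hz := by
    rw [transpose_mul, Matrix.mul_assoc, ← Matrix.mul_assoc _ (F z), hF.orth z fun h => hz (Or.inl h),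
      Matrix.one_mul, hG.orth z fun h => hz (Or.inr h)]

lemma mono (hF : IsOrthLoop F P) (h : P ⊆ Q) : IsOrthLoop F Q :=
  ⟨fun l b hb => hF.reg l b fun h' => hb (h h'), hF.real, hF.lim,
    fun z hz => hF.orth z fun h' => hz (h h')⟩

lemma transpose (hF : IsOrthLoop F P) : IsOrthLoop (fun z => (F z)ᵀ) P where
  reg l b hb := (hF.reg l b hb).transpose
  real z := by rw [transpose_map, hF.real]
  lim i j := by
    have := hF.lim j i
    rwa [← transpose_apply (1 : Mat7), transpose_one] at this
  orth z hz := by rw [transpose_transpose, mul_eq_one_comm.1 (hF.orth z hz)]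

lemma one : IsOrthLoop (fun _ => 1) P where
  reg _ _ _ := MReg.const 1
  real z := by ext i j; simp [one_apply, apply_ite]
  lim i j := tendsto_const_nhds
  orth z _ := by simp

/-- The transformed loop `s F(-λ) s`. -/
lemma twist (hF : IsOrthLoop F P) : IsOrthLoop (fun z => sMat * F (-z) * sMat) {z | -z ∈ P} where
  reg l b hb := by
    refine ((MReg.const sMat).mul ?_).mul (MReg.const sMat)
    intro i j
    obtain ⟨h, hh, e⟩ := hF.reg (Filter.map (fun z => -z) l) (-b) hb i j
    exact ⟨fun z => h (-z), hh.comp analyticAt_id.neg, e⟩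
  real z := by
    rw [map_star_mul, map_star_mul, map_star_sMat, ← hF.real (-z), map_neg]
  lim i j := by
    simp only [sMat_mul_mul_apply]
    have h1 : Tendsto (fun z : ℂ => -z) (cocompact ℂ) (cocompact ℂ) :=
      (Homeomorph.neg ℂ).isClosedEmbedding.tendsto_cocompact
    have := ((tendsto_const_nhds (x := (![-1, -1, -1, -1, 1, 1, 1] : Fin 7 → ℂ) i)).mul
      ((hF.lim i j).comp h1)).mul
      (tendsto_const_nhds (x := (![-1, -1, -1, -1, 1, 1, 1] : Fin 7 → ℂ) j))
    rwa [← sMat_mul_mul_apply, Matrix.mul_one, sMat_mul_self] at this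
  orth z hz := by
    simp only [transpose_mul, sMat_transpose, Matrix.mul_assoc]
    rw [← Matrix.mul_assoc sMat sMat, sMat_mul_self, Matrix.one_mul, ← Matrix.mul_assoc (F (-z))ᵀ,
      hF.orth _ hz, Matrix.one_mul, sMat_mul_self]

lemma eq_one (hF : IsOrthLoop F P) (h : ∀ b ∈ P, MReg (nd b) F b) : ∀ᶠ z in openDense, F z = 1 :=
  eventually_eq_one_of_mReg (fun b => by
    by_cases hb : b ∈ P
    · exact h b hb
    · exact hF.reg _ b hb) fun i j => (hF.lim i j).mono_left inf_le_left

lemma mReg_conj (hF : IsOrthLoop F P) {b : ℂ} (h : MReg (nd b) F b) :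
    MReg (nd (conj b)) F (conj b) :=
  poleLE_zero.1 (PoleLE.real (Eventually.of_forall hF.real) (poleLE_zero.2 h))

end IsOrthLoop

lemma compl_finite_mem_openDense {P : Set ℂ} (hP : P.Finite) : Pᶜ ∈ openDense :=
  ⟨Pᶜ, subset_rfl, hP.isClosed.isOpen_compl, hP.countable.dense_compl ℂ⟩

/-- The simple element of the line of `w`, as a function. -/
def pf (w : V7) (α z : ℂ) : Mat7 := pv w ((z - conj α) / (z - α))

lemma tendsto_div_cocompact (a b : ℂ) :
    Tendsto (fun z : ℂ => (z - a) / (z - b)) (cocompact ℂ) (𝓝 1) := by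
  have h1 : Tendsto (fun z : ℂ => (z - b)⁻¹) (cocompact ℂ) (𝓝 0) := by
    have : Tendsto (fun z : ℂ => z - b) (cocompact ℂ) (cocompact ℂ) :=
      (Homeomorph.subRight b).isClosedEmbedding.tendsto_cocompact
    exact (tendsto_inv₀_cobounded.mono_left (by rw [Metric.cobounded_eq_cocompact])).comp this
  have h2 : Tendsto (fun z : ℂ => 1 + (b - a) * (z - b)⁻¹) (cocompact ℂ) (𝓝 (1 + (b - a) * 0)) :=
    tendsto_const_nhds.add (tendsto_const_nhds.mul h1)
  rw [mul_zero, add_zero] at h2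
  refine h2.congr' ?_
  have : ({b}ᶜ : Set ℂ) ∈ cocompact ℂ := isCompact_singleton.compl_mem_cocompact
  filter_upwards [this] with z hz
  have : z - b ≠ 0 := sub_ne_zero.2 hz
  field_simp
  ring

lemma mReg_pv {l : Filter ℂ} {b : ℂ} {u : ℂ → ℂ} (w : V7) (h1 : RegAt l u b)
    (h2 : RegAt l (fun z => (u z)⁻¹) b) : MReg l (fun z => pv w (u z)) b := by
  have e1 := MReg.smul ((h1.add (RegAt.const (-1))).mul (RegAt.const (star w ⬝ᵥ w)⁻¹))
    (MReg.const (vecMulVec (star w) w))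
  have e2 := MReg.smul ((h2.add (RegAt.const (-1))).mul (RegAt.const (star w ⬝ᵥ w)⁻¹))
    (MReg.const (vecMulVec w (star w)))
  refine (((MReg.const 1).add e1).add e2).congr (Eventually.of_forall fun z => ?_)
  simp only [pv, sub_eq_add_neg, div_eq_mul_inv]

lemma regAt_div (l : Filter ℂ) {a a' b : ℂ} (h : b ≠ a') :
    RegAt l (fun z => (z - a) / (z - a')) b := by
  simp only [div_eq_mul_inv]
  have h1 : RegAt l (fun z => z - a) b := by simpa using regAt_sub_pow l a b 1
  exact h1.mul (regAt_inv_sub l h)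

lemma isOrthLoop_pf {w : V7} (hw : w ≠ 0) (hi : w ⬝ᵥ w = 0) (α : ℂ) :
    IsOrthLoop (pf w α) {α, conj α} where
  reg l b hb := by
    rw [Set.mem_insert_iff, Set.mem_singleton_iff, not_or] at hb
    refine mReg_pv w (regAt_div l hb.1) ?_
    simp only [inv_div]
    exact regAt_div l hb.2
  real z := by
    rw [pf, pv_map_star, pf]
    congr 1
    simp [RCLike.star_def]
  lim i j := by
    have h1 := tendsto_div_cocompact (conj α) α
    have h2 := h1.inv₀ one_ne_zero
    have : Tendsto (fun z : ℂ => (1 : Mat7) i j + ((z - conj α) / (z - α) - 1) / (star w ⬝ᵥ w) *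
        vecMulVec (star w) w i j + (((z - conj α) / (z - α))⁻¹ - 1) / (star w ⬝ᵥ w) *
        vecMulVec w (star w) i j) (cocompact ℂ) (𝓝 ((1 : Mat7) i j + (1 - 1) / (star w ⬝ᵥ w) *
        vecMulVec (star w) w i j + (1⁻¹ - 1) / (star w ⬝ᵥ w) * vecMulVec w (star w) i j)) :=
      ((tendsto_const_nhds).add (((h1.sub tendsto_const_nhds).div_const _).mul
        tendsto_const_nhds)).add (((h2.sub tendsto_const_nhds).div_const _).mul tendsto_const_nhds)
    simpa [pf, pv] using this
  orth z hz := by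
    rw [Set.mem_insert_iff, Set.mem_singleton_iff, not_or] at hz
    have h0 : (z - conj α) / (z - α) ≠ 0 := div_ne_zero (sub_ne_zero.2 hz.2) (sub_ne_zero.2 hz.1)
    rw [pf, pv_transpose, pv_mul_pv hw hi (inv_ne_zero h0) h0, inv_mul_cancel₀ h0, pv_one]

lemma pf_twist (w : V7) (α z : ℂ) : sMat * pf w α (-z) * sMat = pf (sMat *ᵥ w) (-α) z := by
  have h := pv_conj (A := sMat) (by rw [sMat_transpose, sMat_mul_self]) map_star_sMat w
    ((-z - conj α) / (-z - α))
  rw [sMat_transpose] at h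
  rw [pf, h, pf, map_neg]
  congr 1
  rw [← neg_div_neg_eq]
  congr 1 <;> ring

/-- `pf v α * pf w α`. -/
def pf₂ (v w : V7) (α z : ℂ) : Mat7 := pf v α z * pf w α z

lemma isOrthLoop_pf₂ {v w : V7} (hv : v ≠ 0) (hvi : v ⬝ᵥ v = 0) (hw : w ≠ 0) (hwi : w ⬝ᵥ w = 0)
    (α : ℂ) : IsOrthLoop (pf₂ v w α) {α, conj α} :=
  ((isOrthLoop_pf hv hvi α).mul (isOrthLoop_pf hw hwi α)).mono (by simp)

lemma pf₂_twist (v w : V7) (α z : ℂ) :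
    sMat * pf₂ v w α (-z) * sMat = pf₂ (sMat *ᵥ v) (sMat *ᵥ w) (-α) z := by
  rw [pf₂, pf₂, ← pf_twist, ← pf_twist]
  simp only [Matrix.mul_assoc]
  rw [← Matrix.mul_assoc sMat sMat, sMat_mul_self, Matrix.one_mul]

lemma pPair_eq_pf₂ {v w : V7} (hv : v ≠ 0) (hvi : v ⬝ᵥ v = 0) (hw : w ≠ 0) (hwi : w ⬝ᵥ w = 0)
    (α : ℂ) : pPair α (ln v) (ln w) = pf₂ v w α :=
  funext fun z => pPair_ln hv hvi hw hwi α z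

lemma IsFrame.isG2_pf₂ {l k : V7} (h : IsFrame l k) (c : ℂ) {α z : ℂ} (h1 : z ≠ α)
    (h2 : z ≠ conj α) : IsG2 (pf₂ l (k + c • star l) α z) :=
  h.isG2_pv c (div_ne_zero (sub_ne_zero.2 h2) (sub_ne_zero.2 h1))

lemma IsFrame.isOrthLoop {l k : V7} (h : IsFrame l k) (c : ℂ) (α : ℂ) :
    IsOrthLoop (pf₂ l (k + c • star l) α) {α, conj α} :=
  isOrthLoop_pf₂ (ne_zero_of_norm h.sll) h.ll (h.add_ne_zero c) (h.add_isotropic c) α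

lemma IsFrame.smat {l k : V7} (h : IsFrame l k) : IsFrame (sMat *ᵥ l) (sMat *ᵥ k) := by
  have g := isG2_sMat
  refine ⟨?_, ?_, ?_, ?_, ?_, ?_, ?_⟩
  · rw [g.dot, h.ll]
  · rw [g.dot, h.kk]
  · rw [g.dot, h.lk]
  · rw [star_sMat_mulVec, g.dot, h.sll]
  · rw [star_sMat_mulVec, g.dot, h.skk]
  · rw [star_sMat_mulVec, g.dot, h.slk]
  · rw [g.cross, h.cr, mulVec_zero]

lemma IsFrame.poleLE_pf₂ {l k : V7} (h : IsFrame l k) (c : ℂ) {α : ℂ} (hα : α.im ≠ 0) :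
    PoleLE (pf₂ l (k + c • star l) α) α 1 := by
  have hne := ne_conj_of_im hα
  have ht1 : RegAt (nd α) (fun z => z - α) α := by simpa using regAt_sub_pow (nd α) α α 1
  have ht2 : RegAt (nd α) (fun z => z - conj α) α := by
    simpa using regAt_sub_pow (nd α) (conj α) α 1
  have hw := regAt_inv_sub (nd α) hne
  have hv : RegAt (nd α) (fun z => (z - α) * (z - α) * (z - conj α)⁻¹) α := (ht1.mul ht1).mul hw
  set N := 1 + c * star c with hN
  have hN0 : N ≠ 0 := one_add_mul_star_ne_zero c
  have lin : ∀ {f g : ℂ → ℂ} (p q : ℂ), RegAt (nd α) f α → RegAt (nd α) g α →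
      RegAt (nd α) (fun z => f z * p + g z * q) α := fun p q hf hg =>
    (hf.mul (RegAt.const p)).add (hg.mul (RegAt.const q))
  have r0 := MReg.smul ht1 (MReg.const (1 : Mat7))
  have r1 := MReg.smul (lin N⁻¹ (c * star c / N - 1) hv ht1)
    (MReg.const (vecMulVec l (star l) + vecMulVec k (star k)))
  have r2 := MReg.smul (lin N⁻¹ (c * star c / N - 1) ht2 ht1)
    (MReg.const (vecMulVec (star l) l + vecMulVec (star k) k))
  have r3 := MReg.smul (lin (star c / N) (-(star c / N)) ht1 hv)
    (MReg.const (vecMulVec l k - vecMulVec k l))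
  have r4 := MReg.smul (lin (c / N) (-(c / N)) ht2 ht1)
    (MReg.const (vecMulVec (star k) (star l) - vecMulVec (star l) (star k)))
  refine ((((r0.add r1).add r2).add r3).add r4).congr ?_
  filter_upwards [eventually_nd_conj_ne] with z hz
  have hz1 := hz.1
  have hz2 := hz.2
  rw [pf₂, pf, pf, h.pv_mul c (div_ne_zero hz2 hz1), slElem, inv_div, ← hN]
  match_scalars <;> field_simp <;> ring

/-! ### Dressing -/

lemma mReg_exists_tendsto {l : Filter ℂ} {F : ℂ → Mat7} {b : ℂ} (hl : l ≤ 𝓝 b) (h : MReg l F b) :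
    ∃ V, Tendsto F l (𝓝 V) := by
  choose u hu e using h
  refine ⟨of fun i j => u i j b, ?_⟩
  refine tendsto_pi_nhds.2 fun i => tendsto_pi_nhds.2 fun j => ?_
  exact ((hu i j).continuousAt.tendsto.mono_left hl).congr' (e i j).symm

lemma orth_of_tendsto {l : Filter ℂ} [l.NeBot] {F : ℂ → Mat7} {V : Mat7} (h : Tendsto F l (𝓝 V))
    (ho : ∀ᶠ z in l, (F z)ᵀ * F z = 1) : Vᵀ * V = 1 := by
  have hc : Continuous fun M : Mat7 => Mᵀ * M := by fun_prop
  exact tendsto_nhds_unique_of_eventuallyEq ((hc.tendsto V).comp h) tendsto_const_nhds ho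

/-- If `h` is regular and orthogonal at `β`, then so is `p_{β,hK} h p_{β,K}⁻¹`. -/
theorem mReg_dress {β : ℂ} (hβ : β.im ≠ 0) {h : ℂ → Mat7} {V : Mat7} (hreg : MReg (𝓝[≠] β) h β)
    (hV : Tendsto h (𝓝[≠] β) (𝓝 V)) (ho : ∀ᶠ z in 𝓝[≠] β, (h z)ᵀ * h z = 1) {k : V7} (hk : k ≠ 0)
    (hki : k ⬝ᵥ k = 0) :
    MReg (𝓝[≠] β) (fun z => pf (V *ᵥ k) β z * h z * (pf k β z)ᵀ) β := by
  obtain ⟨A, B, R, hRa, hexp⟩ := hreg.expansion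
  have hR : ContinuousAt R β :=
    continuousAt_pi.2 fun i => continuousAt_pi.2 fun j => (hRa i j).continuousAt
  have hRm : MReg (𝓝[≠] β) R β := fun i j => regAt_of_analyticAt (hRa i j)
  have hne := ne_conj_of_im hβ
  have hAV : A = V := by
    have hc : ContinuousAt (fun z => A + (z - β) • B + (z - β) ^ 2 • R z) β := by fun_prop
    have h1 : Tendsto (fun z => A + (z - β) • B + (z - β) ^ 2 • R z) (𝓝[≠] β)
        (𝓝 (A + (β - β) • B + (β - β) ^ 2 • R β)) := hc.tendsto.mono_left nhdsWithin_le_nhds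
    have := tendsto_nhds_unique_of_eventuallyEq hV h1 hexp
    simpa using this.symm
  subst hAV
  have hVV := orth_of_tendsto hV ho
  have hd := (orthogonal_iff A).2 hVV
  -- This is the derivative at `β` of the constant function `⟨h k, h k⟩ = 0`.
  have hB : A *ᵥ k ⬝ᵥ B *ᵥ k = 0 := by
    set Φ : ℂ × Mat7 → ℂ := fun p => A *ᵥ k ⬝ᵥ p.2 *ᵥ k + B *ᵥ k ⬝ᵥ B *ᵥ k + p.2 *ᵥ k ⬝ᵥ A *ᵥ k +
      (p.1 - β) * (B *ᵥ k ⬝ᵥ p.2 *ᵥ k + p.2 *ᵥ k ⬝ᵥ B *ᵥ k) +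
      (p.1 - β) ^ 2 * (p.2 *ᵥ k ⬝ᵥ p.2 *ᵥ k) with hΦ
    have hc : Continuous Φ := by fun_prop
    have := (coeff_eq_zero (b := β) (a := 0) (c := 2 * (A *ᵥ k ⬝ᵥ B *ᵥ k))
      (R := fun z => Φ (z, R z)) (hc.continuousAt.comp (continuousAt_id.prodMk hR)) (by
        filter_upwards [nd_le_nhdsNE β ho, nd_le_nhdsNE β hexp] with z h1 h2
        have h3 := (orthogonal_iff _).2 h1 k k
        rw [h2, hki] at h3
        simp only [add_mulVec, smul_mulVec, add_dotProduct, dotProduct_add, smul_dotProduct,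
          dotProduct_smul, smul_eq_mul, hd, hki, dotProduct_comm (B *ᵥ k) (A *ᵥ k)] at h3
        simp only [hΦ]
        linear_combination h3)).2
    simpa using this
  set k₂ := A *ᵥ k with hk₂
  have hk₂i : k₂ ⬝ᵥ k₂ = 0 := by rw [hd, hki]
  have hk₂0 : k₂ ≠ 0 := by
    intro e
    apply hk
    rw [← one_mulVec k, ← hVV, ← mulVec_mulVec, ← hk₂, e, mulVec_zero]
  have hN₁ := norm_ne_zero hk
  have hN₂ := norm_ne_zero hk₂0
  have hw := regAt_inv_sub (𝓝[≠] β) hne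
  have ht1 : RegAt (𝓝[≠] β) (fun z => z - β) β := by simpa using regAt_sub_pow (𝓝[≠] β) β β 1
  set δ := β - conj β with hδ
  set N₁ := star k ⬝ᵥ k with hN₁d
  set N₂ := star k₂ ⬝ᵥ k₂ with hN₂d
  set E₂ := vecMulVec (star k₂) k₂ with hE₂
  set F₁ := vecMulVec k (star k) with hF₁
  have rX₁ := (MReg.const (l := 𝓝[≠] β) (b := β) 1).add
    (MReg.smul (hw.mul (RegAt.const (-δ / N₁))) (MReg.const (vecMulVec (star k) k)))
  have rX₂ := (MReg.const (l := 𝓝[≠] β) (b := β) 1).add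
    (MReg.smul (hw.mul (RegAt.const (-δ / N₂))) (MReg.const (vecMulVec k₂ (star k₂))))
  have rB := (MReg.const (l := 𝓝[≠] β) (b := β) B).add (MReg.smul ht1 hRm)
  have rh := ((MReg.const (l := 𝓝[≠] β) (b := β) A).add (MReg.smul ht1 rB))
  have r1 := (rX₂.mul rh).mul rX₁
  have r2 := MReg.smul (RegAt.const (δ / N₂)) ((MReg.smul hw
    (MReg.const (vecMulVec (star k₂) k))).add (((MReg.const E₂).mul rB).mul rX₁))
  have r3 := MReg.smul (RegAt.const (δ / N₁)) ((MReg.smul hw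
    (MReg.const (vecMulVec k₂ (star k)))).add ((rX₂.mul rB).mul (MReg.const F₁)))
  have r4 := MReg.smul (RegAt.const (δ ^ 2 / (N₁ * N₂)))
    (((MReg.const E₂).mul hRm).mul (MReg.const F₁))
  refine (((r1.add r2).add r3).add r4).congr ?_
  have hz0 : ∀ᶠ z in 𝓝[≠] β, z - β ≠ 0 ∧ z - conj β ≠ 0 := by
    filter_upwards [self_mem_nhdsWithin,
      mem_nhdsWithin_of_mem_nhds (isOpen_compl_singleton.mem_nhds hne)] with z h1 h2
    exact ⟨sub_ne_zero.2 h1, sub_ne_zero.2 h2⟩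
  filter_upwards [hexp, hz0] with z hz hz0
  obtain ⟨h1, h2⟩ := hz0
  have hdz : δ = (z - conj β) - (z - β) := by rw [hδ]; ring
  have p1 : (pf k β z)ᵀ = pv k ((z - conj β) / (z - β))⁻¹ := by rw [pf, pv_transpose]
  have p2 : pf k₂ β z = pv k₂ ((z - conj β) / (z - β)) := rfl
  generalize z - conj β = v at *
  generalize z - β = t at *
  set X₁ := 1 + (v⁻¹ * (-δ / N₁)) • vecMulVec (star k) k with hX₁
  set X₂ := 1 + (v⁻¹ * (-δ / N₂)) • vecMulVec k₂ (star k₂) with hX₂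
  replace p1 : (pf k β z)ᵀ = X₁ + (δ / t / N₁) • F₁ := by
    rw [p1, pv, ← hN₁d, hX₁, hF₁, hdz]
    match_scalars <;> field_simp
    ring
  replace p2 : pf k₂ β z = X₂ + (δ / t / N₂) • E₂ := by
    rw [p2, pv, ← hN₂d, hX₂, hE₂, hdz]
    match_scalars <;> field_simp
    ring
  have hk₂A : k₂ ᵥ* A = k := by
    rw [hk₂, ← mulVec_transpose, mulVec_mulVec, hVV, one_mulVec]
  -- `X₁, X₂` are the regular parts of the outer factors and `F₁, E₂` their polar parts. By `q1` and
  -- `q2` the simple poles cancel, since the regular parts vanish to first order on the vectors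
  -- concerned; by `q3` and `q4` only the remainder meets the double pole.
  have q1 : E₂ * A * X₁ = (t * v⁻¹) • vecMulVec (star k₂) k := by
    rw [hE₂, vecMulVec_mul, hk₂A, hX₁, mul_add, mul_smul_comm, vecMulVec_mul_vecMulVec, Matrix.mul_one,
      dotProduct_comm k (star k), hdz, vecMulVec_smul]
    match_scalars
    field_simp
    ring
  have q2 : X₂ * A * F₁ = (t * v⁻¹) • vecMulVec k₂ (star k) := by
    rw [Matrix.mul_assoc, hF₁, mul_vecMulVec, ← hk₂, hX₂, add_mul, smul_mul_assoc,
      vecMulVec_mul_vecMulVec, Matrix.one_mul, hdz, vecMulVec_smul]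
    match_scalars
    field_simp
    ring
  have q3 : E₂ * A * F₁ = 0 := by
    rw [Matrix.mul_assoc, hF₁, mul_vecMulVec, ← hk₂, hE₂, vecMulVec_mul_vecMulVec, hk₂i, zero_smul, vecMulVec_zero]
  have q4 : E₂ * B * F₁ = 0 := by
    rw [Matrix.mul_assoc, hF₁, mul_vecMulVec, hE₂, vecMulVec_mul_vecMulVec, hB, zero_smul, vecMulVec_zero]
  rw [hz, p1, p2]
  simp only [add_mul, mul_add, smul_mul_assoc, mul_smul_comm, q1, q2, q3, q4, smul_add, smul_smul]
  match_scalars <;> field_simp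

/-! ### The elements `q_{α,L,K}` -/

lemma eventually_notMem_nhdsNE {P : Set ℂ} (hP : P.Finite) (b : ℂ) : ∀ᶠ z in 𝓝[≠] b, z ∉ P := by
  have : ∀ᶠ z in 𝓝[≠] b, ∀ a ∈ P, z ≠ a := (Filter.eventually_all_finite hP).2 fun a _ => by
    by_cases h : b = a
    · subst h; exact self_mem_nhdsWithin
    · exact mem_nhdsWithin_of_mem_nhds (isOpen_compl_singleton.mem_nhds h)
  exact this.mono fun z hz h => hz z h rfl

lemma IsOrthLoop.eventually_orth {F : ℂ → Mat7} {P : Set ℂ} (hF : IsOrthLoop F P) (hP : P.Finite)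
    (b : ℂ) : ∀ᶠ z in 𝓝[≠] b, (F z)ᵀ * F z = 1 :=
  (eventually_notMem_nhdsNE hP b).mono fun z hz => hF.orth z hz

/-- The field `reg` allows the filter `𝓝 b`, which sees the value at `b` itself. -/
lemma IsOrthLoop.tendsto {F : ℂ → Mat7} {P : Set ℂ} (hF : IsOrthLoop F P) {b : ℂ} (hb : b ∉ P) :
    Tendsto F (𝓝[≠] b) (𝓝 (F b)) := by
  obtain ⟨V, hV⟩ := mReg_exists_tendsto le_rfl (hF.reg (𝓝 b) b hb)
  rw [tendsto_nhds_unique (tendsto_pure_nhds F b) (hV.mono_left (pure_le_nhds b))]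
  exact hV.mono_left nhdsWithin_le_nhds

lemma mulVec_ne_zero_of_orth {A : Mat7} (hA : Aᵀ * A = 1) {x : V7} (hx : x ≠ 0) : A *ᵥ x ≠ 0 := by
  intro e
  apply hx
  rw [← one_mulVec x, ← hA, ← mulVec_mulVec, e, mulVec_zero]

lemma dress_eventuallyEq {β : ℂ} {p : ℂ → Mat7} {P : Set ℂ} (hp : IsOrthLoop p P)
    (hβ : β ∉ P) {k : V7} (hk : k ≠ 0) (hki : k ⬝ᵥ k = 0) :
    ∀ᶠ z in 𝓝[≠] β, dress β (ln (p β *ᵥ k)) p z = pf (p β *ᵥ k) β z * p z * (pf k β z)ᵀ := by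
  have ho := hp.orth β hβ
  have h1 : matSub (p β)⁻¹ (ln (p β *ᵥ k)) = ln k := by
    rw [matSub_ln, mulVec_mulVec, inv_eq_left_inv ho, ho, one_mulVec]
  filter_upwards [(isOrthLoop_pf hk hki β).eventually_orth (by simp) β] with z hz
  rw [dress, h1, pLine_ln (mulVec_ne_zero_of_orth ho hk) (by rw [(orthogonal_iff _).2 ho, hki]),
    pLine_ln hk hki]
  exact congrArg _ (inv_eq_left_inv hz)

lemma neg_notMem_of_re {α : ℂ} (hre : α.re ≠ 0) (him : α.im ≠ 0) : -α ∉ ({α, conj α} : Set ℂ) := by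
  rw [Set.mem_insert_iff, Set.mem_singleton_iff, not_or]
  constructor <;> intro e
  · exact him (by have := congrArg Complex.im e; simp at this; linarith)
  · exact hre (by have := congrArg Complex.re e; simp at this; linarith)

/-- Dressing first with `sK` and then with `sL` makes `q p_{-α,sL,sK}⁻¹` regular at `-α`, which is
not a pole of `p_{α,L,K}`. -/
lemma IsFrame.exists_qPair_eq {l k : V7} (h : IsFrame l k) (c : ℂ) {α : ℂ} (hre : α.re ≠ 0)
    (him : α.im ≠ 0) : ∃ v w : V7, v ≠ 0 ∧ v ⬝ᵥ v = 0 ∧ w ≠ 0 ∧ w ⬝ᵥ w = 0 ∧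
      qPair α (ln l) (ln (k + c • star l)) =
        (fun z => pf₂ v w (-α) z * pf₂ l (k + c • star l) α z) ∧
      MReg (nd (-α)) (fun z => pf₂ v w (-α) z * pf₂ l (k + c • star l) α z *
        (pf₂ (sMat *ᵥ l) (sMat *ᵥ (k + c • star l)) (-α) z)ᵀ) (-α) := by
  have hl := ne_zero_of_norm h.sll
  have hli := h.ll
  have hk := h.add_ne_zero c
  have hki := h.add_isotropic c
  have hp := h.isOrthLoop c α
  generalize k + c • star l = k' at *
  have hpe := pPair_eq_pf₂ hl hli hk hki α
  have hb := neg_notMem_of_re hre him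
  have hbi : (-α).im ≠ 0 := by simpa using him
  set p := pf₂ l k' α with hpd
  set β := -α with hβ
  have hs : sMatᵀ * sMat = 1 := by rw [sMat_transpose, sMat_mul_self]
  have hl₁ := mulVec_ne_zero_of_orth hs hl
  have hk₁ := mulVec_ne_zero_of_orth hs hk
  have hl₁i : sMat *ᵥ l ⬝ᵥ sMat *ᵥ l = 0 := by rw [isG2_sMat.dot, hli]
  have hk₁i : sMat *ᵥ k' ⬝ᵥ sMat *ᵥ k' = 0 := by rw [isG2_sMat.dot, hki]
  set l₁ := sMat *ᵥ l with hl₁d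
  set k₁ := sMat *ᵥ k' with hk₁d
  have ho := hp.orth β hb
  set k₂ := p β *ᵥ k₁ with hk₂d
  have hk₂ : k₂ ≠ 0 := mulVec_ne_zero_of_orth ho hk₁
  have hk₂i : k₂ ⬝ᵥ k₂ = 0 := by rw [hk₂d, (orthogonal_iff _).2 ho, hk₁i]
  have hr := mReg_dress hbi (hp.reg _ β hb) (hp.tendsto hb) (hp.eventually_orth (by simp) β) hk₁ hk₁i
  rw [← hk₂d] at hr
  set h₁ := fun z => pf k₂ β z * p z * (pf k₁ β z)ᵀ with hh₁
  have hh : IsOrthLoop h₁ _ := ((isOrthLoop_pf hk₂ hk₂i β).mul hp).mul (isOrthLoop_pf hk₁ hk₁i β).transpose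
  have hho := hh.eventually_orth (by simp) β
  obtain ⟨V, hV⟩ := mReg_exists_tendsto nhdsWithin_le_nhds hr
  have hVo := orth_of_tendsto hV hho
  have hsK : sKPrime α (ln l) (ln k') = ln k₂ := by
    rw [sKPrime, hpe, matSub_ln, matSub_ln]
  -- The first dressing step guarantees that the limit exists, so `limUnder` is not a default value.
  have hdr : dressAt β (ln k₂) p = V :=
    (hV.congr' ((dress_eventuallyEq hp hb hk₁ hk₁i).mono fun z hz => hz.symm)).limUnder_eq
  have hsL : sLPrime α (ln l) (ln k') = ln (V *ᵥ l₁) := by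
    rw [sLPrime, hpe, matSub_ln, hsK, ← hβ, hdr, matSub_ln]
  have hl₂ := mulVec_ne_zero_of_orth hVo hl₁
  have hl₂i : V *ᵥ l₁ ⬝ᵥ V *ᵥ l₁ = 0 := by rw [(orthogonal_iff _).2 hVo, hl₁i]
  refine ⟨V *ᵥ l₁, k₂, hl₂, hl₂i, hk₂, hk₂i, ?_, ?_⟩
  · funext z
    rw [qPair, hpe, hsK, hsL, pPair_eq_pf₂ hl₂ hl₂i hk₂ hk₂i]
  · refine ((mReg_dress hbi hr hV hho hl₁ hl₁i).mono (nd_le_nhdsNE _)).congr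
      (Eventually.of_forall fun z => ?_)
    simp only [hh₁, pf₂, transpose_mul, Matrix.mul_assoc]

/-- Since `h` has at most a simple pole, some `𝔾₂`-valued factor `P₁` also makes `P₁ h` regular at
`β`. Then `P P₁⁻¹ = (P h) (P₁ h)⁻¹` has no poles at all and equals `1` by Liouville. -/
lemma isG2_of_mReg_mul {β : ℂ} (hβ : β.im ≠ 0) {P h : ℂ → Mat7}
    (hP : IsOrthLoop P {β, conj β}) (hh : ∀ᶠ z in nd β, IsG2 (h z)) (h1 : PoleLE h β 1)
    (hr : MReg (nd β) (fun z => P z * h z) β) : ∀ᶠ z in openDense, IsG2 (P z) := by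
  obtain ⟨P₁, ho, hg, hr₁⟩ : ∃ P₁, IsOrthLoop P₁ {β, conj β} ∧ (∀ᶠ z in openDense, IsG2 (P₁ z)) ∧
      MReg (nd β) (fun z => P₁ z * h z) β := by
    by_cases h0 : PoleLE h β (1 - 1)
    · refine ⟨fun _ => 1, .one, Eventually.of_forall fun _ => .one, ?_⟩
      simpa using poleLE_zero.1 h0
    · obtain ⟨L, K, hLK, hp, -⟩ := exists_pair_lowering (r := False) hβ le_rfl hh h1 h0 False.elim
      obtain ⟨l, k, c, hf, rfl, rfl⟩ := exists_frame_of_isPair hLK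
      rw [pPair_eq_pf₂ (ne_zero_of_norm hf.sll) hf.ll (hf.add_ne_zero c) (hf.add_isotropic c)] at hp
      refine ⟨_, hf.isOrthLoop c β, ?_, poleLE_zero.1 hp⟩
      filter_upwards [compl_finite_mem_openDense (P := {β, conj β}) (by simp)] with z hz
      rw [Set.mem_compl_iff, Set.mem_insert_iff, Set.mem_singleton_iff, not_or] at hz
      exact hf.isG2_pf₂ c hz.1 hz.2
  have hW := (hP.mul ho.transpose).mono (Q := {β, conj β}) (by simp)
  have hWr : MReg (nd β) (fun z => P z * (P₁ z)ᵀ) β := by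
    refine (hr.mul hr₁.transpose).congr ?_
    filter_upwards [hh] with z hz
    rw [transpose_mul, Matrix.mul_assoc, ← Matrix.mul_assoc (h z), hz.mul_transpose, Matrix.one_mul]
  have h1 := hW.eq_one (by
    rintro b (rfl | rfl)
    · exact hWr
    · exact hW.mReg_conj hWr)
  filter_upwards [h1, hg] with z h1 h2
  have : P z = P₁ z := by
    rw [← Matrix.mul_one (P z), ← h2.transpose_mul, ← Matrix.mul_assoc, h1, Matrix.one_mul]
  rwa [this]

/-- The quotient `W = q T⁻¹` satisfies `W(z) = (s W(-z) s)ᵀ` and is real, so regularity at `-α`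
spreads to all four possible poles. Liouville gives `W = 1`. -/
lemma twisted_of_mReg {q T : ℂ → Mat7} {α : ℂ}
    (hq : IsOrthLoop q {α, conj α, -α, -conj α}) (hT : T = fun z => sMat * q (-z) * sMat)
    (hr : MReg (nd (-α)) (fun z => q z * (T z)ᵀ) (-α)) :
    ∀ᶠ z in openDense, sMat * q (-z) * sMat = q z := by
  have hT' : IsOrthLoop T {α, conj α, -α, -conj α} := by
    rw [hT]
    refine hq.twist.mono fun z hz => ?_
    simp only [Set.mem_ofPred_eq, Set.mem_insert_iff, Set.mem_singleton_iff, neg_inj,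
      neg_eq_iff_eq_neg (a := z)] at hz ⊢
    tauto
  have hW := (hq.mul hT'.transpose).mono (Q := {α, conj α, -α, -conj α}) (by simp)
  have hsymm : ∀ z, q z * (T z)ᵀ = (sMat * (q (-z) * (T (-z))ᵀ) * sMat)ᵀ := fun z => by
    simp only [hT, transpose_mul, sMat_transpose, transpose_transpose, Matrix.mul_assoc, neg_neg]
    rw [← Matrix.mul_assoc sMat sMat, sMat_mul_self, Matrix.one_mul]
  have hra : MReg (nd α) (fun z => q z * (T z)ᵀ) α := by
    have := (((MReg.const sMat).mul hr.neg_arg).mul (MReg.const sMat)).transpose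
    rw [neg_neg] at this
    exact this.congr (Eventually.of_forall hsymm)
  have h1 := hW.eq_one (by
    rintro b (rfl | rfl | rfl | rfl)
    · exact hra
    · exact hW.mReg_conj hra
    · exact hr
    · simpa using hW.mReg_conj hr)
  filter_upwards [h1, compl_finite_mem_openDense (P := {α, conj α, -α, -conj α}) (by simp)]
    with z h1 h2
  have h3 := hT'.orth z h2
  have : T z = q z := by
    rw [← Matrix.one_mul (T z), ← h1, Matrix.mul_assoc, h3, Matrix.mul_one]
  rwa [hT] at this

theorem IsFrame.qPair_spec {l k : V7} (h : IsFrame l k) (c : ℂ) {α : ℂ} (hre : α.re ≠ 0)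
    (him : α.im ≠ 0) : ∃ v w : V7, v ≠ 0 ∧ v ⬝ᵥ v = 0 ∧ w ≠ 0 ∧ w ⬝ᵥ w = 0 ∧
      qPair α (ln l) (ln (k + c • star l)) =
        (fun z => pf₂ v w (-α) z * pf₂ l (k + c • star l) α z) ∧
      (∀ᶠ z in openDense, IsG2 (pf₂ v w (-α) z * pf₂ l (k + c • star l) α z)) ∧
      ∀ᶠ z in openDense, sMat * (pf₂ v w (-α) (-z) * pf₂ l (k + c • star l) α (-z)) * sMat =
        pf₂ v w (-α) z * pf₂ l (k + c • star l) α z := by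
  obtain ⟨v, w, hv, hvi, hw, hwi, e, hr⟩ := h.exists_qPair_eq c hre him
  have hb := neg_notMem_of_re hre him
  have hbi : (-α).im ≠ 0 := by simpa using him
  have hP := isOrthLoop_pf₂ hv hvi hw hwi (-α)
  have hp := h.isOrthLoop c α
  have hsk : sMat *ᵥ (k + c • star l) = sMat *ᵥ k + c • star (sMat *ᵥ l) := by
    rw [mulVec_add, mulVec_smul, star_sMat_mulVec]
  have hq := (hP.mul hp).mono (Q := {α, conj α, -α, -conj α}) (by
    rw [map_neg]
    intro z hz
    simp only [Set.mem_union, Set.mem_insert_iff, Set.mem_singleton_iff] at hz ⊢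
    tauto)
  have hpg : ∀ᶠ z in openDense, IsG2 (pf₂ l (k + c • star l) α z) := by
    filter_upwards [compl_finite_mem_openDense (P := {α, conj α}) (by simp)] with z hz
    rw [Set.mem_compl_iff, Set.mem_insert_iff, Set.mem_singleton_iff, not_or] at hz
    exact h.isG2_pf₂ c hz.1 hz.2
  refine ⟨v, w, hv, hvi, hw, hwi, e, ?_, ?_⟩
  · have hPg := isG2_of_mReg_mul hbi hP (h := fun z => pf₂ l (k + c • star l) α z *
      (pf₂ (sMat *ᵥ l) (sMat *ᵥ (k + c • star l)) (-α) z)ᵀ) ?_ ?_ ?_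
    · filter_upwards [hPg, hpg] with z h1 h2 using h1.mul h2
    · filter_upwards [nd_le_openDense _ hpg, nd_le_openDense _
        (compl_finite_mem_openDense (P := {-α, conj (-α)}) (by simp))] with z h1 h2
      rw [Set.mem_compl_iff, Set.mem_insert_iff, Set.mem_singleton_iff, not_or] at h2
      rw [hsk]
      exact h1.mul (h.smat.isG2_pf₂ c h2.1 h2.2).transpose
    · rw [hsk]
      have := MReg.transpose (h.smat.poleLE_pf₂ c hbi)
      have h3 : PoleLE (fun z => (pf₂ (sMat *ᵥ l) (sMat *ᵥ k + c • star (sMat *ᵥ l)) (-α) z)ᵀ) (-α) 1 :=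
        this.congr (Eventually.of_forall fun z => by rw [transpose_smul])
      exact h3.mul_left (hp.reg _ _ hb)
    · exact hr.congr (Eventually.of_forall fun z => by simp only [Matrix.mul_assoc])
  · refine twisted_of_mReg (q := fun z => pf₂ v w (-α) z * pf₂ l (k + c • star l) α z)
      (T := fun z => sMat * (pf₂ v w (-α) (-z) * pf₂ l (k + c • star l) α (-z)) * sMat)
      hq rfl ?_
    -- `T` is the twist of `P` times `p_{-α,sL,sK}`. The twist of `P` has its poles at `α, ᾱ`, so it
    -- does not disturb regularity at `-α`.
    have hS := hP.twist.reg (nd (-α)) (-α) (by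
      simp only [Set.mem_ofPred_eq, Set.mem_insert_iff, Set.mem_singleton_iff, neg_neg, map_neg] at hb ⊢
      rw [eq_comm, eq_neg_iff_add_eq_zero, ← neg_eq_iff_add_eq_zero]
      exact fun h => hb (h.imp id id))
    refine (hr.mul hS.transpose).congr (Eventually.of_forall fun z => ?_)
    rw [← pf₂_twist]
    simp only [transpose_mul, sMat_transpose, Matrix.mul_assoc]
    rw [← Matrix.mul_assoc sMat sMat, sMat_mul_self, Matrix.one_mul]

/-! ### The elements `p_{β,M,N}` -/

/-- Twisting replaces the line by its conjugate and `β` by `-β = β̄`. Each change inverts the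
eigenvalue `u`, so together they cancel. -/
lemma pf_twist_of_imaginary {w : V7} (hw : w ≠ 0) (h : matSub sMat (ln w) = conjSub (ln w)) {β : ℂ}
    (hβ : β.re = 0) (z : ℂ) : sMat * pf w β (-z) * sMat = pf w β z := by
  rw [matSub_ln, conjSub_ln] at h
  obtain ⟨a, ha, e⟩ := exists_smul_of_ln_eq
    (mulVec_ne_zero_of_orth (by rw [sMat_transpose, sMat_mul_self]) hw) h
  have hc : conj β = -β := by apply Complex.ext <;> simp [hβ]
  rw [pf_twist, e, pf, pf, pv_smul ha, pv_star, inv_div, map_neg, hc, neg_neg]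

/-! ### Loops from matrix valued functions -/

/-- All entries of `F` are meromorphic at `b`. -/
def MMero (F : ℂ → Mat7) (b : ℂ) : Prop := ∀ i j, MeromorphicAt (fun z => F z i j) b

lemma MMero.mul {F G : ℂ → Mat7} {b : ℂ} (hF : MMero F b) (hG : MMero G b) :
    MMero (fun z => F z * G z) b := fun i j => by
  simp only [mul_apply]
  exact MeromorphicAt.fun_sum fun k _ => (hF i k).mul (hG k j)

lemma mMero_pf (w : V7) (α b : ℂ) : MMero (pf w α) b := fun i j => by
  have h1 : MeromorphicAt (fun z : ℂ => (z - conj α) / (z - α)) b := by fun_prop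
  simp only [pf, pv, Matrix.add_apply, Matrix.smul_apply, smul_eq_mul]
  fun_prop

lemma mReg_pf_inv (w : V7) (α : ℂ) : MReg (𝓝[≠] 0) (fun z => pf w α z⁻¹) 0 := by
  have key : ∀ a b : ℂ, RegAt (𝓝[≠] 0) (fun z : ℂ => (z⁻¹ - a) / (z⁻¹ - b)) 0 := fun a b => by
    refine ⟨fun z => (1 - a * z) / (1 - b * z), ?_, ?_⟩
    · refine AnalyticAt.div (by fun_prop) (by fun_prop) (by simp)
    · filter_upwards [self_mem_nhdsWithin] with z hz
      have hz : z ≠ 0 := hz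
      rw [← mul_div_mul_left _ _ hz, mul_sub, mul_sub, mul_inv_cancel₀ hz, mul_comm z, mul_comm z]
  refine mReg_pv w (key _ _) ?_
  simp only [inv_div]
  exact key _ _

open Classical in
/-- The loop with matrix `F z` outside of `P`. -/
def toGL (F : ℂ → Mat7) (z : ℂ) : GL (Fin 7) ℂ :=
  -- At a pole, division by zero yields a meaningless matrix, possibly singular; the value `1` used
  -- there does not affect the germ.
  if h : (F z)ᵀ * F z = 1 then ⟨F z, (F z)ᵀ, mul_eq_one_comm.1 h, h⟩ else 1

lemma toGL_val {F : ℂ → Mat7} {z : ℂ} (h : (F z)ᵀ * F z = 1) : (toGL F z).val = F z := by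
  rw [toGL, dif_pos h]

lemma tau_val (A : GL (Fin 7) ℂ) : (tau A).val = A.val.map star := rfl

lemma sigma_val (A : GL (Fin 7) ℂ) : (sigma A).val = sMat * A.val * sMat := rfl

lemma represents_coe {F : ℂ → Mat7} {f : ℂ → GL (Fin 7) ℂ} :
    Represents F (f : Loop) ↔ ∀ᶠ z in openDense, (f z).val = F z := Germ.coe_eq

lemma tendsto_inv_nhdsNE_cocompact : Tendsto (fun w : ℂ => w⁻¹) (𝓝[≠] 0) (cocompact ℂ) := by
  rw [← Metric.cobounded_eq_cocompact]
  exact tendsto_inv₀_nhdsNE_zero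

theorem exists_represents {F : ℂ → Mat7} {P : Set ℂ} (hF : IsOrthLoop F P) (hP : P.Finite)
    (hm : ∀ b, MMero F b) (hi : MReg (𝓝[≠] 0) (fun w => F w⁻¹) 0)
    (hg : ∀ᶠ z in openDense, IsG2 (F z)) (ht : ∀ᶠ z in openDense, sMat * F (-z) * sMat = F z) :
    ∃ γ ∈ twistedLoopGroup, Represents F γ := by
  have hval : ∀ z ∉ P, (toGL F z).val = F z := fun z hz => toGL_val (hF.orth z hz)
  have hev : ∀ᶠ z in openDense, (toGL F z).val = F z := by
    filter_upwards [compl_finite_mem_openDense hP] with z hz using hval z hz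
  have hm' : ∀ b, MMero (fun z => (toGL F z).val) b := fun b i j =>
    (hm b i j).congr ((eventually_notMem_nhdsNE hP b).mono fun z hz => by
      simp only [hval z hz])
  have hana : ∀ i j, AnalyticAt ℂ (fun w => (atInfty (toGL F) w).val i j) 0 := by
    intro i j
    obtain ⟨u, hu, e⟩ := hi i j
    refine hu.congr ?_
    have h1 : ∀ᶠ w in 𝓝[≠] (0 : ℂ), u w = (atInfty (toGL F) w).val i j := by
      filter_upwards [e, self_mem_nhdsWithin,
        tendsto_inv_nhdsNE_cocompact hP.isCompact.compl_mem_cocompact] with w h1 h2 h3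
      rw [atInfty, Function.update_of_ne h2, hval _ h3, ← h1]
    -- The value `1` prescribed at `∞` agrees with the analytic extension because the limit of `F`
    -- at infinity is `1`.
    have h2 : u 0 = (atInfty (toGL F) 0).val i j := by
      rw [atInfty, Function.update_self]
      exact tendsto_nhds_unique ((hu.continuousAt.tendsto.mono_left nhdsWithin_le_nhds).congr' e.symm)
        ((hF.lim i j).comp tendsto_inv_nhdsNE_cocompact)
    rw [eventually_nhdsWithin_iff] at h1
    filter_upwards [h1] with w hw
    by_cases h0 : w = 0
    · rw [h0, h2]
    · exact hw h0
  refine ⟨(toGL F : Loop), ⟨toGL F, rfl, ?_, ⟨hm', fun i j => ?_⟩, ?_, ?_, hana⟩,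
    represents_coe.2 hev⟩
  · obtain ⟨U, hU, hUo, hUd⟩ := hg
    obtain ⟨W, hW, hWo, hWd⟩ := compl_finite_mem_openDense hP
    refine ⟨U ∩ W, hUo.inter hWo, hUd.inter_of_isOpen_left hWd hUo, fun z hz => ?_, fun i j z hz => ?_⟩
    · rw [mem_G2_iff, hval z (hW hz.2)]
      exact hU hz.1
    · obtain ⟨u, hu, e⟩ := hF.reg (𝓝 z) z (hW hz.2) i j
      refine (hu.differentiableAt.congr_of_eventuallyEq ?_).differentiableWithinAt
      filter_upwards [e, hWo.mem_nhds hz.2] with w h1 h2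
      rw [← h1, hval w (hW h2)]
  · refine (hana i j).meromorphicAt.congr ?_
    filter_upwards [self_mem_nhdsWithin] with w hw
    rw [atInfty, Function.update_of_ne hw]
  · filter_upwards [hev, tendsto_conj_openDense.eventually hev] with z h1 h2
    refine Units.ext ?_
    rw [tau_val, h2, h1, hF.real]
  · filter_upwards [hev, tendsto_neg_openDense.eventually hev, ht] with z h1 h2 h3
    refine Units.ext ?_
    rw [sigma_val, h2, h1, h3]

lemma mMero_pf₂ (v w : V7) (α b : ℂ) : MMero (pf₂ v w α) b := (mMero_pf v α b).mul (mMero_pf w α b)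

lemma mReg_pf₂_inv (v w : V7) (α : ℂ) : MReg (𝓝[≠] 0) (fun z => pf₂ v w α z⁻¹) 0 :=
  (mReg_pf_inv v α).mul (mReg_pf_inv w α)

theorem exists_represents_of_pFamily {F : ℂ → Mat7} (h : F ∈ pFamily) :
    ∃ γ ∈ twistedLoopGroup, Represents F γ := by
  obtain ⟨β, M, N, hβ, -, hMN, hM, hN, rfl⟩ := h
  obtain ⟨l, k, c, hf, rfl, rfl⟩ := exists_frame_of_isPair hMN
  have hl := ne_zero_of_norm hf.sll
  have hk := hf.add_ne_zero c
  rw [pPair_eq_pf₂ hl hf.ll hk (hf.add_isotropic c)]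
  refine exists_represents (hf.isOrthLoop c β) (by simp) (mMero_pf₂ _ _ _) (mReg_pf₂_inv _ _ _) ?_
    (Eventually.of_forall fun z => ?_)
  · filter_upwards [compl_finite_mem_openDense (P := {β, conj β}) (by simp)] with z hz
    rw [Set.mem_compl_iff, Set.mem_insert_iff, Set.mem_singleton_iff, not_or] at hz
    exact hf.isG2_pf₂ c hz.1 hz.2
  · rw [pf₂, pf₂, ← pf_twist_of_imaginary hl hM hβ z, ← pf_twist_of_imaginary hk hN hβ z]
    simp only [Matrix.mul_assoc]
    rw [← Matrix.mul_assoc sMat sMat, sMat_mul_self, Matrix.one_mul]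

theorem exists_represents_of_qFamily {F : ℂ → Mat7} (h : F ∈ qFamily) :
    ∃ γ ∈ twistedLoopGroup, Represents F γ := by
  obtain ⟨α, L, K, hre, him, hLK, rfl⟩ := h
  obtain ⟨l, k, c, hf, rfl, rfl⟩ := exists_frame_of_isPair hLK
  obtain ⟨v, w, hv, hvi, hw, hwi, e, hg, ht⟩ := hf.qPair_spec c hre him
  rw [e]
  exact exists_represents ((isOrthLoop_pf₂ hv hvi hw hwi (-α)).mul (hf.isOrthLoop c α)) (by simp)
    (fun b => (mMero_pf₂ _ _ _ b).mul (mMero_pf₂ _ _ _ b))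
    ((mReg_pf₂_inv _ _ _).mul (mReg_pf₂_inv _ _ _)) hg ht

/-! ### Poles of loops -/

/-- A real loop in `𝔾₂` has no real poles. -/
lemma poleLE_pred_of_real {g : ℂ → Mat7} {a : ℂ} (ha : a.im = 0) {n : ℕ} (hn : 1 ≤ n)
    (hG : ∀ᶠ z in openDense, IsG2 (g z)) (hr : ∀ᶠ z in openDense, (g (conj z)).map star = g z)
    (hP : PoleLE g a n) : PoleLE g a (n - 1) := by
  obtain ⟨A, B, R, hRa, hexp⟩ := MReg.expansion hP
  have hRm : MReg (nd a) R a := fun i j => regAt_of_analyticAt (hRa i j)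
  have hR : ContinuousAt R a :=
    continuousAt_pi.2 fun i => continuousAt_pi.2 fun j => (hRa i j).continuousAt
  by_contra hP'
  have hA : A ≠ 0 := by
    rintro rfl
    exact hP' (poleLE_pred_of_expansion hn hRm (by simpa using hexp))
  have hL := isLeading_of_expansion hn hR (nd_le_openDense a hG) hexp hA
  have hca : conj a = a := Complex.conj_eq_iff_im.2 ha
  have hc : ContinuousAt (fun z => A + (z - a) • B + (z - a) ^ 2 • R z) a := by fun_prop
  have t1 : Tendsto (fun z => (z - a) ^ n • g z) (nd a) (𝓝 A) := by
    have h1 : Tendsto (fun z => A + (z - a) • B + (z - a) ^ 2 • R z) (nd a)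
      (𝓝 (A + (a - a) • B + (a - a) ^ 2 • R a)) := hc.tendsto.mono_left (nd_le_nhds a)
    rw [sub_self, zero_smul, add_zero, zero_pow two_ne_zero, zero_smul, add_zero] at h1
    exact h1.congr' (hexp.mono fun z hz => hz.symm)
  have ht := tendsto_conj_nd a
  rw [hca] at ht
  have hmap : Continuous fun M : Mat7 => M.map star := continuous_id.matrix_map continuous_star
  -- At a real point the leading coefficient is a real matrix, so its isotropic columns vanish.
  have hAr : A.map star = A := by
    refine tendsto_nhds_unique_of_eventuallyEq ((hmap.tendsto A).comp (t1.comp ht)) t1 ?_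
    filter_upwards [nd_le_openDense a hr] with z hz
    ext i j
    have := congrFun (congrFun hz i) j
    have h2 : star a = a := hca
    simp only [Function.comp, map_apply, Matrix.smul_apply, smul_eq_mul, star_mul', star_pow,
      star_sub, h2] at this ⊢
    rw [this]
    congr 3
    exact star_star z
  apply hA
  ext i j
  have h1 := hL.dot₀ (Pi.single j 1) (Pi.single j 1)
  have h2 : star (A *ᵥ Pi.single j 1) = A *ᵥ Pi.single j 1 := by
    ext m
    have := congrFun (congrFun hAr m) j
    simpa using this
  have h3 : A *ᵥ Pi.single j 1 = 0 := by
    by_contra h0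
    exact norm_ne_zero h0 (by rw [h2, h1])
  simpa using congrFun h3 i

lemma exists_poleLE {g : ℂ → Mat7} {b : ℂ} (h : MMero g b) : ∃ n, PoleLE g b n := by
  choose n hn using h
  refine ⟨∑ i, ∑ j, n i j, fun i j => ?_⟩
  have hle : n i j ≤ ∑ i, ∑ j, n i j :=
    (Finset.single_le_sum (f := fun j => n i j) (fun _ _ => Nat.zero_le _) (Finset.mem_univ j)).trans
      (Finset.single_le_sum (f := fun i => ∑ j, n i j) (fun _ _ => Nat.zero_le _) (Finset.mem_univ i))
  refine ((regAt_sub_pow (nd b) b b (∑ i, ∑ j, n i j - n i j)).mul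
    (regAt_of_analyticAt (hn i j))).congr (Eventually.of_forall fun z => ?_)
  simp only [Matrix.smul_apply, smul_eq_mul]
  rw [← mul_assoc, ← pow_add, Nat.sub_add_cancel hle]

/-- Holomorphy at `∞` keeps the poles in a compact set, where they are isolated. -/
lemma finite_poles {f : ℂ → GL (Fin 7) ℂ} (hf : IsRational f) (hi : IsNegative f) :
    {b | ¬PoleLE (fun z => (f z).val) b 0}.Finite := by
  set g : ℂ → Mat7 := fun z => (f z).val with hg
  have hreg : ∀ b, (∀ i j, AnalyticAt ℂ (fun z => g z i j) b) → PoleLE g b 0 := fun b hb =>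
    poleLE_zero.2 fun i j => regAt_of_analyticAt (hb i j)
  have hinf : ∀ᶠ z in cocompact ℂ, PoleLE g z 0 := by
    have h1 : ∀ᶠ w in 𝓝 (0 : ℂ), ∀ i j, AnalyticAt ℂ (fun w => (atInfty f w).val i j) w :=
      eventually_all.2 fun i => eventually_all.2 fun j => (hi i j).eventually_analyticAt
    have ht : Tendsto (fun z : ℂ => z⁻¹) (cocompact ℂ) (𝓝 0) := by
      rw [← Metric.cobounded_eq_cocompact]
      exact tendsto_inv₀_cobounded
    have h0 : ({0}ᶜ : Set ℂ) ∈ cocompact ℂ := isCompact_singleton.compl_mem_cocompact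
    filter_upwards [ht.eventually h1, h0] with z hz hz0
    have hz0 : z ≠ 0 := hz0
    refine hreg z fun i j => ?_
    have h2 := AnalyticAt.comp (g := fun w => (atInfty f w).val i j) (f := fun z : ℂ => z⁻¹) (hz i j)
      (analyticAt_id.inv hz0)
    refine h2.congr ?_
    filter_upwards [isOpen_compl_singleton.mem_nhds hz0] with w hw
    have hw : w ≠ 0 := hw
    simp only [Function.comp, atInfty, Function.update_of_ne (inv_ne_zero hw), inv_inv, hg]
  obtain ⟨K, hK, hKs⟩ := mem_cocompact.1 hinf
  have hfin : (K ∩ {b | ¬PoleLE g b 0}).Finite := by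
    refine hK.induction_on (p := fun s => (s ∩ {b | ¬PoleLE g b 0}).Finite) (by simp)
      (fun s t hst ht => ht.subset (Set.inter_subset_inter_left _ hst))
      (fun s t hs ht => by rw [Set.union_inter_distrib_right]; exact hs.union ht) fun b _ => ?_
    have h1 : ∀ᶠ z in 𝓝[≠] b, ∀ i j, AnalyticAt ℂ (fun z => g z i j) z :=
      eventually_all.2 fun i => eventually_all.2 fun j => (hf.1 b i j).eventually_analyticAt
    rw [eventually_nhdsWithin_iff] at h1
    refine ⟨_, mem_nhdsWithin_of_mem_nhds h1, (Set.finite_singleton b).subset ?_⟩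
    rintro z ⟨hz, hz'⟩
    by_contra hne
    exact hz' (hreg z (hz hne))
  refine hfin.subset fun b hb => ⟨?_, hb⟩
  by_contra hbK
  exact hb (hKs hbK)

/-- The multiset records bounds for all pole orders at once; its cardinality is the measure for the
final induction. -/
lemma exists_multiset_poleLE {f : ℂ → GL (Fin 7) ℂ} (hf : IsRational f) (hi : IsNegative f) :
    ∃ S : Multiset ℂ, ∀ b, PoleLE (fun z => (f z).val) b (S.count b) := by
  classical
  choose N hN using fun b => exists_poleLE (g := fun z => (f z).val) (b := b) (hf.1 b)
  refine ⟨∑ b ∈ (finite_poles hf hi).toFinset, Multiset.replicate (N b) b, fun b => ?_⟩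
  rw [Multiset.count_sum']
  simp only [Multiset.count_replicate, Finset.sum_ite_eq', Set.Finite.mem_toFinset]
  split_ifs with h
  · exact hN b
  · by_contra h'
    exact h h'

/-! ### Generation -/

/-- The properties of the matrix valued functions that represent elements of the loop group. -/
structure IsLoop (g : ℂ → Mat7) : Prop where
  isG2 : ∀ᶠ z in openDense, IsG2 (g z)
  real : ∀ᶠ z in openDense, (g (conj z)).map star = g z
  twisted : ∀ᶠ z in openDense, sMat * g (-z) * sMat = g z
  lim : ∀ i j, Tendsto (fun z => g z i j) (cocompact ℂ ⊓ openDense) (𝓝 ((1 : Mat7) i j))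

lemma exists_isLoop {γ : Loop} (hγ : γ ∈ twistedLoopGroup) : ∃ g, Represents g γ ∧ IsLoop g ∧
    ∃ S : Multiset ℂ, ∀ b, PoleLE g b (S.count b) := by
  obtain ⟨f, rfl, ⟨U, hUo, hUd, hU, -⟩, hrat, hreal, htw, hneg⟩ := hγ
  refine ⟨fun z => (f z).val, represents_coe.2 (Eventually.of_forall fun _ => rfl), ⟨?_, ?_, ?_, ?_⟩,
    exists_multiset_poleLE hrat hneg⟩
  · exact ⟨U, fun z hz => (mem_G2_iff _).1 (hU z hz), hUo, hUd⟩
  · filter_upwards [hreal] with z hz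
    rw [← hz, tau_val]
  · filter_upwards [htw] with z hz
    rw [← hz, sigma_val]
  · intro i j
    have h1 := (hneg i j).continuousAt.tendsto
    rw [atInfty, Function.update_self] at h1
    have ht : Tendsto (fun z : ℂ => z⁻¹) (cocompact ℂ) (𝓝 0) := by
      rw [← Metric.cobounded_eq_cocompact]
      exact tendsto_inv₀_cobounded
    have h0 : ({0}ᶜ : Set ℂ) ∈ cocompact ℂ := isCompact_singleton.compl_mem_cocompact
    refine ((h1.comp ht).congr' ?_).mono_left inf_le_left
    filter_upwards [h0] with z hz
    have hz : z ≠ 0 := hz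
    simp only [Function.comp, Function.update_of_ne (inv_ne_zero hz), inv_inv]

lemma Represents.mul {F G : ℂ → Mat7} {γ δ : Loop} (h : Represents F γ) (h' : Represents G δ) :
    Represents (fun z => F z * G z) (γ * δ) := by
  induction γ using Germ.inductionOn with | _ f
  induction δ using Germ.inductionOn with | _ f'
  rw [represents_coe] at h h'
  refine represents_coe.2 ?_
  filter_upwards [h, h'] with z h1 h2
  simp [h1, h2]

lemma Represents.eventuallyEq {F G : ℂ → Mat7} {γ : Loop} (h : Represents F γ)
    (h' : Represents G γ) : ∀ᶠ z in openDense, F z = G z := Germ.coe_eq.1 (h.symm.trans h')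

lemma Represents.eq_one {F : ℂ → Mat7} {γ : Loop} (h : Represents F γ)
    (h1 : ∀ᶠ z in openDense, F z = 1) : γ = 1 := by
  induction γ using Germ.inductionOn with | _ f
  rw [represents_coe] at h
  refine Germ.coe_eq.2 ?_
  filter_upwards [h, h1] with z h1 h2
  exact Units.ext (h1.trans h2)

lemma IsLoop.congr {g g' : ℂ → Mat7} (h : IsLoop g) (e : ∀ᶠ z in openDense, g z = g' z) :
    IsLoop g' where
  isG2 := by filter_upwards [h.isG2, e] with z h1 h2 using h2 ▸ h1
  real := by
    filter_upwards [h.real, e, tendsto_conj_openDense.eventually e] with z h1 h2 h3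
    rw [← h2, ← h3, h1]
  twisted := by
    filter_upwards [h.twisted, e, tendsto_neg_openDense.eventually e] with z h1 h2 h3
    rw [← h2, ← h3, h1]
  lim i j := (h.lim i j).congr' (inf_le_right (a := cocompact ℂ)
    (e.mono fun z hz => by simp only [hz]))

/-- The loops of the two families. -/
def simpleLoops : Set Loop := {γ | ∃ F ∈ pFamily ∪ qFamily, Represents F γ}

lemma mem_twistedLoopGroup_of_family {F : ℂ → Mat7} (hF : F ∈ pFamily ∪ qFamily) :
    ∃ γ ∈ twistedLoopGroup, Represents F γ :=
  hF.elim exists_represents_of_pFamily exists_represents_of_qFamily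

/-- A pole outside of the real line is lowered by an element of one of the families, which does
not introduce new poles. -/
lemma exists_family_lowering {g : ℂ → Mat7} (hg : IsLoop g) {α : ℂ} (hα : α.im ≠ 0) {n : ℕ}
    (hn : 1 ≤ n) (hP : PoleLE g α n) (hP' : ¬PoleLE g α (n - 1)) :
    ∃ F ∈ pFamily ∪ qFamily, PoleLE (fun z => F z * g z) α (n - 1) ∧
      ∀ b, b ∉ ({α, conj α, -α, -conj α} : Set ℂ) → MReg (nd b) F b := by
  by_cases hre : α.re = 0
  · obtain ⟨L, K, hLK, hlow, hs⟩ := exists_pair_lowering (r := True) hα hn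
      -- Reality and twisting combine to the symmetry under `z ↦ -z̄`, which fixes the imaginary
      -- point `α`.
      (nd_le_openDense _ hg.isG2) hP hP' (fun _ => ⟨hre, by
        have h1 := tendsto_neg_openDense.eventually hg.real
        filter_upwards [nd_le_openDense α h1, nd_le_openDense α hg.twisted] with z h1 h2
        rw [map_neg] at h1
        rw [h1, ← h2]
        simp only [Matrix.mul_assoc, sMat_mul_self, Matrix.mul_one]
        rw [← Matrix.mul_assoc, sMat_mul_self, Matrix.one_mul]⟩)
    refine ⟨pPair α L K, Or.inl ⟨α, L, K, hre, hα, hLK, (hs trivial).1, (hs trivial).2, rfl⟩, hlow,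
      fun b hb => ?_⟩
    obtain ⟨l, k, c, hf, rfl, rfl⟩ := exists_frame_of_isPair hLK
    rw [pPair_eq_pf₂ (ne_zero_of_norm hf.sll) hf.ll (hf.add_ne_zero c) (hf.add_isotropic c)]
    refine (hf.isOrthLoop c α).reg _ b fun h => hb ?_
    simp only [Set.mem_insert_iff, Set.mem_singleton_iff] at h ⊢
    tauto
  · obtain ⟨L, K, hLK, hlow, -⟩ := exists_pair_lowering (r := False) hα hn
      (nd_le_openDense _ hg.isG2) hP hP' False.elim
    refine ⟨qPair α L K, Or.inr ⟨α, L, K, hre, hα, hLK, rfl⟩, ?_⟩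
    obtain ⟨l, k, c, hf, rfl, rfl⟩ := exists_frame_of_isPair hLK
    obtain ⟨v, w, hv, hvi, hw, hwi, e, -, -⟩ := hf.qPair_spec c hre hα
    have hQ := isOrthLoop_pf₂ hv hvi hw hwi (-α)
    rw [e]
    constructor
    · rw [pPair_eq_pf₂ (ne_zero_of_norm hf.sll) hf.ll (hf.add_ne_zero c) (hf.add_isotropic c)] at hlow
      -- The left factor of `q` has its poles at `-α` and `-ᾱ` only, so it does not undo the
      -- lowering at `α`.
      have hb : α ∉ ({-α, conj (-α)} : Set ℂ) := by
        have := neg_notMem_of_re (α := -α) (by simpa using hre) (by simpa using hα)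
        rwa [neg_neg] at this
      exact (hlow.mul_left (hQ.reg _ α hb)).congr
        (Eventually.of_forall fun z => by simp only [Matrix.mul_assoc])
    · intro b hb
      refine (hQ.mul (hf.isOrthLoop c α)).reg _ b fun h => hb ?_
      rw [map_neg] at h
      simp only [Set.mem_union, Set.mem_insert_iff, Set.mem_singleton_iff] at h ⊢
      tauto

/-- Pole orders are constant on the orbit of `α` under conjugation and sign. The order of the new
loop at `α` thus controls all points where the added factor may have poles. -/
lemma poleLE_iff_of_mem {g : ℂ → Mat7} (hg : IsLoop g) {α b : ℂ} {n : ℕ}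
    (hb : b ∈ ({α, conj α, -α, -conj α} : Set ℂ)) : PoleLE g b n ↔ PoleLE g α n := by
  have hr : ∀ a, PoleLE g (conj a) n ↔ PoleLE g a n := fun a =>
    ⟨fun h => by simpa using h.real hg.real, fun h => h.real hg.real⟩
  have ht : ∀ a, PoleLE g (-a) n ↔ PoleLE g a n := fun a =>
    ⟨fun h => by simpa using h.twisted hg.twisted, fun h => h.twisted hg.twisted⟩
  rcases hb with rfl | rfl | rfl | rfl
  · rfl
  · exact hr α
  · exact ht α
  · rw [ht, hr]

theorem mem_closure_of_poleLE (S : Multiset ℂ) : ∀ {γ : Loop} {g : ℂ → Mat7},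
    γ ∈ twistedLoopGroup → Represents g γ → IsLoop g → (∀ b, PoleLE g b (S.count b)) →
      γ ∈ Subgroup.closure simpleLoops := by
  induction hcard : S.card generalizing S with
  | zero =>
    intro γ g _ hrep hg hS
    rw [Multiset.card_eq_zero.1 hcard] at hS
    have h1 := eventually_eq_one_of_mReg (fun b => poleLE_zero.1 (by simpa using hS b)) hg.lim
    rw [hrep.eq_one h1]
    exact one_mem _
  | succ N ih =>
    intro γ g hγ hrep hg hS
    obtain ⟨α, hα⟩ : ∃ α, α ∈ S := Multiset.card_pos_iff_exists_mem.1 (by omega)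
    have hn : 1 ≤ S.count α := Multiset.one_le_count_iff_mem.2 hα
    have hc : (S.erase α).card = N := by rw [Multiset.card_erase_of_mem hα, hcard]; rfl
    -- If the bound at `α` is not sharp, one copy of `α` is dropped without changing the loop.
    -- Otherwise `α` is a pole of exact order `S.count α`.
    by_cases hP' : PoleLE g α (S.count α - 1)
    · refine ih _ hc hγ hrep hg fun b => ?_
      by_cases hb : b = α
      · rw [hb, Multiset.count_erase_self]; exact hP'
      · rw [Multiset.count_erase_of_ne hb]; exact hS b
    have him : α.im ≠ 0 := fun h => hP' (poleLE_pred_of_real h hn hg.isG2 hg.real (hS α))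
    obtain ⟨F, hF, hlow, hreg⟩ := exists_family_lowering hg him hn (hS α) hP'
    obtain ⟨θ, hθ, hFθ⟩ := mem_twistedLoopGroup_of_family hF
    have hmem := mul_mem hθ hγ
    have hrep' := hFθ.mul hrep
    have hg' : IsLoop fun z => F z * g z := by
      obtain ⟨g', hr', hg', -⟩ := exists_isLoop hmem
      exact hg'.congr (hr'.eventuallyEq hrep')
    have hcl : θ * γ ∈ Subgroup.closure simpleLoops := by
      refine ih _ hc hmem hrep' hg' fun b => ?_
      by_cases hb : b ∈ ({α, conj α, -α, -conj α} : Set ℂ)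
      · refine ((poleLE_iff_of_mem hg' hb).2 hlow).mono ?_
        by_cases hbα : b = α
        · rw [hbα, Multiset.count_erase_self]
        · rw [Multiset.count_erase_of_ne hbα]
          -- A smaller bound at another point of the orbit would, by symmetry, contradict the
          -- sharpness at `α`.
          by_contra! hlt
          exact hP' ((poleLE_iff_of_mem hg hb).1 ((hS b).mono hlt.le))
      · have hbα : b ≠ α := fun h => hb (Or.inl h)
        rw [Multiset.count_erase_of_ne hbα]
        exact (hS b).mul_left (hreg b hb)
    have hθc : θ ∈ Subgroup.closure simpleLoops := Subgroup.subset_closure ⟨F, hF, hFθ⟩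
    exact (Subgroup.mul_mem_cancel_left _ hθc).1 hcl

theorem closure_simpleLoops : Subgroup.closure simpleLoops = twistedLoopGroup := by
  refine le_antisymm ((Subgroup.closure_le _).2 ?_) fun γ hγ => ?_
  · rintro γ ⟨F, hF, hr⟩
    obtain ⟨δ, hδ, hr'⟩ := mem_twistedLoopGroup_of_family hF
    have : γ = δ := by
      induction γ using Germ.inductionOn with | _ f
      induction δ using Germ.inductionOn with | _ f'
      rw [represents_coe] at hr hr'
      refine Germ.coe_eq.2 ?_
      filter_upwards [hr, hr'] with z h1 h2
      exact Units.ext (h1.trans h2.symm)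
    rw [this]
    exact hδ
  · obtain ⟨g, hr, hg, S, hS⟩ := exists_isLoop hγ
    exact mem_closure_of_poleLE S hγ hr hg hS

end G2Loop

end

theorem mainTheorem6 :
    (∀ F ∈ G2Loop.pFamily ∪ G2Loop.qFamily, ∃ γ ∈ G2Loop.twistedLoopGroup, G2Loop.Represents F γ) ∧
    Subgroup.closure {γ : G2Loop.Loop | ∃ F ∈ G2Loop.pFamily ∪ G2Loop.qFamily, G2Loop.Represents F γ}
      = G2Loop.twistedLoopGroup :=
  ⟨fun _ hF => G2Loop.mem_twistedLoopGroup_of_family hF, G2Loop.closure_simpleLoops⟩
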